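/- Let $p\ge 2$ be an integer and let $G=BS(1,p)=\langle a,t\mid tat^{-1}=a^p\rangle$. A word over $\{a,a^{-1},t,t^{-1}\}$ is \emph{geodesic} if no shorter word represents the same element of $G$, and the \emph{geodesic length} of a word $w$ is the least length of a word representing the same element of $G$ as $w$. The computational model is the random access machine: registers $X_0,X_1,\dots$ holding integers, initially $0$; a read-only input tape read from left to right (one letter per symbol) and a write-only output tape; a program is a finite list of instructions, each taking one unit of time, of the forms $X_i\leftarrow c$, $X_i\leftarrow X_j\pm X_k$, $X_i\leftarrow X_{X_j}$, $X_{X_i}\leftarrow X_j$, jump to instruction $m$ if $X_j>0$, read a symbol into $X_i$, print $X_i$; the machine halts when no instruction is left. The space used is the maximum, over all times, of the number of bits needed to write down the addresses and contents of all non-zero registers. In all the claims below, the registers hold at all times integers of only $O(\log n)$ bits, where $n$ is the length of the input. Then: \begin{enumerate} \item There is a (deterministic) random access machine program which, given any word $w$ of length $n$ over $\{a^{\pm1},t^{\pm1}\}$, outputs a geodesic word representing the same element of $G$ as $w$, in $O(n)$ time and $O(n\log n)$ space. \item Consequently, the following three problems for $G$ are solvable in time linear in the length of the input on a random access machine: the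 \emph{geodesic problem} (given a word $w$, find a geodesic word representing the same element); the \emph{geodesic length problem} (given a word $w$, compute its geodesic length); the \emph{bounded geodesic length problem} (given a word $w$ and an integer $k$, the latter written in binary after the word, decide whether the geodesic length of $w$ is less than $k$). \end{enumerate} The programs and the implied constants may depend on $p$. -/

import Mathlib

/-! ## The solvable Baumslag–Solitar groups, words and geodesics -/

namespace BaumslagSolitar

/-- The two generators `a` and `t`. -/
inductive Gen : Type
  | a : Gen
  | t : Gen

/-- The one relator `t a t⁻¹ (a ^ p)⁻¹`. -/
def relators (p : ℕ) : Set (FreeGroup Gen) :=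
  {FreeGroup.of Gen.t * FreeGroup.of Gen.a * (FreeGroup.of Gen.t)⁻¹ * (FreeGroup.of Gen.a ^ p)⁻¹}

/-- `BS(1,p) = ⟨a, t | t a t⁻¹ = a ^ p⟩`. -/
abbrev BS (p : ℕ) : Type := PresentedGroup (relators p)

/-- A letter of `{a, a⁻¹, t, t⁻¹}`: `(x, true)` is `x` and `(x, false)` is `x⁻¹`. -/
abbrev Letter : Type := Gen × Bool

/-- Words (not necessarily freely reduced) over `{a, a⁻¹, t, t⁻¹}`. -/
abbrev Word : Type := List Letter

/-- The element of `BS(1,p)` that a letter stands for. -/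
def letterValue (p : ℕ) (l : Letter) : BS p :=
  if l.2 then PresentedGroup.of l.1 else (PresentedGroup.of l.1)⁻¹

/-- The element of `BS(1,p)` that a word represents. -/
def value (p : ℕ) (w : Word) : BS p := (w.map (letterValue p)).prod

/-- `w` is a shortest word among all words representing the same element of `BS(1,p)`. -/
def IsGeodesic (p : ℕ) (w : Word) : Prop :=
  ∀ v : Word, value p v = value p w → w.length ≤ v.length

/-- The geodesic length of (the element represented by) `w`: the least length of a word
representing the same element. The set is non-empty, as it contains `w.length`. -/
noncomputable def geodesicLength (p : ℕ) (w : Word) : ℕ :=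
  sInf {k : ℕ | ∃ v : Word, value p v = value p w ∧ v.length = k}

end BaumslagSolitar

/-! ## Random access machines

The machine has registers `X 0, X 1, X 2, …`, each holding an integer and initially `0`, a
read-only input tape that is read from left to right and a write-only output tape. A program is a
finite list of instructions, numbered from `0`. Arithmetic is restricted to addition and
subtraction. Every instruction takes one unit of time. -/

namespace RAM

inductive Instr : Type
  /-- `X i ← c` -/
  | const (i : ℕ) (c : ℤ) : Instr
  /-- `X i ← X j + X k` -/
  | add (i j k : ℕ) : Instr
  /-- `X i ← X j - X k` -/
  | sub (i j k : ℕ) : Instr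
  /-- `X i ← X (X j)` -/
  | load (i j : ℕ) : Instr
  /-- `X (X i) ← X j` -/
  | store (i j : ℕ) : Instr
  /-- go to instruction number `m` if `X j > 0` -/
  | jumpPos (m j : ℕ) : Instr
  /-- `X i ←` the next input symbol, or `0` if the input is exhausted -/
  | read (i : ℕ) : Instr
  /-- append the integer `X i` to the output -/
  | print (i : ℕ) : Instr

abbrev Program : Type := List Instr

/-- A configuration: the number of the next instruction, the contents of the registers (all but
finitely many of them are `0`), the unread input, the output produced so far. -/
structure Config : Type where
  pc : ℕ
  reg : ℕ →₀ ℤ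
  input : List ℤ
  output : List ℤ

/-- The configuration in which the machine starts on the input `x`. -/
noncomputable def start (x : List ℤ) : Config := ⟨0, 0, x, []⟩

/-- Execution of a single instruction. An indirect reference with a negative address is a reference
to register `0`. -/
noncomputable def exec (c : Config) : Instr → Config
  | .const i v => { c with pc := c.pc + 1, reg := c.reg.update i v }
  | .add i j k => { c with pc := c.pc + 1, reg := c.reg.update i (c.reg j + c.reg k) }
  | .sub i j k => { c with pc := c.pc + 1, reg := c.reg.update i (c.reg j - c.reg k) }
  | .load i j => { c with pc := c.pc + 1, reg := c.reg.update i (c.reg (c.reg j).toNat) }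
  | .store i j => { c with pc := c.pc + 1, reg := c.reg.update (c.reg i).toNat (c.reg j) }
  | .jumpPos m j => { c with pc := if 0 < c.reg j then m else c.pc + 1 }
  | .read i =>
      { c with pc := c.pc + 1, reg := c.reg.update i (c.input.headD 0), input := c.input.tail }
  | .print i => { c with pc := c.pc + 1, output := c.output ++ [c.reg i] }

/-- The machine has halted when there is no instruction with number `pc`. -/
def Halted (P : Program) (c : Config) : Prop := P.length ≤ c.pc

/-- One step of the machine. A halted configuration does not change any more. -/
noncomputable def step (P : Program) (c : Config) : Config :=
  match P[c.pc]? with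
  | some I => exec c I
  | none => c

/-- The configuration after `τ` steps on the input `x`. -/
noncomputable def configAt (P : Program) (x : List ℤ) (τ : ℕ) : Config := (step P)^[τ] (start x)

/-- The space a configuration occupies: the number of bits needed to write down, in binary, the
addresses and the contents of all the registers in use (that is, with non-zero content; each of
them gets a further bit for its sign). -/
def space (c : Config) : ℕ := ∑ i ∈ c.reg.support, (i.size + (c.reg i).natAbs.size + 1)

/-- The program `P` solves the problem with instances `α`, where `enc x` is the input that describes
the instance `x` and `correct x y` says that the output `y` is a correct answer for `x`; and, `n`
denoting the length of the input, it halts after at most `T n` steps, never occupies more than `S n`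
bits, and never has an integer of more than `W n` bits in a register. -/
def SolvesWithin {α : Type} (enc : α → List ℤ) (correct : α → List ℤ → Prop) (P : Program)
    (T S W : ℕ → ℕ) : Prop :=
  ∀ x : α,
    Halted P (configAt P (enc x) (T (enc x).length)) ∧
    correct x (configAt P (enc x) (T (enc x).length)).output ∧
    ∀ τ : ℕ, space (configAt P (enc x) τ) ≤ S (enc x).length ∧
      ∀ i : ℕ, ((configAt P (enc x) τ).reg i).natAbs.size ≤ W (enc x).length

/-- `f` and `g` take values in the naturals and the reals, and `f n = O(g n)` as `n → ∞`. -/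
def BigO (f : ℕ → ℕ) (g : ℕ → ℝ) : Prop :=
  (fun n => (f n : ℝ)) =O[Filter.atTop] g

/-- Solvable in linear time by a random access machine with registers of `O(log n)` bits (the function
`S` being arbitrary, nothing is demanded of the space). -/
def LinearTimeSolvable {α : Type} (enc : α → List ℤ) (correct : α → List ℤ → Prop) : Prop :=
  ∃ (P : Program) (T S W : ℕ → ℕ), SolvesWithin enc correct P T S W ∧
    BigO T (fun n => (n : ℝ)) ∧ BigO W (fun n => Real.log n)

/-- Solvable in linear time and simultaneously in `O(n log n)` space by a random access machine with
registers of `O(log n)` bits. -/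
def LinearTimeQuasilinearSpaceSolvable {α : Type} (enc : α → List ℤ)
    (correct : α → List ℤ → Prop) : Prop :=
  ∃ (P : Program) (T S W : ℕ → ℕ), SolvesWithin enc correct P T S W ∧
    BigO T (fun n => (n : ℝ)) ∧ BigO S (fun n => (n : ℝ) * Real.log n) ∧
    BigO W (fun n => Real.log n)

end RAM

/-! ## The three problems -/

namespace BaumslagSolitar

/-- The input and output symbols for the letters. -/
def letterCode : Letter → ℤ
  | (Gen.a, true) => 1
  | (Gen.a, false) => -1
  | (Gen.t, true) => 2
  | (Gen.t, false) => -2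

/-- One symbol for each letter. -/
def encodeWord (w : Word) : List ℤ := w.map letterCode

/-- A sign symbol (`3` for `k ≥ 0`, `-3` for `k < 0`), then the binary digits of `|k|`, the most
significant one first (`5` for the digit one, `4` for the digit zero). -/
def encodeInt (k : ℤ) : List ℤ :=
  (if 0 ≤ k then 3 else -3) :: (k.natAbs.bits.reverse.map fun b => if b then 5 else 4)

/-- A word followed by an integer. -/
def encodeWordInt (x : Word × ℤ) : List ℤ := encodeWord x.1 ++ encodeInt x.2

/-- The geodesic problem: given `w`, output a geodesic word representing the same element. -/
def geodesicProblem (p : ℕ) (w : Word) (y : List ℤ) : Prop :=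
  ∃ v : Word, y = encodeWord v ∧ value p v = value p w ∧ IsGeodesic p v

/-- The geodesic length problem: given `w`, output its geodesic length. -/
def geodesicLengthProblem (p : ℕ) (w : Word) (y : List ℤ) : Prop :=
  y = [(geodesicLength p w : ℤ)]

open Classical in
/-- The bounded geodesic length problem: given `w` and `k`, decide whether the geodesic length of `w`
is less than `k` (output `1` for yes, `0` for no). -/
def boundedGeodesicLengthProblem (p : ℕ) (x : Word × ℤ) (y : List ℤ) : Prop :=
  y = [if (geodesicLength p x.1 : ℤ) < x.2 then 1 else 0]

end BaumslagSolitar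

/-! A word that reads `a ^ c i` in total at the height `i` (the exponent sum of `t` so far) and ends at
the height `m` represents `t ^ (-N) * a ^ X * t ^ (N + m)` with `X = ∑ c i * p ^ (i + N)`, for large
`N`; and the element determines `m` and, for fixed `N`, also `X` (`value_eq`, `value_eq_iff`). So a
geodesic word is a cheapest way to write `X` in base `p` with arbitrary integer digits `c i`: if the heights visited are
those from `lo` to `hi`, an interval that contains `0` and `m`, the digits cost `∑ |c i|` letters and
the moves `2 (hi - lo) - |m|` letters (`exists_rep`, `sweepWord_spec`).

In a cheapest representation the digits may be taken to be less than `p` in absolute value, and less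
than `2 p` at the top (`Rep.exists_reduced`), since larger ones can be carried without loss. Compared
with a fixed representation of `X` by digits below `p`, which is obtained from the given word by
carrying, such a representation differs by carries of absolute value at most `2`. So the reduced
representations are paths in a graph with a layer of 15 states for each height: a carry, and whether
the height lies below, in or above the interval visited (`Rep.path`, `exists_rep_of_states`). A
cheapest path is found by dynamic programming (`Optimal.succ`) and traced back, and the word is
written down from it. Only `O(n)` layers matter for a word of length `n`, and all the carrying takes
`O(n)` steps together (`sum_abs_carryIn_le`). This gives `geodesic_ends`.

The algorithm is written in a small language with variables and arrays whose only arithmetic is the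
addition of constants. In linear time such a program reaches values of linear size only, hence of
`O(log n)` bits, and linearly many registers; its translation into a program for a random access
machine takes constant time for each step (`Prog.Run.simulated`, `Code.Run.reach`). This is
`RAM.solvable_of_prog`.

For the decision problem, the binary number is read digit by digit and is given up as soon as it
exceeds the geodesic length. Doubling takes time proportional to the growth of the number, so that
the comparison takes linear time as well (`compare_ends`). -/

set_option linter.unusedSectionVars false

/-! ### Structured code for random access machines -/

namespace RAM

/-- The data of a configuration: everything but the program counter. -/
structure Mem : Type where
  reg : ℕ →₀ ℤ
  input : List ℤ
  output : List ℤ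

/-- The configuration with the given data and program counter. -/
def Mem.at (μ : Mem) (pc : ℕ) : Config := ⟨pc, μ.reg, μ.input, μ.output⟩

/-- The data of a configuration. -/
def Config.mem (c : Config) : Mem := ⟨c.reg, c.input, c.output⟩

/-- The effect of an instruction on the data. -/
noncomputable def Mem.exec (μ : Mem) (I : Instr) : Mem := (RAM.exec (μ.at 0) I).mem

/-- Writing a register. -/
noncomputable def Mem.upd (μ : Mem) (r : ℕ) (z : ℤ) : Mem := { μ with reg := μ.reg.update r z }

/-- The instruction is not a jump. -/
def Instr.Straight : Instr → Prop
  | .jumpPos _ _ => False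
  | _ => True

theorem exec_at_of_straight {I : Instr} (hI : I.Straight) (μ : Mem) (pc : ℕ) :
    RAM.exec (μ.at pc) I = (μ.exec I).at (pc + 1) := by
  cases I <;> first | rfl | exact hI.elim

/-- Structured code. The conditions test whether a register is positive. Register `0` serves as
a scratch register for unconditional jumps. -/
inductive Code : Type
  | instr (I : Instr) : Code
  | seq (c d : Code) : Code
  | ite (j : ℕ) (c d : Code) : Code
  | loop (j : ℕ) (c : Code) : Code

/-- The number of instructions that the code is compiled to. -/
def Code.len : Code → ℕ
  | .instr _ => 1
  | .seq c d => c.len + d.len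
  | .ite _ c d => c.len + d.len + 3
  | .loop _ c => c.len + 5

/-- The instructions for the code, when the first of them is to have number `off`. -/
def Code.compile : Code → ℕ → Program
  | .instr I, _ => [I]
  | .seq c d, off => c.compile off ++ d.compile (off + c.len)
  | .ite j c d, off =>
      .jumpPos (off + d.len + 3) j :: (d.compile (off + 1) ++
        (.const 0 1 :: .jumpPos (off + d.len + 3 + c.len) 0 :: c.compile (off + d.len + 3)))
  | .loop j c, off =>
      .jumpPos (off + 3) j :: .const 0 1 :: .jumpPos (off + c.len + 5) 0 ::
        (c.compile (off + 3) ++ [.const 0 1, .jumpPos off 0])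

theorem Code.length_compile (c : Code) (off : ℕ) : (c.compile off).length = c.len := by
  induction c generalizing off with
  | instr I => rfl
  | seq c d hc hd => simp [compile, len, hc, hd]
  | ite j c d hc hd => simp [compile, len, hc, hd]; omega
  | loop j c hc => simp [compile, len, hc]

/-- Big-step semantics of structured code with the exact number of instructions executed. All the
data that occur on the way have the property `ok`. -/
inductive Code.Run (ok : Mem → Prop) : Code → Mem → Mem → ℕ → Prop
  | instr {I : Instr} {μ : Mem} : I.Straight → ok μ → ok (μ.exec I) →
      Run ok (.instr I) μ (μ.exec I) 1
  | seq {c d : Code} {μ μ' μ'' : Mem} {n n' : ℕ} : Run ok c μ μ' n → Run ok d μ' μ'' n' →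
      Run ok (.seq c d) μ μ'' (n + n')
  | ite_pos {j : ℕ} {c d : Code} {μ μ' : Mem} {n : ℕ} : 0 < μ.reg j → ok μ → Run ok c μ μ' n →
      Run ok (.ite j c d) μ μ' (n + 1)
  | ite_neg {j : ℕ} {c d : Code} {μ μ' : Mem} {n : ℕ} : ¬ 0 < μ.reg j → ok μ →
      Run ok d μ μ' n → ok (μ'.upd 0 1) → Run ok (.ite j c d) μ (μ'.upd 0 1) (n + 3)
  | loop_pos {j : ℕ} {c : Code} {μ μ' μ'' : Mem} {n n' : ℕ} : 0 < μ.reg j → ok μ →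
      Run ok c μ μ' n → ok (μ'.upd 0 1) → Run ok (.loop j c) (μ'.upd 0 1) μ'' n' →
      Run ok (.loop j c) μ μ'' (n + n' + 3)
  | loop_neg {j : ℕ} {c : Code} {μ : Mem} : ¬ 0 < μ.reg j → ok μ → ok (μ.upd 0 1) →
      Run ok (.loop j c) μ (μ.upd 0 1) 3

/-- `n` steps of the machine lead from `c` to `c'`, and all the data on the way have the
property `ok`. -/
def Reach (P : Program) (ok : Mem → Prop) (c c' : Config) (n : ℕ) : Prop :=
  (step P)^[n] c = c' ∧ ∀ i ≤ n, ok ((step P)^[i] c).mem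

theorem Reach.trans {P : Program} {ok : Mem → Prop} {c c' c'' : Config} {n n' : ℕ}
    (h : Reach P ok c c' n) (h' : Reach P ok c' c'' n') : Reach P ok c c'' (n + n') := by
  refine ⟨by rw [add_comm, Function.iterate_add_apply, h.1, h'.1], fun i hi => ?_⟩
  rcases le_total i n with hin | hin
  · exact h.2 i hin
  · obtain ⟨k, rfl⟩ := Nat.exists_eq_add_of_le hin
    rw [add_comm, Function.iterate_add_apply, h.1]
    exact h'.2 k (by omega)

theorem Reach.single {P : Program} {ok : Mem → Prop} {c c' : Config} (h : step P c = c')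
    (h1 : ok c.mem) (h2 : ok c'.mem) : Reach P ok c c' 1 := by
  refine ⟨by simpa using h, fun i hi => ?_⟩
  interval_cases i
  · simpa using h1
  · simpa [h] using h2

/-- The instructions `l` stand in the program `P`, from number `off` on. -/
def CodeAt (P : Program) (off : ℕ) (l : List Instr) : Prop :=
  ∃ pre post : List Instr, P = pre ++ l ++ post ∧ pre.length = off

theorem CodeAt.left {P : Program} {off : ℕ} {l l' : List Instr} (h : CodeAt P off (l ++ l')) :
    CodeAt P off l := by
  obtain ⟨a, b, rfl, h⟩ := h
  exact ⟨a, l' ++ b, by simp, h⟩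

theorem CodeAt.right {P : Program} {off : ℕ} {l l' : List Instr} (h : CodeAt P off (l ++ l'))
    {k : ℕ} (hk : off + l.length = k) : CodeAt P k l' := by
  obtain ⟨a, b, rfl, h⟩ := h
  exact ⟨a ++ l, b, by simp, by simp [h, hk]⟩

theorem CodeAt.tail {P : Program} {off : ℕ} {I : Instr} {l : List Instr}
    (h : CodeAt P off (I :: l)) : CodeAt P (off + 1) l :=
  CodeAt.right (l := [I]) h rfl

theorem CodeAt.step_eq {P : Program} {off : ℕ} {I : Instr} {l : List Instr}
    (h : CodeAt P off (I :: l)) (μ : Mem) : step P (μ.at off) = RAM.exec (μ.at off) I := by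
  obtain ⟨a, b, rfl, rfl⟩ := h
  simp [step, Mem.at]

theorem CodeAt.reach_jump_pos {P : Program} {ok : Mem → Prop} {off m j : ℕ} {l : List Instr}
    (h : CodeAt P off (.jumpPos m j :: l)) {μ : Mem} (hj : 0 < μ.reg j) (hok : ok μ) :
    Reach P ok (μ.at off) (μ.at m) 1 :=
  Reach.single (by rw [h.step_eq]; simp [RAM.exec, Mem.at, hj]) hok hok

theorem CodeAt.reach_jump_neg {P : Program} {ok : Mem → Prop} {off m j : ℕ} {l : List Instr}
    (h : CodeAt P off (.jumpPos m j :: l)) {μ : Mem} (hj : ¬ 0 < μ.reg j) (hok : ok μ) :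
    Reach P ok (μ.at off) (μ.at (off + 1)) 1 :=
  Reach.single (by rw [h.step_eq]; simp [RAM.exec, Mem.at, hj]) hok hok

theorem CodeAt.reach_straight {P : Program} {ok : Mem → Prop} {off : ℕ} {I : Instr}
    {l : List Instr} (h : CodeAt P off (I :: l)) (hI : I.Straight) {μ : Mem} (hok : ok μ)
    (hok' : ok (μ.exec I)) : Reach P ok (μ.at off) ((μ.exec I).at (off + 1)) 1 :=
  Reach.single (by rw [h.step_eq, exec_at_of_straight hI]) hok hok'

theorem Mem.upd_same (μ : Mem) (r : ℕ) (z : ℤ) : (μ.upd r z).reg r = z := by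
  simp [Mem.upd]

/-- An unconditional jump: a positive constant is put into the scratch register. -/
theorem CodeAt.reach_goto {P : Program} {ok : Mem → Prop} {off m : ℕ} {l : List Instr}
    (h : CodeAt P off (.const 0 1 :: .jumpPos m 0 :: l)) {μ : Mem} (hok : ok μ)
    (hok' : ok (μ.upd 0 1)) : Reach P ok (μ.at off) ((μ.upd 0 1).at m) 2 :=
  (h.reach_straight trivial hok hok').trans
    (h.tail.reach_jump_pos (show (0 : ℤ) < (μ.upd 0 1).reg 0 by rw [Mem.upd_same]; exact one_pos) hok')

theorem Code.Run.ok_right {ok : Mem → Prop} {c : Code} {μ μ' : Mem} {n : ℕ}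
    (h : c.Run ok μ μ' n) : ok μ' := by
  induction h <;> assumption

/-- The compiled code does what the big-step semantics says. -/
theorem Code.Run.reach {ok : Mem → Prop} {P : Program} {c : Code} {μ μ' : Mem} {n : ℕ}
    (h : c.Run ok μ μ' n) : ∀ {off : ℕ}, CodeAt P off (c.compile off) →
      Reach P ok (μ.at off) (μ'.at (off + c.len)) n := by
  induction h with
  | instr hI h1 h2 => intro off hc; exact CodeAt.reach_straight hc hI h1 h2
  | @seq c d μ μ' μ'' n n' _ _ ih1 ih2 =>
    intro off hc
    have hd := hc.right (by rw [Code.length_compile])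
    have := (ih1 hc.left).trans (ih2 hd)
    rwa [add_assoc] at this
  | @ite_pos j c d μ μ' n hj hok h ih =>
    intro off hc
    have h1 := hc.reach_jump_pos hj hok
    have h2 : CodeAt P (off + d.len + 3) (c.compile (off + d.len + 3)) :=
      ((hc.tail.right rfl).tail.tail) |> fun h => by
        rw [Code.length_compile] at h
        convert h using 1; omega
    have := h1.trans (ih h2)
    rw [add_comm n 1]
    convert this using 2
    simp only [Code.len]; omega
  | @ite_neg j c d μ μ' n hj hok h hok' ih =>
    intro off hc
    have h1 := hc.reach_jump_neg hj hok
    have h2 := ih hc.tail.left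
    have h3 : CodeAt P (off + 1 + d.len) _ := hc.tail.right (by rw [Code.length_compile])
    have := (h1.trans h2).trans (h3.reach_goto h.ok_right hok')
    convert this using 1
    · simp only [Code.len]; congr 1; omega
    · omega
  | @loop_pos j c μ μ' μ'' n n' hj hok h hok' _ ih1 ih2 =>
    intro off hc
    have h1 := hc.reach_jump_pos hj hok
    have h2 := ih1 hc.tail.tail.tail.left
    have h3 : CodeAt P (off + 3 + c.len) _ :=
      hc.tail.tail.tail.right (by rw [Code.length_compile])
    have := ((h1.trans h2).trans (h3.reach_goto h.ok_right hok')).trans (ih2 hc)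
    convert this using 1
    omega
  | @loop_neg j c μ hj hok hok' =>
    intro off hc
    exact (hc.reach_jump_neg hj hok).trans (hc.tail.reach_goto hok hok')

end RAM

/-! ### A small imperative language with arrays -/

namespace RAM

/-- An operand: a variable or a literal. -/
inductive Atom (V : Type) : Type
  | var (x : V) : Atom V
  | lit (c : ℤ) : Atom V

/-- Programs with integer variables `V` and with arrays `A` that are indexed by the integers. The
only arithmetic is to add a literal to a variable, so that, for bounded input symbols, all values are
`O(t)` after `t` steps. -/
inductive Prog (V A : Type) : Type
  | skip : Prog V A
  | set (x : V) (e : Atom V) : Prog V A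
  | inc (x : V) (c : ℤ) : Prog V A
  | get (x : V) (a : A) (y : V) : Prog V A
  | put (a : A) (y x : V) : Prog V A
  | read (x : V) : Prog V A
  | print (e : Atom V) : Prog V A
  | seq (P Q : Prog V A) : Prog V A
  | ite (e f : Atom V) (P Q : Prog V A) : Prog V A
  | while (e f : Atom V) (P : Prog V A) : Prog V A

/-- The state of a program: variables, arrays, unread input, output. -/
structure St (V A : Type) : Type where
  v : V → ℤ
  a : A → ℤ → ℤ
  inp : List ℤ
  out : List ℤ

variable {V A : Type} [DecidableEq V] [DecidableEq A]

/-- The value of an operand. -/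
def Atom.val (s : St V A) : Atom V → ℤ
  | .var x => s.v x
  | .lit c => c

/-- Writing a variable. -/
def St.setv (s : St V A) (x : V) (z : ℤ) : St V A := { s with v := Function.update s.v x z }

/-- Writing an array element. -/
def St.seta (s : St V A) (a : A) (i z : ℤ) : St V A :=
  { s with a := Function.update s.a a (Function.update (s.a a) i z) }

/-- Big-step semantics; `ite e f P Q` and `while e f P` test whether `e < f`. The number is an upper
bound for the number of steps. -/
inductive Prog.Run : Prog V A → St V A → St V A → ℕ → Prop
  | skip {s : St V A} : Run .skip s s 1
  | set {s : St V A} {x : V} {e : Atom V} : Run (.set x e) s (s.setv x (e.val s)) 1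
  | inc {s : St V A} {x : V} {c : ℤ} : Run (.inc x c) s (s.setv x (s.v x + c)) 1
  | get {s : St V A} {x y : V} {a : A} : Run (.get x a y) s (s.setv x (s.a a (s.v y))) 1
  | put {s : St V A} {x y : V} {a : A} : Run (.put a y x) s (s.seta a (s.v y) (s.v x)) 1
  | read {s : St V A} {x : V} :
      Run (.read x) s { s.setv x (s.inp.headD 0) with inp := s.inp.tail } 1
  | print {s : St V A} {e : Atom V} : Run (.print e) s { s with out := s.out ++ [e.val s] } 1
  | seq {P Q : Prog V A} {s s' s'' : St V A} {t t' : ℕ} : Run P s s' t → Run Q s' s'' t' →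
      Run (.seq P Q) s s'' (t + t')
  | ite_pos {P Q : Prog V A} {e f : Atom V} {s s' : St V A} {t : ℕ} : e.val s < f.val s →
      Run P s s' t → Run (.ite e f P Q) s s' (t + 1)
  | ite_neg {P Q : Prog V A} {e f : Atom V} {s s' : St V A} {t : ℕ} : ¬ e.val s < f.val s →
      Run Q s s' t → Run (.ite e f P Q) s s' (t + 1)
  | while_pos {P : Prog V A} {e f : Atom V} {s s' s'' : St V A} {t t' : ℕ} :
      e.val s < f.val s → Run P s s' t → Run (.while e f P) s' s'' t' →
      Run (.while e f P) s s'' (t + t' + 1)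
  | while_neg {P : Prog V A} {e f : Atom V} {s : St V A} : ¬ e.val s < f.val s →
      Run (.while e f P) s s 1
  | mono {P : Prog V A} {s s' : St V A} {t t' : ℕ} : Run P s s' t → t ≤ t' → Run P s s' t'

/-! ### Translation into structured code -/

section Translation

variable [Fintype V] [Fintype A]

/-- The register of a variable. Registers `0, 1, 2, 3` are scratch registers, the variables come next,
and the arrays are interleaved behind them. -/
noncomputable def varAddr (x : V) : ℕ := 4 + Fintype.equivFin V x

/-- The register of the array element `a[i]`. With `k` the number of arrays, a positive index `i`
belongs to the block of `k` registers with number `2 i`, an index `i ≤ 0` to the one with number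
`2 |i| + 1`; so the address is obtained by adding or subtracting `i` exactly `2 k` times. -/
noncomputable def arrAddr (V : Type) [Fintype V] (a : A) (i : ℤ) : ℕ :=
  4 + Fintype.card V + Fintype.equivFin A a +
    Fintype.card A * (if 0 < i then 2 * i.toNat else 2 * (-i).toNat + 1)

/-- Loads the value of an operand into the scratch register `r`. -/
noncomputable def Atom.loadCode (r : ℕ) : Atom V → Code
  | .lit c => .instr (.const r c)
  | .var x => .seq (.instr (.const r 0)) (.instr (.add r r (varAddr x)))

/-- The instruction `I`, repeated `n + 1` times. -/
def Code.rep (I : Instr) : ℕ → Code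
  | 0 => .instr I
  | n + 1 => .seq (Code.rep I n) (.instr I)

/-- Computes the address of `a[y]` into scratch register `1`. -/
noncomputable def addrCode (a : A) (y : V) : Code :=
  .ite (varAddr y)
    (.seq (.instr (.const 1 ((4 + Fintype.card V + Fintype.equivFin A a : ℕ) : ℤ)))
      (Code.rep (.add 1 1 (varAddr y)) (2 * Fintype.card A - 1)))
    (.seq (.instr (.const 1 ((4 + Fintype.card V + Fintype.equivFin A a + Fintype.card A : ℕ) : ℤ)))
      (Code.rep (.sub 1 1 (varAddr y)) (2 * Fintype.card A - 1)))

/-- Makes scratch register `1` positive if and only if `e < f`. -/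
noncomputable def condCode (e f : Atom V) : Code :=
  .seq (.seq (e.loadCode 2) (f.loadCode 3)) (.instr (.sub 1 3 2))

/-- The structured code for a program. -/
noncomputable def Prog.code : Prog V A → Code
  | .skip => .instr (.const 1 0)
  | .set x (.lit c) => .instr (.const (varAddr x) c)
  | .set x (.var y) =>
      .seq (.instr (.const 2 0)) (.instr (.add (varAddr x) (varAddr y) 2))
  | .inc x c => .seq (.instr (.const 2 c)) (.instr (.add (varAddr x) (varAddr x) 2))
  | .get x a y => .seq (addrCode a y) (.instr (.load (varAddr x) 1))
  | .put a y x => .seq (addrCode a y) (.instr (.store 1 (varAddr x)))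
  | .read x => .instr (.read (varAddr x))
  | .print e => .seq (e.loadCode 2) (.instr (.print 2))
  | .seq P Q => .seq P.code Q.code
  | .ite e f P Q => .seq (condCode e f) (.ite 1 P.code Q.code)
  | .while e f P => .seq (condCode e f) (.loop 1 (.seq P.code (condCode e f)))

/-- The absolute value of a literal operand. -/
def Atom.lits : Atom V → ℕ
  | .lit c => c.natAbs
  | .var _ => 0

/-- An upper bound for the literals of the program. -/
def Prog.lits : Prog V A → ℕ
  | .set _ e => e.lits
  | .inc _ c => c.natAbs
  | .print e => e.lits
  | .seq P Q => max P.lits Q.lits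
  | .ite e f P Q => max (max e.lits f.lits) (max P.lits Q.lits)
  | .while e f P => max (max e.lits f.lits) P.lits
  | _ => 0

/-- The registers represent the state of the program. -/
structure Sim (s : St V A) (μ : Mem) : Prop where
  v : ∀ x, μ.reg (varAddr x) = s.v x
  a : ∀ a i, μ.reg (arrAddr V a i) = s.a a i
  inp : μ.input = s.inp
  out : μ.output = s.out

/-- All registers in use have address and content at most `M`. -/
def Mem.Within (M : ℕ) (μ : Mem) : Prop :=
  ∀ r, (μ.reg r).natAbs ≤ M ∧ (μ.reg r ≠ 0 → r ≤ M)

/-- All registers in use have address and content at most `M`, those outside of the scratch area have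
content at most `b`, and the remaining input symbols are at most `C`. -/
structure Good (M C b : ℕ) (μ : Mem) : Prop where
  within : μ.Within M
  val : ∀ r, 4 ≤ r → (μ.reg r).natAbs ≤ b
  inp : ∀ z ∈ μ.input, z.natAbs ≤ C

theorem varAddr_injective : Function.Injective (varAddr (V := V)) := by
  intro x y h
  have : (Fintype.equivFin V x : ℕ) = Fintype.equivFin V y := by
    simp only [varAddr] at h; omega
  exact (Fintype.equivFin V).injective (Fin.ext this)

theorem four_le_varAddr (x : V) : 4 ≤ varAddr x := by simp [varAddr]

theorem varAddr_lt (x : V) : varAddr x < 4 + Fintype.card V := by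
  have := (Fintype.equivFin V x).2
  simp only [varAddr]; omega

theorem le_arrAddr (a : A) (i : ℤ) : 4 + Fintype.card V ≤ arrAddr V a i := by
  simp only [arrAddr]; omega

theorem arrAddr_inj {a a' : A} {i i' : ℤ} (h : arrAddr V a i = arrAddr V a' i') :
    a = a' ∧ i = i' := by
  have hk := (Fintype.equivFin A a).2
  have hk' := (Fintype.equivFin A a').2
  have key : (Fintype.equivFin A a : ℕ) = Fintype.equivFin A a' → a = a' := fun h =>
    (Fintype.equivFin A).injective (Fin.ext h)
  simp only [arrAddr] at h
  generalize (Fintype.equivFin A a : ℕ) = u at *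
  generalize (Fintype.equivFin A a' : ℕ) = u' at *
  generalize Fintype.card A = k at *
  generalize hj : (if 0 < i then 2 * i.toNat else 2 * (-i).toNat + 1) = j at h
  generalize hj' : (if 0 < i' then 2 * i'.toNat else 2 * (-i').toNat + 1) = j' at h
  have h' : u + k * j = u' + k * j' := by omega
  have hkpos : 0 < k := by omega
  have h1 : j = j' := by
    have := congrArg (· / k) h'
    simp only [Nat.add_mul_div_left _ _ hkpos, Nat.div_eq_of_lt hk, Nat.div_eq_of_lt hk'] at this
    omega
  subst h1
  refine ⟨key (by omega), ?_⟩
  split_ifs at hj hj' <;> omega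

theorem arrAddr_le {a : A} {i : ℤ} {b : ℕ} (h : i.natAbs ≤ b) :
    arrAddr V a i ≤ 4 + Fintype.card V + Fintype.card A * (2 * b + 2) := by
  have hk := (Fintype.equivFin A a).2
  have h1 : (if 0 < i then 2 * i.toNat else 2 * (-i).toNat + 1) ≤ 2 * b + 1 := by
    split_ifs <;> omega
  have := Nat.mul_le_mul_left (Fintype.card A) h1
  simp only [arrAddr]
  nlinarith

theorem Mem.upd_reg (μ : Mem) (r : ℕ) (z : ℤ) (i : ℕ) :
    (μ.upd r z).reg i = if i = r then z else μ.reg i := by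
  simp [Mem.upd, Finsupp.coe_update, Function.update_apply]

theorem Mem.upd_reg_ne (μ : Mem) {r i : ℕ} (z : ℤ) (h : i ≠ r) : (μ.upd r z).reg i = μ.reg i := by
  rw [Mem.upd_reg, if_neg h]

theorem Sim.scratch {s : St V A} {μ : Mem} (h : Sim s μ) {r : ℕ} (hr : r < 4) (z : ℤ) :
    Sim s (μ.upd r z) := by
  refine ⟨fun x => ?_, fun a i => ?_, h.inp, h.out⟩
  · rw [Mem.upd_reg_ne, h.v]
    have := four_le_varAddr x; omega
  · rw [Mem.upd_reg_ne, h.a]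
    have := le_arrAddr (V := V) a i; omega

theorem Sim.setv {s : St V A} {μ : Mem} (h : Sim s μ) (x : V) (z : ℤ) :
    Sim (s.setv x z) (μ.upd (varAddr x) z) := by
  refine ⟨fun y => ?_, fun a i => ?_, h.inp, h.out⟩
  · rw [Mem.upd_reg, h.v]
    simp [St.setv, Function.update_apply, varAddr_injective.eq_iff]
  · rw [Mem.upd_reg_ne, h.a]
    · rfl
    · have := le_arrAddr (V := V) a i
      have := varAddr_lt x
      omega

theorem Sim.seta {s : St V A} {μ : Mem} (h : Sim s μ) (a : A) (i z : ℤ) :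
    Sim (s.seta a i z) (μ.upd (arrAddr V a i) z) := by
  refine ⟨fun y => ?_, fun a' i' => ?_, h.inp, h.out⟩
  · rw [Mem.upd_reg_ne, h.v]
    · rfl
    · have := le_arrAddr (V := V) a i
      have := varAddr_lt y
      omega
  · rw [Mem.upd_reg, h.a]
    by_cases ha : a' = a
    · subst ha
      by_cases hi : i' = i
      · simp [St.seta, hi]
      · rw [if_neg (fun h => hi (arrAddr_inj h).2)]
        simp [St.seta, hi]
    · rw [if_neg (fun h => ha (arrAddr_inj h).1)]
      simp [St.seta, ha]

theorem Mem.Within.upd {M : ℕ} {μ : Mem} (h : μ.Within M) {r : ℕ} {z : ℤ} (hr : r ≤ M)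
    (hz : z.natAbs ≤ M) : (μ.upd r z).Within M := by
  intro i
  rw [Mem.upd_reg]
  split_ifs with hi
  · exact ⟨hz, fun _ => hi ▸ hr⟩
  · exact h i

theorem Good.scratch {M C b : ℕ} {μ : Mem} (h : Good M C b μ) {r : ℕ} {z : ℤ} (hr : r < 4)
    (hM : 4 ≤ M) (hz : z.natAbs ≤ M) : Good M C b (μ.upd r z) :=
  ⟨h.within.upd (by omega) hz, fun i hi => by
    rw [Mem.upd_reg_ne _ _ (by omega)]; exact h.val i hi, h.inp⟩

theorem Good.upd {M C b b' : ℕ} {μ : Mem} (h : Good M C b μ) {r : ℕ} {z : ℤ} (hr : r ≤ M)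
    (hz : z.natAbs ≤ b') (hb : b ≤ b') (hM : b' ≤ M) : Good M C b' (μ.upd r z) :=
  ⟨h.within.upd hr (hz.trans hM), fun i hi => by
    rw [Mem.upd_reg]
    split_ifs with h1
    · exact hz
    · exact (h.val i hi).trans hb, h.inp⟩

theorem Good.mono {M C b b' : ℕ} {μ : Mem} (h : Good M C b μ) (hb : b ≤ b') : Good M C b' μ :=
  ⟨h.within, fun i hi => (h.val i hi).trans hb, h.inp⟩

end Translation

/-! ### The simulation -/

section Simulation

variable {V A : Type} [DecidableEq V] [DecidableEq A] [Fintype V] [Fintype A]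

/-- The registers needed when all values are at most `b`. -/
def layoutBound (V A : Type) [Fintype V] [Fintype A] (b : ℕ) : ℕ :=
  4 + Fintype.card V + Fintype.card A * (2 * b + 2) + 2 * b

theorem layoutBound_mono {b b' : ℕ} (h : b ≤ b') : layoutBound V A b ≤ layoutBound V A b' := by
  unfold layoutBound; gcongr

theorem Mem.upd_upd (μ : Mem) (r : ℕ) (z z' : ℤ) : (μ.upd r z).upd r z' = μ.upd r z' := by
  have : ((μ.upd r z).upd r z').reg = (μ.upd r z').reg := by
    ext i
    simp only [Mem.upd_reg]
    split_ifs <;> rfl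
  simp only [Mem.upd] at this ⊢
  rw [this]

variable {M C b : ℕ} {s : St V A} {μ : Mem}

theorem Good.run_scratch (h : Good M C b μ) (hM : 4 ≤ M) {I : Instr} (hI : I.Straight) {r : ℕ}
    (hr : r < 4) {z : ℤ} (hz : z.natAbs ≤ M) (he : μ.exec I = μ.upd r z) :
    Code.Run (Mem.Within M) (.instr I) μ (μ.upd r z) 1 := by
  have := Code.Run.instr (ok := Mem.Within M) hI h.within (by
    rw [he]; exact (h.scratch hr hM hz).within)
  rwa [he] at this

theorem Good.run_upd {b' : ℕ} (h : Good M C b μ) {I : Instr} (hI : I.Straight) {r : ℕ}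
    (hr : r ≤ M) {z : ℤ} (hz : z.natAbs ≤ b') (hb : b ≤ b') (hM : b' ≤ M)
    (he : μ.exec I = μ.upd r z) :
    Code.Run (Mem.Within M) (.instr I) μ (μ.upd r z) 1 := by
  have := Code.Run.instr (ok := Mem.Within M) hI h.within (by
    rw [he]; exact (h.upd hr hz hb hM).within)
  rwa [he] at this

theorem Good.natAbs_var (h : Good M C b μ) (hs : Sim s μ) (x : V) : (s.v x).natAbs ≤ b := by
  rw [← hs.v]; exact h.val _ (four_le_varAddr x)

theorem Good.natAbs_arr (h : Good M C b μ) (hs : Sim s μ) (a : A) (i : ℤ) :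
    (s.a a i).natAbs ≤ b := by
  rw [← hs.a]
  exact h.val _ (by have := le_arrAddr (V := V) a i; omega)

theorem Good.natAbs_atom (h : Good M C b μ) (hs : Sim s μ) (e : Atom V) (he : e.lits ≤ b) :
    (e.val s).natAbs ≤ b := by
  cases e with
  | var x => exact h.natAbs_var hs x
  | lit c => exact he

theorem Sim.load (hs : Sim s μ) (hg : Good M C b μ) (hM : layoutBound V A b ≤ M) {r : ℕ}
    (hr : r < 4) (e : Atom V) (he : e.lits ≤ b) :
    ∃ n, Code.Run (Mem.Within M) (e.loadCode r) μ (μ.upd r (e.val s)) n ∧ n ≤ 2 := by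
  have hz := hg.natAbs_atom hs e he
  unfold layoutBound at hM
  cases e with
  | lit c =>
    exact ⟨1, hg.run_scratch (by omega) (by trivial) hr (by simp only [Atom.val] at hz ⊢; omega) rfl,
      by omega⟩
  | var x =>
    refine ⟨1 + 1, Code.Run.seq (hg.run_scratch (r := r) (z := 0) (by omega) (by trivial) hr (by simp) rfl)
      ?_, by omega⟩
    have h1 : (μ.upd r 0).upd r (s.v x) = μ.upd r (s.v x) := Mem.upd_upd ..
    simp only [Atom.val] at hz ⊢
    rw [← h1]
    refine (hg.scratch hr (by omega) (by simp)).run_scratch (by omega) (by trivial) hr (by omega) ?_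
    have h2 := four_le_varAddr x
    have h3 : (μ.upd r 0).reg r + (μ.upd r 0).reg (varAddr x) = s.v x := by
      rw [Mem.upd_reg_ne _ _ (show varAddr x ≠ r by omega), Mem.upd_same, hs.v, zero_add]
    rw [← h3]; rfl

theorem Sim.cond (hs : Sim s μ) (hg : Good M C b μ) (hM : layoutBound V A b ≤ M) (e f : Atom V)
    (he : e.lits ≤ b) (hf : f.lits ≤ b) :
    ∃ μ' n, Code.Run (Mem.Within M) (condCode e f) μ μ' n ∧ n ≤ 5 ∧ Sim s μ' ∧
      Good M C b μ' ∧ (0 < μ'.reg 1 ↔ e.val s < f.val s) := by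
  have hM' := hM
  unfold layoutBound at hM'
  have hez := hg.natAbs_atom hs e he
  have hfz := hg.natAbs_atom hs f hf
  obtain ⟨n1, h1, hn1⟩ := hs.load hg hM (r := 2) (by omega) e he
  have hs1 := hs.scratch (r := 2) (by omega) (e.val s)
  have hg1 := hg.scratch (r := 2) (z := e.val s) (by omega) (by omega) (by omega)
  obtain ⟨n2, h2, hn2⟩ := hs1.load hg1 hM (r := 3) (by omega) f hf
  have hs2 := hs1.scratch (r := 3) (by omega) (f.val s)
  have hg2 := hg1.scratch (r := 3) (z := f.val s) (by omega) (by omega) (by omega)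
  have hz : (f.val s - e.val s).natAbs ≤ M := by omega
  refine ⟨_, _, (h1.seq h2).seq (hg2.run_scratch (I := .sub 1 3 2) (r := 1) (z := f.val s - e.val s)
    (by omega) (by trivial) (by omega) hz ?_), by omega, hs2.scratch (by omega) _,
    hg2.scratch (by omega) (by omega) hz, ?_⟩
  · have h3 : ((μ.upd 2 (e.val s)).upd 3 (f.val s)).reg 3 -
        ((μ.upd 2 (e.val s)).upd 3 (f.val s)).reg 2 = f.val s - e.val s := by
      simp [Mem.upd_reg]
    rw [← h3]; rfl
  · rw [Mem.upd_same]; omega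

theorem Good.run_rep_add (hg : Good M C b μ) (hM : 4 ≤ M) (x : ℕ) (hx : 4 ≤ x) (k : ℕ)
    (hk : ∀ j ≤ k + 1, (μ.reg 1 + j * μ.reg x).natAbs ≤ M) :
    Code.Run (Mem.Within M) (Code.rep (.add 1 1 x) k) μ (μ.upd 1 (μ.reg 1 + (k + 1 : ℕ) * μ.reg x))
      (k + 1) := by
  induction k with
  | zero =>
    exact hg.run_scratch hM (by trivial) (by omega) (hk 1 (by omega)) (by
      simp only [Mem.exec, Mem.upd, RAM.exec, Config.mem, Mem.at]; simp)
  | succ k ih =>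
    refine Code.Run.seq (ih fun j hj => hk j (by omega)) ?_
    have h1 := (hg.scratch (r := 1) (z := μ.reg 1 + (k + 1 : ℕ) * μ.reg x) (by omega) hM
      (hk _ (by omega))).run_scratch hM (I := .add 1 1 x) (by trivial) (r := 1)
      (z := μ.reg 1 + (k + 1 + 1 : ℕ) * μ.reg x) (by omega) (hk _ (by omega)) (by
        have h3 : (μ.upd 1 (μ.reg 1 + (k + 1 : ℕ) * μ.reg x)).reg 1 +
            (μ.upd 1 (μ.reg 1 + (k + 1 : ℕ) * μ.reg x)).reg x =
            μ.reg 1 + (k + 1 + 1 : ℕ) * μ.reg x := by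
          rw [Mem.upd_same, Mem.upd_reg_ne _ _ (show x ≠ 1 by omega)]; push_cast; ring
        rw [← h3]; rfl)
    rwa [Mem.upd_upd] at h1

theorem Good.run_rep_sub (hg : Good M C b μ) (hM : 4 ≤ M) (x : ℕ) (hx : 4 ≤ x) (k : ℕ)
    (hk : ∀ j ≤ k + 1, (μ.reg 1 - j * μ.reg x).natAbs ≤ M) :
    Code.Run (Mem.Within M) (Code.rep (.sub 1 1 x) k) μ (μ.upd 1 (μ.reg 1 - (k + 1 : ℕ) * μ.reg x))
      (k + 1) := by
  induction k with
  | zero =>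
    exact hg.run_scratch hM (by trivial) (by omega) (hk 1 (by omega)) (by
      simp only [Mem.exec, Mem.upd, RAM.exec, Config.mem, Mem.at]; simp)
  | succ k ih =>
    refine Code.Run.seq (ih fun j hj => hk j (by omega)) ?_
    have h1 := (hg.scratch (r := 1) (z := μ.reg 1 - (k + 1 : ℕ) * μ.reg x) (by omega) hM
      (hk _ (by omega))).run_scratch hM (I := .sub 1 1 x) (by trivial) (r := 1)
      (z := μ.reg 1 - (k + 1 + 1 : ℕ) * μ.reg x) (by omega) (hk _ (by omega)) (by
        have h3 : (μ.upd 1 (μ.reg 1 - (k + 1 : ℕ) * μ.reg x)).reg 1 -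
            (μ.upd 1 (μ.reg 1 - (k + 1 : ℕ) * μ.reg x)).reg x =
            μ.reg 1 - (k + 1 + 1 : ℕ) * μ.reg x := by
          rw [Mem.upd_same, Mem.upd_reg_ne _ _ (show x ≠ 1 by omega)]; push_cast; ring
        rw [← h3]; rfl)
    rwa [Mem.upd_upd] at h1

theorem Sim.addr (hs : Sim s μ) (hg : Good M C b μ) (hM : layoutBound V A b ≤ M) (a : A) (y : V) :
    ∃ μ' n, Code.Run (Mem.Within M) (addrCode a y) μ μ' n ∧ n ≤ 2 * Fintype.card A + 4 ∧
      Sim s μ' ∧ Good M C b μ' ∧ μ'.reg 1 = (arrAddr V a (s.v y) : ℕ) := by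
  have hk := (Fintype.equivFin A a).2
  have hy := hg.natAbs_var hs y
  have hle := arrAddr_le (V := V) (a := a) hy
  unfold layoutBound at hM
  have hM4 : 4 ≤ M := by omega
  have h4 := four_le_varAddr y
  unfold addrCode
  have hA : 2 * Fintype.card A - 1 + 1 = 2 * Fintype.card A := by omega
  have hmul : ∀ j ≤ 2 * Fintype.card A - 1 + 1,
      ((j : ℤ) * s.v y).natAbs ≤ 2 * Fintype.card A * b := by
    intro j hj
    rw [Int.natAbs_mul, Int.natAbs_natCast]
    exact Nat.mul_le_mul (by omega) hy
  by_cases hpos : 0 < s.v y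
  · set z : ℤ := ((4 + Fintype.card V + Fintype.equivFin A a : ℕ) : ℤ) with hz
    have hzM : z.natAbs ≤ M := by rw [hz, Int.natAbs_natCast]; nlinarith
    have hg1 := hg.scratch (r := 1) (z := z) (by omega) hM4 hzM
    have hbound : ∀ j ≤ 2 * Fintype.card A - 1 + 1,
        ((μ.upd 1 z).reg 1 + (j : ℤ) * (μ.upd 1 z).reg (varAddr y)).natAbs ≤ M := by
      intro j hj
      rw [Mem.upd_same, Mem.upd_reg_ne _ _ (show varAddr y ≠ 1 by omega), hs.v]
      refine (Int.natAbs_add_le _ _).trans ?_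
      have := hmul j hj
      rw [hz, Int.natAbs_natCast]
      nlinarith
    have hrep := hg1.run_rep_add hM4 (varAddr y) h4 _ hbound
    refine ⟨_, _, Code.Run.ite_pos (by rwa [hs.v]) hg.within ((hg.run_scratch hM4 (r := 1) (z := z)
      (by trivial) (by omega) hzM rfl).seq hrep), by omega, (hs.scratch (by omega) _).scratch (by omega) _,
      hg1.scratch (by omega) hM4 (hbound _ le_rfl), ?_⟩
    rw [Mem.upd_same, Mem.upd_same, Mem.upd_reg_ne _ _ (show varAddr y ≠ 1 by omega), hs.v, hA, hz,
      arrAddr, if_pos hpos]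
    have : s.v y = ((s.v y).toNat : ℕ) := by omega
    rw [this]
    push_cast [Int.toNat_natCast]
    ring
  · set z : ℤ := ((4 + Fintype.card V + Fintype.equivFin A a + Fintype.card A : ℕ) : ℤ) with hz
    have hzM : z.natAbs ≤ M := by rw [hz, Int.natAbs_natCast]; nlinarith
    have hg1 := hg.scratch (r := 1) (z := z) (by omega) hM4 hzM
    have hbound : ∀ j ≤ 2 * Fintype.card A - 1 + 1,
        ((μ.upd 1 z).reg 1 - (j : ℤ) * (μ.upd 1 z).reg (varAddr y)).natAbs ≤ M := by
      intro j hj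
      rw [Mem.upd_same, Mem.upd_reg_ne _ _ (show varAddr y ≠ 1 by omega), hs.v]
      refine (Int.natAbs_sub_le _ _).trans ?_
      have := hmul j hj
      rw [hz, Int.natAbs_natCast]
      nlinarith
    have hrep := hg1.run_rep_sub hM4 (varAddr y) h4 _ hbound
    have hg2 := hg1.scratch (r := 1) (by omega) hM4 (hbound _ le_rfl)
    have hg3 := hg2.scratch (r := 0) (z := 1) (by omega) hM4 (by simp; omega)
    refine ⟨_, _, Code.Run.ite_neg (by rwa [hs.v]) hg.within ((hg.run_scratch hM4 (r := 1) (z := z)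
      (by trivial) (by omega) hzM rfl).seq hrep) hg3.within, by omega,
      ((hs.scratch (by omega) _).scratch (by omega) _).scratch (by omega) _, hg3, ?_⟩
    rw [Mem.upd_reg_ne _ _ (show 1 ≠ 0 by omega), Mem.upd_same, Mem.upd_same,
      Mem.upd_reg_ne _ _ (show varAddr y ≠ 1 by omega), hs.v, hA, hz, arrAddr, if_neg hpos]
    have : s.v y = -((-s.v y).toNat : ℕ) := by omega
    rw [this]
    push_cast [Int.toNat_natCast, neg_neg]
    ring

/-- In at most `n` steps, the code `c` leads from `μ` to data that represent the state `s'`, with the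
registers in use bounded by `M` on the way and the values bounded by `b` at the end. -/
def Simulated (M C : ℕ) (c : Code) (μ : Mem) (s' : St V A) (b n : ℕ) : Prop :=
  ∃ μ' k, Code.Run (Mem.Within M) c μ μ' k ∧ k ≤ n ∧ Sim s' μ' ∧ Good M C b μ'

/-- The number of instructions that one step of a program may take. -/
def slowdown (A : Type) [Fintype A] : ℕ := 2 * Fintype.card A + 20

/-- The simulation of a program. In `t` steps the bound for the values grows by `C * t`. -/
theorem Prog.Run.simulated {P : Prog V A} {s s' : St V A} {t : ℕ} (h : P.Run s s' t) :
    P.lits ≤ C → ∀ {μ : Mem} {b : ℕ}, Sim s μ → Good M C b μ → C ≤ b →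
      layoutBound V A (b + C * t) ≤ M →
      Simulated M C P.code μ s' (b + C * t) (slowdown A * t) ∧
      ∀ e f Q, P = .while e f Q → (0 < μ.reg 1 ↔ e.val s < f.val s) →
        ∃ μ' k, Code.Run (Mem.Within M) (.loop 1 (.seq Q.code (condCode e f))) μ μ' k ∧
          k + 5 ≤ slowdown A * t ∧ Sim s' μ' ∧ Good M C (b + C * t) μ' := by
  -- The second claim concerns a loop whose condition has already been evaluated; the first claim
  -- about `while` follows from it.
  have hwhile : ∀ {e f : Atom V} {Q : Prog V A} {s s' : St V A} {t : ℕ},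
      (Prog.while e f Q).lits ≤ C →
      (∀ {μ : Mem} {b : ℕ}, Sim s μ → Good M C b μ → C ≤ b → layoutBound V A (b + C * t) ≤ M →
        (0 < μ.reg 1 ↔ e.val s < f.val s) →
        ∃ μ' k, Code.Run (Mem.Within M) (.loop 1 (.seq Q.code (condCode e f))) μ μ' k ∧
          k + 5 ≤ slowdown A * t ∧ Sim s' μ' ∧ Good M C (b + C * t) μ') →
      ∀ {μ : Mem} {b : ℕ}, Sim s μ → Good M C b μ → C ≤ b → layoutBound V A (b + C * t) ≤ M →
      Simulated M C (Prog.while e f Q).code μ s' (b + C * t) (slowdown A * t) ∧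
      ∀ e' f' Q', Prog.while e f Q = .while e' f' Q' → (0 < μ.reg 1 ↔ e'.val s < f'.val s) →
        ∃ μ' k, Code.Run (Mem.Within M) (.loop 1 (.seq Q'.code (condCode e' f'))) μ μ' k ∧
          k + 5 ≤ slowdown A * t ∧ Sim s' μ' ∧ Good M C (b + C * t) μ' := by
    intro e f Q s s' t hl hB μ b hs hg hC hM
    simp only [Prog.lits, max_le_iff] at hl
    refine ⟨?_, ?_⟩
    · obtain ⟨μ1, n1, h1, hn1, hs1, hg1, hc⟩ := hs.cond hg ((layoutBound_mono (by omega)).trans hM)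
        e f (by omega) (by omega)
      obtain ⟨μ2, n2, h2, hn2, hs2, hg2⟩ := hB hs1 hg1 hC hM hc
      exact ⟨μ2, _, h1.seq h2, by omega, hs2, hg2⟩
    · rintro e' f' Q' ⟨⟩ hc
      exact hB hs hg hC hM hc
  -- Commands other than `while` need the first claim only.
  have hother : ∀ {P : Prog V A} {s s' : St V A} {t : ℕ}, (∀ e f Q, P ≠ .while e f Q) →
      (∀ {μ : Mem} {b : ℕ}, Sim s μ → Good M C b μ → C ≤ b → layoutBound V A (b + C * t) ≤ M →
        Simulated M C P.code μ s' (b + C * t) (slowdown A * t)) →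
      ∀ {μ : Mem} {b : ℕ}, Sim s μ → Good M C b μ → C ≤ b → layoutBound V A (b + C * t) ≤ M →
      Simulated M C P.code μ s' (b + C * t) (slowdown A * t) ∧
      ∀ e f Q, P = .while e f Q → (0 < μ.reg 1 ↔ e.val s < f.val s) →
        ∃ μ' k, Code.Run (Mem.Within M) (.loop 1 (.seq Q.code (condCode e f))) μ μ' k ∧
          k + 5 ≤ slowdown A * t ∧ Sim s' μ' ∧ Good M C (b + C * t) μ' :=
    fun hP h _ _ hs hg hC hM => ⟨h hs hg hC hM, fun e f Q hPe => (hP e f Q hPe).elim⟩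
  induction h with
  | @skip s =>
    intro _
    refine @hother _ _ _ _ (by simp) fun {μ b} hs hg hC hM => ?_
    unfold layoutBound at hM
    exact ⟨_, 1, hg.run_scratch (r := 1) (z := 0) (by omega) (by trivial) (by omega) (by simp) rfl,
      by unfold slowdown; omega, hs.scratch (by omega) _,
      (hg.scratch (by omega) (by omega) (by simp)).mono (by omega)⟩
  | @set s x e =>
    intro hl
    refine @hother _ _ _ _ (by simp) fun {μ b} hs hg hC hM => ?_
    simp only [Prog.lits] at hl
    have hz := hg.natAbs_atom hs e (by omega)
    have hx := varAddr_lt x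
    unfold layoutBound at hM
    cases e with
    | lit c =>
      simp only [Atom.val] at hz ⊢
      exact ⟨_, 1, hg.run_upd (b' := b + C * 1) (I := .const (varAddr x) c) (by trivial) (by omega)
        (by omega) (by omega) (by omega) rfl, by unfold slowdown; omega, hs.setv x c,
        hg.upd (by omega) (by omega) (by omega) (by omega)⟩
    | var y =>
      simp only [Atom.val] at hz ⊢
      have hg1 := hg.scratch (r := 2) (z := 0) (by omega) (by omega) (by simp)
      refine ⟨_, 1 + 1, (hg.run_scratch (r := 2) (z := 0) (by omega) (by trivial) (by omega)
        (by simp) rfl).seq (hg1.run_upd (b' := b + C * 1) (I := .add (varAddr x) (varAddr y) 2)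
        (r := varAddr x) (z := s.v y) (by trivial)
        (by omega) (by omega) (by omega) (by omega) ?_), by unfold slowdown; omega,
        (hs.scratch (by omega) _).setv x _, hg1.upd (by omega) (by omega) (by omega) (by omega)⟩
      have h4 := four_le_varAddr y
      have h3 : (μ.upd 2 0).reg (varAddr y) + (μ.upd 2 0).reg 2 = s.v y := by
        rw [Mem.upd_reg_ne _ _ (show varAddr y ≠ 2 by omega), Mem.upd_same, hs.v, add_zero]
      rw [← h3]; rfl
  | @inc s x c =>
    intro hl
    refine @hother _ _ _ _ (by simp) fun {μ b} hs hg hC hM => ?_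
    simp only [Prog.lits] at hl
    have hz := hg.natAbs_var hs x
    have hx := varAddr_lt x
    unfold layoutBound at hM
    have hg1 := hg.scratch (r := 2) (z := c) (by omega) (by omega) (by omega)
    refine ⟨_, 1 + 1, (hg.run_scratch (r := 2) (z := c) (by omega) (by trivial) (by omega)
        (by omega) rfl).seq (hg1.run_upd (b' := b + C * 1) (I := .add (varAddr x) (varAddr x) 2)
        (r := varAddr x) (z := s.v x + c) (by trivial)
        (by omega) (by omega) (by omega) (by omega) ?_), by unfold slowdown; omega,
        (hs.scratch (by omega) _).setv x _, hg1.upd (by omega) (by omega) (by omega) (by omega)⟩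
    have h4 := four_le_varAddr x
    have h3 : (μ.upd 2 c).reg (varAddr x) + (μ.upd 2 c).reg 2 = s.v x + c := by
      rw [Mem.upd_reg_ne _ _ (show varAddr x ≠ 2 by omega), Mem.upd_same, hs.v]
    rw [← h3]; rfl
  | @get s x y a =>
    intro _
    refine @hother _ _ _ _ (by simp) fun {μ b} hs hg hC hM => ?_
    obtain ⟨μ1, n1, h1, hn1, hs1, hg1, hr⟩ :=
      hs.addr hg ((layoutBound_mono (by omega)).trans hM) a y
    have hz := hg.natAbs_arr hs a (s.v y)
    have hx := varAddr_lt x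
    unfold layoutBound at hM
    refine ⟨_, _, h1.seq (hg1.run_upd (b' := b + C * 1) (I := .load (varAddr x) 1)
      (r := varAddr x) (z := s.a a (s.v y)) (by trivial) (by omega) (by omega) (by omega) (by omega) ?_),
      by unfold slowdown; omega, hs1.setv x _,
      hg1.upd (by omega) (by omega) (by omega) (by omega)⟩
    have h3 : μ1.reg (μ1.reg 1).toNat = s.a a (s.v y) := by
      rw [hr, Int.toNat_natCast, hs1.a]
    rw [← h3]; rfl
  | @put s x y a =>
    intro _
    refine @hother _ _ _ _ (by simp) fun {μ b} hs hg hC hM => ?_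
    obtain ⟨μ1, n1, h1, hn1, hs1, hg1, hr⟩ :=
      hs.addr hg ((layoutBound_mono (by omega)).trans hM) a y
    have hz := hg.natAbs_var hs x
    have hle := arrAddr_le (V := V) (a := a) (hg.natAbs_var hs y)
    have hM1 := (layoutBound_mono (V := V) (A := A) (show b ≤ b + C * 1 by omega)).trans hM
    unfold layoutBound at hM hM1
    refine ⟨_, _, h1.seq (hg1.run_upd (b' := b + C * 1) (I := .store 1 (varAddr x))
      (r := arrAddr V a (s.v y)) (z := s.v x) (by trivial) (by omega) (by omega) (by omega) (by omega)
      ?_), by unfold slowdown; omega, hs1.seta a _ _,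
      hg1.upd (by omega) (by omega) (by omega) (by omega)⟩
    simp only [Mem.exec, RAM.exec, Mem.at, Config.mem, Mem.upd, hr, Int.toNat_natCast, hs1.v]
  | @read s x =>
    intro _
    refine @hother _ _ _ _ (by simp) fun {μ b} hs hg hC hM => ?_
    have hx := varAddr_lt x
    unfold layoutBound at hM
    have hz : (s.inp.headD 0).natAbs ≤ C := by
      have := hg.inp
      rw [hs.inp] at this
      cases h : s.inp with
      | nil => simp
      | cons z l => exact this z (by simp [h])
    have hg1 := hg.upd (r := varAddr x) (z := s.inp.headD 0) (b' := b + C * 1) (by omega)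
      (by omega) (by omega) (by omega)
    have hs1 := hs.setv x (s.inp.headD 0)
    have he : μ.exec (.read (varAddr x)) =
        { μ.upd (varAddr x) (s.inp.headD 0) with input := s.inp.tail } := by
      rw [← hs.inp]; rfl
    have hr := Code.Run.instr (ok := Mem.Within M) (I := .read (varAddr x)) (by trivial) hg.within
      (by rw [he]; exact hg1.within)
    rw [he] at hr
    refine ⟨_, _, hr, by unfold slowdown; omega, ⟨hs1.v, hs1.a, rfl, hs1.out⟩,
      ⟨hg1.within, hg1.val, fun z hz => ?_⟩⟩
    refine hg.inp z ?_
    rw [hs.inp]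
    exact List.mem_of_mem_tail hz
  | @print s e =>
    intro hl
    refine @hother _ _ _ _ (by simp) fun {μ b} hs hg hC hM => ?_
    simp only [Prog.lits] at hl
    have hz := hg.natAbs_atom hs e (by omega)
    obtain ⟨n1, h1, hn1⟩ := hs.load hg ((layoutBound_mono (by omega)).trans hM) (r := 2)
      (by omega) e (by omega)
    unfold layoutBound at hM
    have hg1 := hg.scratch (r := 2) (z := e.val s) (by omega) (by omega) (by omega)
    have hs1 := hs.scratch (r := 2) (by omega) (e.val s)
    have he : (μ.upd 2 (e.val s)).exec (.print 2) =
        { μ.upd 2 (e.val s) with output := s.out ++ [e.val s] } := by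
      rw [← hs.out, ← Mem.upd_same μ 2 (e.val s)]
      simp only [Mem.upd_same]
      simp only [Mem.exec, RAM.exec, Mem.at, Config.mem, Mem.upd_same]
      rfl
    have hr := Code.Run.instr (ok := Mem.Within M) (I := .print 2) (by trivial) hg1.within
      (by rw [he]; exact hg1.within)
    rw [he] at hr
    exact ⟨_, _, h1.seq hr, by unfold slowdown; omega, ⟨hs1.v, hs1.a, hs1.inp, rfl⟩,
      ⟨hg1.within, fun r hr => (hg1.val r hr).trans (by omega), hg1.inp⟩⟩
  | @seq P Q s s' s'' t t' _ _ ih1 ih2 =>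
    intro hl
    simp only [Prog.lits, max_le_iff] at hl
    refine @hother _ _ _ _ (by simp) fun {μ b} hs hg hC hM => ?_
    rw [Nat.mul_add] at hM
    obtain ⟨⟨μ1, n1, h1, hn1, hs1, hg1⟩⟩ :=
      ih1 hl.1 hs hg hC ((layoutBound_mono (by omega)).trans hM)
    obtain ⟨⟨μ2, n2, h2, hn2, hs2, hg2⟩⟩ :=
      ih2 hl.2 hs1 hg1 (by omega) (by rwa [add_assoc])
    refine ⟨_, _, h1.seq h2, by rw [Nat.mul_add]; omega, hs2, hg2.mono ?_⟩
    rw [Nat.mul_add]; omega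
  | @ite_pos P Q e f s s' t hc _ ih =>
    intro hl
    simp only [Prog.lits, max_le_iff] at hl
    refine @hother _ _ _ _ (by simp) fun {μ b} hs hg hC hM => ?_
    rw [Nat.mul_add] at hM
    obtain ⟨μ1, n1, h1, hn1, hs1, hg1, hr⟩ := hs.cond hg ((layoutBound_mono (by omega)).trans hM)
      e f (by omega) (by omega)
    obtain ⟨⟨μ2, n2, h2, hn2, hs2, hg2⟩⟩ :=
      ih hl.2.1 hs1 hg1 hC ((layoutBound_mono (by omega)).trans hM)
    refine ⟨_, _, h1.seq (.ite_pos (hr.2 hc) hg1.within h2), ?_, hs2, hg2.mono ?_⟩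
    · rw [Nat.mul_add]; unfold slowdown at *; omega
    · rw [Nat.mul_add]; omega
  | @ite_neg P Q e f s s' t hc _ ih =>
    intro hl
    simp only [Prog.lits, max_le_iff] at hl
    refine @hother _ _ _ _ (by simp) fun {μ b} hs hg hC hM => ?_
    rw [Nat.mul_add] at hM
    obtain ⟨μ1, n1, h1, hn1, hs1, hg1, hr⟩ := hs.cond hg ((layoutBound_mono (by omega)).trans hM)
      e f (by omega) (by omega)
    obtain ⟨⟨μ2, n2, h2, hn2, hs2, hg2⟩⟩ :=
      ih hl.2.2 hs1 hg1 hC ((layoutBound_mono (by omega)).trans hM)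
    have hM4 : 4 ≤ M := by unfold layoutBound at hM; omega
    have hg3 := hg2.scratch (r := 0) (z := 1) (by omega) hM4 (by simp; omega)
    refine ⟨_, _, h1.seq (.ite_neg (fun h => hc (hr.1 h)) hg1.within h2 hg3.within), ?_,
      hs2.scratch (by omega) _, hg3.mono ?_⟩
    · rw [Nat.mul_add]; unfold slowdown at *; omega
    · rw [Nat.mul_add]; omega
  | @while_pos P e f s s' s'' t t' hc _ _ ih1 ih2 =>
    intro hl
    refine hwhile hl fun {μ b} hs hg hC hM hcond => ?_
    have hl' := hl
    simp only [Prog.lits, max_le_iff] at hl'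
    have hdist : C * (t + t' + 1) = C * t + C * t' + C := by ring
    rw [hdist] at hM ⊢
    obtain ⟨⟨μ1, n1, h1, hn1, hs1, hg1⟩⟩ :=
      ih1 hl'.2 hs hg hC ((layoutBound_mono (by omega)).trans hM)
    obtain ⟨μ2, n2, h2, hn2, hs2, hg2, hr2⟩ := hs1.cond hg1
      ((layoutBound_mono (by omega)).trans hM) e f (by omega) (by omega)
    have hM4 : 4 ≤ M := by unfold layoutBound at hM; omega
    have hg3 := hg2.scratch (r := 0) (z := 1) (by omega) hM4 (by simp; omega)
    obtain ⟨μ4, n4, h4, hn4, hs4, hg4⟩ := (ih2 hl (hs2.scratch (by omega) _) hg3 (by omega)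
      ((layoutBound_mono (by omega)).trans hM)).2 e f P rfl (by
        rw [Mem.upd_reg_ne _ _ (show 1 ≠ 0 by omega)]; exact hr2)
    refine ⟨μ4, _, .loop_pos (hcond.2 hc) hg.within (h1.seq h2) hg3.within h4, ?_, hs4,
      hg4.mono (by omega)⟩
    have : slowdown A * (t + t' + 1) = slowdown A * t + slowdown A * t' + slowdown A := by ring
    rw [this]
    have : 20 ≤ slowdown A := by unfold slowdown; omega
    omega
  | @while_neg P e f s hc =>
    intro hl
    refine hwhile hl fun {μ b} hs hg hC hM hcond => ?_
    have hM4 : 4 ≤ M := by unfold layoutBound at hM; omega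
    have hg3 := hg.scratch (r := 0) (z := 1) (by omega) hM4 (by simp; omega)
    exact ⟨_, _, .loop_neg (fun h => hc (hcond.1 h)) hg.within hg3.within,
      by unfold slowdown; omega, hs.scratch (by omega) _, hg3.mono (by omega)⟩
  | @mono P s s' t t' _ htt ih =>
    intro hl μ b hs hg hC hM
    have h1 := Nat.mul_le_mul_left C htt
    have h2 := Nat.mul_le_mul_left (slowdown A) htt
    obtain ⟨⟨μ1, n1, h1, hn1, hs1, hg1⟩, ih'⟩ :=
      ih hl hs hg hC ((layoutBound_mono (by omega)).trans hM)
    refine ⟨⟨μ1, n1, h1, by omega, hs1, hg1.mono (by omega)⟩, fun e f Q hP hc => ?_⟩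
    obtain ⟨μ2, n2, h2, hn2, hs2, hg2⟩ := ih' e f Q hP hc
    exact ⟨μ2, n2, h2, by omega, hs2, hg2.mono (by omega)⟩

end Simulation

/-! ### Programs that run in linear time solve problems in linear time -/

section Solve

variable {V A : Type} [DecidableEq V] [DecidableEq A] [Fintype V] [Fintype A]

theorem bigO_linear (K : ℕ) : BigO (fun n => K * (n + 1)) (fun n => (n : ℝ)) := by
  refine Asymptotics.IsBigO.of_bound (2 * K) ?_
  filter_upwards [Filter.eventually_ge_atTop 1] with n hn
  have h1 : (1 : ℝ) ≤ n := by exact_mod_cast hn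
  have hK : (0 : ℝ) ≤ K := Nat.cast_nonneg _
  simp only [Real.norm_eq_abs, Nat.cast_mul, Nat.cast_add, Nat.cast_one]
  rw [abs_of_nonneg (by positivity), abs_of_nonneg (by positivity)]
  nlinarith

theorem bigO_size (K : ℕ) : BigO (fun n => (K * (n + 1)).size) (fun n => Real.log n) := by
  refine Asymptotics.IsBigO.of_bound (5 / Real.log 2) ?_
  filter_upwards [Filter.eventually_ge_atTop (max K 2)] with n hn
  have hnK : K ≤ n := le_of_max_le_left hn
  have hn2 : 2 ≤ n := le_of_max_le_right hn
  have hlog2 : 0 < Real.log 2 := Real.log_pos one_lt_two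
  have hn0 : (0 : ℝ) < n := by exact_mod_cast (by omega : 0 < n)
  have hlogn : Real.log 2 ≤ Real.log n := Real.log_le_log two_pos (by exact_mod_cast hn2)
  rw [Real.norm_eq_abs, Real.norm_eq_abs, abs_of_nonneg (by positivity),
    abs_of_nonneg (hlog2.le.trans hlogn)]
  have h3 : K * (n + 1) ≤ n ^ 3 := by
    calc K * (n + 1) ≤ n * (n * n) := Nat.mul_le_mul hnK (by nlinarith)
      _ = n ^ 3 := by ring
  have hsize : ((n ^ 3).size - 1 : ℝ) * Real.log 2 ≤ 3 * Real.log n := by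
    have hpos : 0 < (n ^ 3).size := Nat.size_pos.2 (by positivity)
    have h1 : 2 ^ ((n ^ 3).size - 1) ≤ n ^ 3 := Nat.lt_size.1 (by omega)
    have h2 : Real.log ((2 : ℝ) ^ ((n ^ 3).size - 1)) ≤ Real.log ((n : ℝ) ^ 3) :=
      Real.log_le_log (by positivity) (by exact_mod_cast h1)
    rw [Real.log_pow, Real.log_pow, Nat.cast_sub hpos] at h2
    simpa using h2
  have hle : ((K * (n + 1)).size : ℝ) ≤ (n ^ 3).size := by exact_mod_cast Nat.size_le_size h3
  rw [div_mul_eq_mul_div, le_div_iff₀ hlog2]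
  nlinarith

theorem bigO_space (K : ℕ) :
    BigO (fun n => (K * (n + 1) + 1) * (2 * (K * (n + 1)).size + 1))
      (fun n => (n : ℝ) * Real.log n) := by
  have h1 : BigO (fun n => K * (n + 1) + 1) (fun n => (n : ℝ)) := by
    refine Asymptotics.IsBigO.trans (Asymptotics.IsBigO.of_bound 1 ?_) (bigO_linear (K + 1))
    filter_upwards with n
    rw [one_mul, Real.norm_natCast, Real.norm_natCast]
    exact_mod_cast (by nlinarith : K * (n + 1) + 1 ≤ (K + 1) * (n + 1))
  have h2 : BigO (fun n => 2 * (K * (n + 1)).size + 1) (fun n => Real.log n) := by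
    have h3 : BigO (fun n => 2 * ((K + 1) * (n + 1)).size + 1) (fun n => Real.log n) := by
      refine Asymptotics.IsBigO.trans (Asymptotics.IsBigO.of_bound 3 ?_) (bigO_size (K + 1))
      filter_upwards with n
      rw [Real.norm_natCast, Real.norm_natCast]
      have : 0 < ((K + 1) * (n + 1)).size := Nat.size_pos.2 (by positivity)
      exact_mod_cast (by omega :
        2 * ((K + 1) * (n + 1)).size + 1 ≤ 3 * ((K + 1) * (n + 1)).size)
    refine Asymptotics.IsBigO.trans (Asymptotics.IsBigO.of_bound 1 ?_) h3
    filter_upwards with n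
    rw [one_mul, Real.norm_natCast, Real.norm_natCast]
    have := Nat.size_le_size (show K * (n + 1) ≤ (K + 1) * (n + 1) by nlinarith)
    exact_mod_cast (by omega :
      2 * (K * (n + 1)).size + 1 ≤ 2 * ((K + 1) * (n + 1)).size + 1)
  have := Asymptotics.IsBigO.mul h1 h2
  simpa [BigO] using this

theorem space_le_of_within {M : ℕ} {c : Config} (h : c.mem.Within M) :
    space c ≤ (M + 1) * (2 * M.size + 1) := by
  have hsub : c.reg.support ⊆ Finset.range (M + 1) := by
    intro i hi
    have := (h i).2 (Finsupp.mem_support_iff.1 hi)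
    simpa using Nat.lt_succ_of_le this
  calc space c ≤ ∑ i ∈ c.reg.support, (2 * M.size + 1) := by
        refine Finset.sum_le_sum fun i hi => ?_
        have h1 := Nat.size_le_size ((h i).2 (Finsupp.mem_support_iff.1 hi))
        have h2 : (c.reg i).natAbs.size ≤ M.size := Nat.size_le_size (h i).1
        omega
    _ = c.reg.support.card * (2 * M.size + 1) := by simp
    _ ≤ (M + 1) * (2 * M.size + 1) :=
        Nat.mul_le_mul_right _ (by simpa using Finset.card_le_card hsub)

theorem iterate_step_of_halted {P : Program} {c : Config} (h : Halted P c) (n : ℕ) :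
    (step P)^[n] c = c := by
  have h1 : step P c = c := by
    unfold step
    rw [List.getElem?_eq_none h]
  exact Function.iterate_fixed h1 n

/-- The initial state of a program. -/
def St.init (V A : Type) (x : List ℤ) : St V A := ⟨fun _ => 0, fun _ _ => 0, x, []⟩

/-- A problem that is solved by a program in the language above in linear time is solved by a random
access machine in linear time and quasilinear space: since the program only ever adds
constants, the time bound also bounds the values and the array indices. -/
theorem solvable_of_prog {α : Type} {enc : α → List ℤ} {correct : α → List ℤ → Prop}
    (P : Prog V A) (K : ℕ) (henc : ∀ x, ∀ z ∈ enc x, z.natAbs ≤ 5)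
    (h : ∀ x, ∃ s, P.Run (St.init V A (enc x)) s (K * ((enc x).length + 1)) ∧ correct x s.out) :
    LinearTimeQuasilinearSpaceSolvable enc correct := by
  set C := P.lits + 5 with hC
  set B := layoutBound V A (C + C * K) with hB
  have hM : ∀ n, layoutBound V A (C + C * (K * (n + 1))) ≤ B * (n + 1) := by
    intro n
    rw [hB]
    calc layoutBound V A (C + C * (K * (n + 1)))
        ≤ layoutBound V A ((C + C * K) * (n + 1)) := layoutBound_mono (by nlinarith)
      _ ≤ _ := by unfold layoutBound; nlinarith [Nat.zero_le (Fintype.card V * n),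
          Nat.zero_le (Fintype.card A * n)]
  refine ⟨P.code.compile 0, fun n => slowdown A * K * (n + 1),
    fun n => (B * (n + 1) + 1) * (2 * (B * (n + 1)).size + 1), fun n => (B * (n + 1)).size,
    fun x => ?_, bigO_linear _, bigO_space B, bigO_size B⟩
  obtain ⟨s, hrun, hcorr⟩ := h x
  set n := (enc x).length with hn
  set μ₀ : Mem := ⟨0, enc x, []⟩ with hμ
  have hs : Sim (St.init V A (enc x)) μ₀ := ⟨fun _ => rfl, fun _ _ => rfl, rfl, rfl⟩
  have hg : Good (B * (n + 1)) C C μ₀ :=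
    ⟨fun r => by simp [hμ], fun r _ => by simp [hμ], fun z hz => (henc x z hz).trans (by omega)⟩
  obtain ⟨⟨μ', k, hk, hkn, hs', -⟩, -⟩ :=
    hrun.simulated (C := C) (by omega) hs hg le_rfl (hM n)
  have hreach := hk.reach (P := P.code.compile 0) (off := 0) ⟨[], [], by simp, rfl⟩
  have hstart : μ₀.at 0 = start (enc x) := rfl
  rw [hstart] at hreach
  have hhalt : Halted (P.code.compile 0) (μ'.at (0 + P.code.len)) := by
    simp [Halted, Code.length_compile, Mem.at]
  have hafter : ∀ τ, k ≤ τ →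
      configAt (P.code.compile 0) (enc x) τ = μ'.at (0 + P.code.len) := by
    intro τ hτ
    obtain ⟨d, rfl⟩ := Nat.exists_eq_add_of_le hτ
    rw [configAt, add_comm, Function.iterate_add_apply, hreach.1, iterate_step_of_halted hhalt]
  have hall : ∀ τ, (configAt (P.code.compile 0) (enc x) τ).mem.Within (B * (n + 1)) := by
    intro τ
    rcases le_total τ k with hτ | hτ
    · exact hreach.2 τ hτ
    · rw [hafter τ hτ]
      have := hreach.2 k le_rfl
      rwa [hreach.1] at this
  have hT := hafter (slowdown A * K * (n + 1)) (by rw [mul_assoc]; exact hkn)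
  refine ⟨by rw [hT]; exact hhalt, ?_, fun τ => ⟨space_le_of_within (hall τ), fun i =>
    Nat.size_le_size (hall τ i).1⟩⟩
  rw [hT]
  have : (μ'.at (0 + P.code.len)).output = s.out := hs'.out
  rwa [this]

theorem LinearTimeQuasilinearSpaceSolvable.linearTimeSolvable {α : Type} {enc : α → List ℤ}
    {correct : α → List ℤ → Prop} (h : LinearTimeQuasilinearSpaceSolvable enc correct) :
    LinearTimeSolvable enc correct := by
  obtain ⟨P, T, S, W, h1, h2, -, h3⟩ := h
  exact ⟨P, T, S, W, h1, h2, h3⟩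

end Solve

end RAM

namespace BaumslagSolitar

/-! ### Words and elements of the group -/

/-- One step of reading a word: the first component is the height (the exponent sum of `t` so far),
the second one the exponent sum of `a` at each height. -/
def scanStep (σ : ℤ × (ℤ → ℤ)) (l : Letter) : ℤ × (ℤ → ℤ) :=
  match l with
  | (Gen.a, b) => (σ.1, Function.update σ.2 σ.1 (σ.2 σ.1 + if b then 1 else -1))
  | (Gen.t, b) => (σ.1 + if b then 1 else -1, σ.2)

/-- The final height of a word, that is, its exponent sum of `t`. -/
def height (w : Word) : ℤ := (w.foldl scanStep (0, 0)).1

/-- The exponent sum of those letters `a^{±1}` of a word that are read at the height `i`. -/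
def coef (w : Word) : ℤ → ℤ := (w.foldl scanStep (0, 0)).2

theorem height_append_a (w : Word) (b : Bool) : height (w ++ [(Gen.a, b)]) = height w := by
  simp [height, scanStep]

theorem height_append_t (w : Word) (b : Bool) :
    height (w ++ [(Gen.t, b)]) = height w + if b then 1 else -1 := by
  simp [height, scanStep]

theorem coef_append_a (w : Word) (b : Bool) :
    coef (w ++ [(Gen.a, b)]) =
      Function.update (coef w) (height w) (coef w (height w) + if b then 1 else -1) := by
  simp [coef, height, scanStep]

theorem coef_append_t (w : Word) (b : Bool) : coef (w ++ [(Gen.t, b)]) = coef w := by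
  simp [coef, scanStep]

theorem abs_height_le (w : Word) : |height w| ≤ w.length := by
  induction w using List.reverseRecOn with
  | nil => simp [height]
  | append_singleton w l ih =>
    obtain ⟨g, b⟩ := l
    cases g
    · rw [height_append_a]; simp; omega
    · rw [height_append_t, abs_le] at *
      simp only [List.length_append, List.length_singleton]
      cases b <;> simp <;> omega

/-- The digits from height `-N` on. -/
def window (N : ℕ) (c : ℤ → ℤ) (j : ℕ) : ℤ := c (j - N)

theorem window_update {N k : ℕ} {i : ℤ} (h : i = k - N) (c : ℤ → ℤ) (z : ℤ) :
    window N (Function.update c i z) = Function.update (window N c) k z := by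
  funext j
  simp only [window, Function.update_apply]
  congr 1
  simp only [eq_iff_iff]
  omega

theorem sum_range_update {T i : ℕ} (hi : i < T) (g : ℕ → ℤ → ℤ) (c : ℕ → ℤ) (z : ℤ) :
    ∑ j ∈ Finset.range T, g j (Function.update c i z j) =
      ∑ j ∈ Finset.range T, g j (c j) + (g i z - g i (c i)) := by
  rw [← Finset.add_sum_erase _ _ (Finset.mem_range.2 hi),
    ← Finset.add_sum_erase (a := i) _ _ (Finset.mem_range.2 hi), Function.update_self]
  have : ∑ j ∈ (Finset.range T).erase i, g j (Function.update c i z j) =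
      ∑ j ∈ (Finset.range T).erase i, g j (c j) :=
    Finset.sum_congr rfl fun j hj => by rw [Function.update_of_ne (Finset.ne_of_mem_erase hj)]
  rw [this]; ring

/-- The generator `a` of `BS(1,p)`. -/
def genA (p : ℕ) : BS p := PresentedGroup.of Gen.a

/-- The generator `t` of `BS(1,p)`. -/
def genT (p : ℕ) : BS p := PresentedGroup.of Gen.t

theorem genT_mul_genA (p : ℕ) : genT p * genA p * (genT p)⁻¹ = genA p ^ p := by
  have h := PresentedGroup.one_of_mem (rels := relators p) (x := FreeGroup.of Gen.t *
    FreeGroup.of Gen.a * (FreeGroup.of Gen.t)⁻¹ * (FreeGroup.of Gen.a ^ p)⁻¹) rfl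
  simp only [map_mul, map_inv, map_pow] at h
  exact mul_inv_eq_one.1 h

theorem genT_pow_mul_genA_zpow (p k : ℕ) (z : ℤ) :
    genT p ^ k * genA p ^ z = genA p ^ (z * p ^ k) * genT p ^ k := by
  induction k generalizing z with
  | zero => simp
  | succ k ih =>
    have h1 : genT p * genA p ^ z = genA p ^ (z * p) * genT p := by
      have := congrArg (· ^ z) (genT_mul_genA p)
      simp only [conj_zpow] at this
      rw [← zpow_natCast, ← zpow_mul, mul_comm (p : ℤ)] at this
      rw [← this]; group
    rw [pow_succ, mul_assoc, h1, ← mul_assoc, ih, mul_assoc]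
    congr 2
    ring

theorem value_append (p : ℕ) (u v : Word) : value p (u ++ v) = value p u * value p v := by
  simp [value]

/-- The normal form `t⁻ᴺ aˣ tᵏ` of the element that a word of length at most `N` represents. -/
theorem value_eq (p : ℕ) {N T : ℕ} (hT : 2 * N < T) (w : Word) (hw : w.length ≤ N) :
    value p w = genT p ^ (-(N : ℤ)) *
      genA p ^ (∑ j ∈ Finset.range T, window N (coef w) j * (p : ℤ) ^ j) *
      genT p ^ ((N : ℤ) + height w) := by
  induction w using List.reverseRecOn with
  | nil => simp [value, coef, height, window]
  | append_singleton w l ih =>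
    rw [List.length_append, List.length_singleton] at hw
    have hh := abs_le.1 (abs_height_le w)
    rw [value_append, ih (by omega)]
    obtain ⟨g, b⟩ := l
    cases g
    · obtain ⟨k, hk⟩ : ∃ k : ℕ, (N : ℤ) + height w = k := ⟨((N : ℤ) + height w).toNat, by omega⟩
      rw [height_append_a, coef_append_a, window_update (k := k) (by omega),
        sum_range_update (i := k) (by omega) (fun j x => x * (p : ℤ) ^ j), hk]
      have h1 : value p [(Gen.a, b)] = genA p ^ (if b then 1 else -1 : ℤ) := by
        cases b <;> simp [value, letterValue, genA]
      have h2 : window N (coef w) k = coef w (height w) := by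
        rw [window]; congr 1; omega
      rw [h1, zpow_natCast, mul_assoc, mul_assoc, genT_pow_mul_genA_zpow, h2, ← mul_assoc,
        ← mul_assoc, mul_assoc _ (genA p ^ _) (genA p ^ _), ← zpow_add]
      congr 4
      ring
    · rw [height_append_t, coef_append_t, mul_assoc]
      have h1 : value p [(Gen.t, b)] = genT p ^ (if b then 1 else -1 : ℤ) := by
        cases b <;> simp [value, letterValue, genT]
      rw [h1, ← zpow_add, ← add_assoc]

theorem addRight_one_zpow (x : ℤ) (y : ℚ) : (Equiv.addRight (1 : ℚ) ^ x) y = y + x := by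
  induction x generalizing y with
  | zero => simp
  | succ n ih =>
    rw [zpow_add_one, Equiv.Perm.mul_apply, ih, Equiv.coe_addRight]
    push_cast; ring
  | pred n ih =>
    have : (Equiv.addRight (1 : ℚ))⁻¹ y = y - 1 := by
      rw [Equiv.Perm.inv_eq_iff_eq, Equiv.coe_addRight]; ring
    rw [zpow_sub_one, Equiv.Perm.mul_apply, this, ih]
    push_cast; ring

/-- The generator `a` has infinite order, as the affine action on the rationals shows. -/
theorem genA_zpow_injective {p : ℕ} (hp : 0 < p) {x y : ℤ} (h : genA p ^ x = genA p ^ y) :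
    x = y := by
  have hp' : (p : ℚ) ≠ 0 := by exact_mod_cast hp.ne'
  -- Here `a` acts as the translation by `1` and `t` as the scaling by `p`.
  let f : Gen → Equiv.Perm ℚ := fun g =>
    match g with
    | .a => Equiv.addRight 1
    | .t => Equiv.mulLeft₀ (p : ℚ) hp'
  have hf : ∀ r ∈ relators p, FreeGroup.lift f r = 1 := by
    rintro r rfl
    simp only [map_mul, map_inv, map_pow, FreeGroup.lift_apply_of]
    rw [mul_inv_eq_one]
    ext z
    have hinv : ((Equiv.mulLeft₀ (p : ℚ) hp')⁻¹ : Equiv.Perm ℚ) z = (p : ℚ)⁻¹ * z := rfl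
    have hpow := addRight_one_zpow p z
    rw [zpow_natCast, Int.cast_natCast] at hpow
    simp only [f, Equiv.Perm.mul_apply, hinv, hpow, Equiv.coe_addRight]
    change (p : ℚ) * ((p : ℚ)⁻¹ * z + 1) = z + p
    field_simp
  have h1 := congrArg (fun g => PresentedGroup.toGroup hf g 0) h
  simp only [map_zpow, genA, PresentedGroup.toGroup.of] at h1
  simpa [f, addRight_one_zpow] using h1

/-- The exponent sum of `t` is well defined on the group. -/
theorem exponent_t_eq {p : ℕ} {x y k l : ℤ} {g : BS p}
    (h : g * genA p ^ x * genT p ^ k = g * genA p ^ y * genT p ^ l) : k = l := by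
  let f : Gen → Multiplicative ℤ := fun g =>
    match g with
    | .a => 1
    | .t => Multiplicative.ofAdd 1
  have hf : ∀ r ∈ relators p, FreeGroup.lift f r = 1 := by
    rintro r rfl
    simp [f]
  have h1 := congrArg (fun g => PresentedGroup.toGroup hf g) h
  simp only [map_zpow, map_mul, genA, genT, PresentedGroup.toGroup.of, f, one_zpow, mul_one,
    mul_right_inj, ← ofAdd_zsmul, smul_eq_mul] at h1
  exact Multiplicative.ofAdd.injective h1

/-- Two words represent the same element if and only if they have the same height and their
coefficients are digits, in base `p`, of the same number. -/
theorem value_eq_iff {p : ℕ} (hp : 0 < p) {N T : ℕ} (hT : 2 * N < T) {u w : Word}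
    (hu : u.length ≤ N) (hw : w.length ≤ N) :
    value p u = value p w ↔ height u = height w ∧
      ∑ j ∈ Finset.range T, window N (coef u) j * (p : ℤ) ^ j =
        ∑ j ∈ Finset.range T, window N (coef w) j * (p : ℤ) ^ j := by
  rw [value_eq p hT u hu, value_eq p hT w hw]
  constructor
  · intro h
    have h1 := exponent_t_eq h
    have h2 : height u = height w := by omega
    rw [h2] at h
    exact ⟨h2, genA_zpow_injective hp (mul_left_cancel (mul_right_cancel h))⟩
  · rintro ⟨h1, h2⟩
    rw [h1, h2]

/-! ### Digit representations and their cost -/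

/-- The digits `c` represent the integer `X` in base `p`, and vanish outside of `[lo, hi]`, an
interval that contains `N` and `N + m`. Up to a power of `p`, such a representation stands for a path
from height `0` to height `m` that visits the heights from `lo - N` to `hi - N` and reads
`a ^ c j` at height `j - N`. -/
structure Rep (p T N : ℕ) (m X : ℤ) (lo hi : ℕ) (c : ℕ → ℤ) : Prop where
  lo_le : lo ≤ N
  lo_le' : (lo : ℤ) ≤ N + m
  le_hi : N ≤ hi
  le_hi' : N + m ≤ hi
  hi_lt : hi < T
  supp : ∀ j, c j ≠ 0 → lo ≤ j ∧ j ≤ hi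
  sum : ∑ j ∈ Finset.range T, c j * (p : ℤ) ^ j = X

/-- The number of letters needed to write down a representation, plus `|m|`. -/
def repCost (T lo hi : ℕ) (c : ℕ → ℤ) : ℤ := ∑ j ∈ Finset.range T, |c j| + 2 * ((hi : ℤ) - lo)

/-- A word yields a representation that costs at most its length. -/
theorem exists_rep (p : ℕ) {N T : ℕ} (hT : 2 * N < T) (w : Word) (hw : w.length ≤ N) :
    ∃ lo hi, Rep p T N (height w) (∑ j ∈ Finset.range T, window N (coef w) j * (p : ℤ) ^ j)
      lo hi (window N (coef w)) ∧
      repCost T lo hi (window N (coef w)) ≤ w.length + |height w| := by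
  induction w using List.reverseRecOn with
  | nil =>
    refine ⟨N, N, ⟨le_rfl, ?_, le_rfl, ?_, by omega, ?_, rfl⟩, ?_⟩ <;>
      simp [height, coef, window, repCost]
  | append_singleton w l ih =>
    rw [List.length_append, List.length_singleton] at hw
    have hh := abs_le.1 (abs_height_le w)
    have hh' := abs_le.1 (abs_height_le (w ++ [l]))
    rw [List.length_append, List.length_singleton] at hh' ⊢
    obtain ⟨lo, hi, ⟨h1, h2, h3, h4, h5, h6, h7⟩, hc⟩ := ih (by omega)
    obtain ⟨g, b⟩ := l
    cases g
    · obtain ⟨k, hk⟩ : ∃ k : ℕ, (N : ℤ) + height w = k := ⟨((N : ℤ) + height w).toNat, by omega⟩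
      rw [height_append_a] at *
      refine ⟨lo, hi, ⟨h1, h2, h3, h4, h5, ?_, rfl⟩, ?_⟩
      · intro j hj
        rw [coef_append_a, window_update (k := k) (by omega)] at hj
        by_cases hjk : j = k
        · omega
        · exact h6 j (by rwa [Function.update_of_ne hjk] at hj)
      · unfold repCost at *
        rw [coef_append_a, window_update (k := k) (by omega),
          sum_range_update (i := k) (by omega) (fun j x => |x|)]
        have h8 : window N (coef w) k = coef w (height w) := by
          rw [window]; congr 1; omega
        rw [h8]
        have h9 : |coef w (height w) + if b then 1 else -1| ≤ |coef w (height w)| + 1 := by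
          refine (abs_add_le _ _).trans ?_
          cases b <;> simp
        push_cast
        linarith
    · rw [height_append_t] at *
      rw [coef_append_t]
      cases b
      · simp only [Bool.false_eq_true, if_false] at *
        by_cases hlo : (lo : ℤ) = N + height w
        · refine ⟨lo - 1, hi, ⟨by omega, by omega, h3, by omega, h5, fun j hj => ?_, rfl⟩, ?_⟩
          · have := h6 j hj; omega
          · unfold repCost at *
            rw [abs_of_nonpos (by omega)] at *
            push_cast [show 1 ≤ lo by omega]
            linarith
        · refine ⟨lo, hi, ⟨h1, by omega, h3, by omega, h5, h6, rfl⟩, ?_⟩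
          have : |height w| ≤ |height w + -1| + 1 := by
            have := abs_sub_abs_le_abs_sub (height w) (height w + -1)
            simp at this; linarith
          push_cast
          linarith
      · simp only [if_true] at *
        by_cases hlo : (hi : ℤ) = N + height w
        · refine ⟨lo, hi + 1, ⟨h1, by omega, by omega, by omega, by omega, fun j hj => ?_, rfl⟩, ?_⟩
          · have := h6 j hj; omega
          · unfold repCost at *
            rw [abs_of_nonneg (by omega)] at *
            push_cast
            linarith
        · refine ⟨lo, hi, ⟨h1, by omega, by omega, by omega, h5, h6, rfl⟩, ?_⟩
          have : |height w| ≤ |height w + 1| + 1 := by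
            have := abs_sub_abs_le_abs_sub (height w) (height w + 1)
            simp at this; linarith
          push_cast
          linarith

/-- Carrying `q` from position `j` to position `j + 1`. -/
def carryOver (p : ℕ) (c : ℕ → ℤ) (j : ℕ) (q : ℤ) : ℕ → ℤ :=
  Function.update (Function.update c j (c j - q * p)) (j + 1) (c (j + 1) + q)

theorem sum_carryOver {p T j : ℕ} (hj : j + 1 < T) (g : ℕ → ℤ → ℤ) (c : ℕ → ℤ) (q : ℤ) :
    ∑ i ∈ Finset.range T, g i (carryOver p c j q i) = ∑ i ∈ Finset.range T, g i (c i) +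
      (g j (c j - q * p) - g j (c j)) + (g (j + 1) (c (j + 1) + q) - g (j + 1) (c (j + 1))) := by
  rw [carryOver, sum_range_update hj, sum_range_update (by omega),
    Function.update_of_ne (by omega)]

theorem Rep.carryOver {p T N lo hi hi' : ℕ} {m X : ℤ} {c : ℕ → ℤ} (h : Rep p T N m X lo hi c)
    {j : ℕ} (hj : lo ≤ j) (hj' : j + 1 ≤ hi') (hi1 : hi ≤ hi') (hi2 : hi' < T) (q : ℤ) :
    Rep p T N m X lo hi' (carryOver p c j q) := by
  obtain ⟨h1, h2, h3, h4, h5, h6, h7⟩ := h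
  refine ⟨h1, h2, by omega, by omega, hi2, fun i hi => ?_, ?_⟩
  · simp only [BaumslagSolitar.carryOver, Function.update_apply] at hi
    split_ifs at hi
    · omega
    · omega
    · have := h6 i hi; omega
  · rw [sum_carryOver (by omega) (fun i x => x * (p : ℤ) ^ i), h7]
    ring

/-- Some representation of least cost has small digits: a digit of absolute value at least `p`
below the top, or at least `2 p` at the top, may be reduced by a carry. Raising the top costs `2`, and
the carry of `±2` costs `2` again, which `2 p ≥ 4` makes up for. The bound `hK` on the cost leaves
room below `T` for the new top. -/
theorem Rep.exists_reduced {p T N : ℕ} (hp : 2 ≤ p) {m X K : ℤ} (hK : 2 * N + K + 2 < 2 * T) :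
    ∀ {lo hi : ℕ} {c : ℕ → ℤ}, Rep p T N m X lo hi c → repCost T lo hi c ≤ K →
      ∃ hi' c', Rep p T N m X lo hi' c' ∧ repCost T lo hi' c' ≤ K ∧
        (∀ j, j ≠ hi' → |c' j| ≤ p - 1) ∧ |c' hi'| ≤ 2 * p - 1 := by
  suffices H : ∀ n : ℕ, ∀ {lo hi : ℕ} {c : ℕ → ℤ}, (∑ j ∈ Finset.range T, |c j|) ≤ n →
      Rep p T N m X lo hi c → repCost T lo hi c ≤ K →
      ∃ hi' c', Rep p T N m X lo hi' c' ∧ repCost T lo hi' c' ≤ K ∧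
        (∀ j, j ≠ hi' → |c' j| ≤ p - 1) ∧ |c' hi'| ≤ 2 * p - 1 by
    intro lo hi c
    exact H (∑ j ∈ Finset.range T, |c j|).toNat (Int.self_le_toNat _)
  intro n
  induction n using Nat.strong_induction_on with
  | _ n ih =>
  intro lo hi c hn h hcost
  have hp' : (2 : ℤ) ≤ p := by exact_mod_cast hp
  have hnn : ∀ c : ℕ → ℤ, 0 ≤ ∑ j ∈ Finset.range T, |c j| := fun c =>
    Finset.sum_nonneg fun _ _ => abs_nonneg _
  by_cases h1 : ∀ j, j ≠ hi → |c j| ≤ p - 1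
  · by_cases h2 : |c hi| ≤ 2 * p - 1
    · exact ⟨hi, c, h, hcost, h1, h2⟩
    · have hhi : hi + 1 < T := by
        have := h.lo_le
        have := hnn c
        unfold repCost at hcost
        omega
      have hlo : lo ≤ hi := h.lo_le.trans h.le_hi
      have h3 : c (hi + 1) = 0 := by
        by_contra h3
        have := (h.supp _ h3).2
        omega
      obtain ⟨q, hq1, hq2⟩ : ∃ q : ℤ, |q| = 2 ∧ |c hi - q * p| = |c hi| - 2 * p := by
        rcases abs_cases (c hi) with ⟨hc, hc'⟩ | ⟨hc, hc'⟩
        · exact ⟨2, by norm_num, by rw [abs_of_nonneg (by linarith)]; linarith⟩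
        · exact ⟨-2, by norm_num, by rw [abs_of_nonpos (by linarith)]; linarith⟩
      have hsum := sum_carryOver (p := p) hhi (fun _ x => |x|) c q
      simp only [hq2, h3, zero_add, hq1, abs_zero] at hsum
      have h4 := h.carryOver hlo le_rfl (Nat.le_succ _) hhi q
      have h5 := hnn (BaumslagSolitar.carryOver p c hi q)
      refine ih (n - 1) (by omega) ?_ h4 ?_
      · omega
      · unfold repCost at *
        push_cast
        omega
  · push Not at h1
    obtain ⟨j, hj, hcj⟩ := h1
    have h3 : c j ≠ 0 := by
      intro h0; rw [h0, abs_zero] at hcj; linarith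
    have h4 := h.supp j h3
    have h5 := h.hi_lt
    obtain ⟨q, hq1, hq2⟩ : ∃ q : ℤ, |q| = 1 ∧ |c j - q * p| = |c j| - p := by
      rcases abs_cases (c j) with ⟨hc, hc'⟩ | ⟨hc, hc'⟩
      · exact ⟨1, by norm_num, by rw [abs_of_nonneg (by linarith)]; linarith⟩
      · exact ⟨-1, by norm_num, by rw [abs_of_nonpos (by linarith)]; linarith⟩
    have hsum := sum_carryOver (p := p) (T := T) (j := j) (by omega) (fun _ x => |x|) c q
    simp only [hq2] at hsum
    have h6 := abs_add_le (c (j + 1)) q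
    have h7 := hnn (BaumslagSolitar.carryOver p c j q)
    refine ih (n - 1) (by omega) ?_ (h.carryOver (hi' := hi) h4.1 (by omega) le_rfl h5 q) ?_
    · omega
    · unfold repCost at *
      omega

/-! ### Digits in base `p` -/

/-- The carry into position `j` when the integers `D` are made digits of absolute value below `p`. -/
def carryIn (p : ℕ) (D : ℕ → ℤ) : ℕ → ℤ
  | 0 => 0
  | j + 1 => (D j + carryIn p D j).tdiv p

/-- The digit in position `j`; it has the sign of `D j` plus the carry. -/
def digit (p : ℕ) (D : ℕ → ℤ) (j : ℕ) : ℤ := (D j + carryIn p D j).tmod p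

theorem digit_add_carryIn (p : ℕ) (D : ℕ → ℤ) (j : ℕ) :
    digit p D j + p * carryIn p D (j + 1) = D j + carryIn p D j :=
  Int.tmod_add_mul_tdiv _ _

theorem abs_digit_le {p : ℕ} (hp : 0 < p) (D : ℕ → ℤ) (j : ℕ) : |digit p D j| ≤ p - 1 := by
  have h2 : (digit p D j).natAbs < p := by
    rw [digit, Int.natAbs_tmod, Int.natAbs_natCast]
    exact Nat.mod_lt _ hp
  rw [Int.abs_eq_natAbs]
  omega

theorem sum_digit (p : ℕ) (D : ℕ → ℤ) (j : ℕ) :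
    ∑ i ∈ Finset.range j, digit p D i * (p : ℤ) ^ i + carryIn p D j * (p : ℤ) ^ j =
      ∑ i ∈ Finset.range j, D i * (p : ℤ) ^ i := by
  induction j with
  | zero => simp [carryIn]
  | succ j ih =>
    rw [Finset.sum_range_succ, Finset.sum_range_succ, ← ih]
    have := digit_add_carryIn p D j
    linear_combination (p : ℤ) ^ j * this

theorem two_mul_abs_carryIn_le {p : ℕ} (hp : 2 ≤ p) (D : ℕ → ℤ) (j : ℕ) :
    2 * |carryIn p D (j + 1)| ≤ |D j| + |carryIn p D j| := by
  refine le_trans ?_ (abs_add_le _ _)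
  rw [carryIn, Int.abs_eq_natAbs, Int.abs_eq_natAbs, Int.natAbs_tdiv]
  have : (D j + carryIn p D j).natAbs / (p : ℤ).natAbs * 2 ≤ (D j + carryIn p D j).natAbs := by
    rw [Int.natAbs_natCast]
    exact (Nat.mul_le_mul_left _ hp).trans (Nat.div_mul_le_self _ _)
  change 2 * (((D j + carryIn p D j).natAbs / (p : ℤ).natAbs : ℕ) : ℤ) ≤ _
  omega

/-- Carrying is cheap in total, since a carry is at most half as large as what causes it. -/
theorem sum_abs_carryIn_le {p : ℕ} (hp : 2 ≤ p) (D : ℕ → ℤ) (j : ℕ) :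
    ∑ i ∈ Finset.range j, |carryIn p D (i + 1)| + |carryIn p D j| ≤
      ∑ i ∈ Finset.range j, |D i| := by
  induction j with
  | zero => simp [carryIn]
  | succ j ih =>
    rw [Finset.sum_range_succ, Finset.sum_range_succ]
    have := two_mul_abs_carryIn_le hp D j
    linarith

/-- Above the nonzero integers among the `D j`, the carry dies out within `N` positions. -/
theorem carryIn_eq_zero {p : ℕ} (hp : 2 ≤ p) {D : ℕ → ℤ} {N : ℕ}
    (h0 : ∀ j, 2 * N < j → D j = 0) (hD : ∑ i ∈ Finset.range (2 * N + 1), |D i| ≤ N) {j : ℕ}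
    (hj : 3 * N + 1 ≤ j) : carryIn p D j = 0 := by
  have key : ∀ k, |carryIn p D (2 * N + 1 + k)| ≤ max ((N : ℤ) - k) 0 := by
    intro k
    induction k with
    | zero =>
      have h1 := sum_abs_carryIn_le hp D (2 * N + 1)
      have h2 : 0 ≤ ∑ i ∈ Finset.range (2 * N + 1), |carryIn p D (i + 1)| :=
        Finset.sum_nonneg fun _ _ => abs_nonneg _
      simp only [add_zero, Nat.cast_zero, sub_zero]
      exact le_max_of_le_left (by linarith)
    | succ k ih =>
      have h1 := two_mul_abs_carryIn_le hp D (2 * N + 1 + k)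
      rw [h0 _ (by omega), abs_zero] at h1
      have h2 := abs_nonneg (carryIn p D (2 * N + 1 + k + 1))
      rw [← add_assoc]
      push_cast
      omega
  obtain ⟨k, rfl⟩ := Nat.exists_eq_add_of_le (show 2 * N + 1 ≤ j by omega)
  have := key k
  rw [max_eq_right (by omega)] at this
  exact abs_nonpos_iff.1 this

/-! ### Representations as paths in a layered graph -/

/-- The phase of a state. The layers of the graph belong to the heights; each of them has 15 states,
which consist of a phase (`0`: below the interval of the heights visited, `1`: inside, `2`: above) and
of the carry into the next position, between `-2` and `2`. -/
def phase (q : Fin 15) : ℕ := q.val / 5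

/-- The carry of a state. -/
def carry (q : Fin 15) : ℤ := ((q.val % 5 : ℕ) : ℤ) - 2

/-- Phase `0` and carry `0`. -/
def startState : Fin 15 := 2

/-- Phase `2` and carry `0`. -/
def finalState : Fin 15 := 12

theorem exists_state {φ : ℕ} {k : ℤ} (hφ : φ ≤ 2) (hk : |k| ≤ 2) :
    ∃ q, phase q = φ ∧ carry q = k := by
  rw [abs_le] at hk
  refine ⟨⟨5 * φ + (k + 2).toNat, by omega⟩, ?_, ?_⟩
  · simp only [phase]; omega
  · simp only [carry]; omega

theorem eq_of_phase_of_carry {q q' : Fin 15} (h1 : phase q = phase q') (h2 : carry q = carry q') :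
    q = q' := by
  simp only [phase, carry] at h1 h2
  apply Fin.ext
  omega

/-- The digit that replaces `e` on the way from one state to another. -/
def label (p : ℕ) (e : ℤ) (q q' : Fin 15) : ℤ := e + carry q - p * carry q'

/-- The edges of the graph at a position with digit `e`; at some positions phase `1` is `forced`. -/
def Allowed (p : ℕ) (forced : Bool) (e : ℤ) (q q' : Fin 15) : Prop :=
  phase q ≤ phase q' ∧ (phase q' = 1 ∨ forced = false ∧ label p e q q' = 0)

instance (p : ℕ) (forced : Bool) (e : ℤ) (q q' : Fin 15) : Decidable (Allowed p forced e q q') :=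
  inferInstanceAs (Decidable (_ ∧ _))

/-- The cost of an edge: the letters `a^{±1}` at a height, and two letters `t^{±1}` for a height in
the interval visited. -/
def weight (p : ℕ) (e : ℤ) (q q' : Fin 15) : ℤ :=
  |label p e q q'| + if phase q' = 1 then 2 else 0

theorem weight_nonneg (p : ℕ) (e : ℤ) (q q' : Fin 15) : 0 ≤ weight p e q q' := by
  unfold weight; positivity

/-- `Path p f e j q x`: some path of cost `x` leads through `j` layers to the state `q`. -/
inductive Path (p : ℕ) (f : ℕ → Bool) (e : ℕ → ℤ) : ℕ → Fin 15 → ℤ → Prop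
  | zero : Path p f e 0 startState 0
  | succ {j : ℕ} {q q' : Fin 15} {x : ℤ} : Path p f e j q x → Allowed p (f j) (e j) q q' →
      Path p f e (j + 1) q' (x + weight p (e j) q q')

/-- A reduced representation is a path: with digits below `p` on both sides, the carries
cannot exceed `1`, except for the one after the top digit, which cannot exceed `2`. -/
theorem Rep.path {p T N lo hi : ℕ} (hp : 2 ≤ p) {m X : ℤ} {c : ℕ → ℤ}
    (h : Rep p T N m X lo hi c) (hc : ∀ j, j ≠ hi → |c j| ≤ p - 1) (hchi : |c hi| ≤ 2 * p - 1)
    (hT : hi + 1 < T) {e : ℕ → ℤ} (he : ∀ j, |e j| ≤ p - 1)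
    (hsum : ∑ j ∈ Finset.range T, e j * (p : ℤ) ^ j = X) {f : ℕ → Bool}
    (hf : ∀ j, f j = true → lo ≤ j ∧ j ≤ hi) :
    Path p f e T finalState (repCost T lo hi c + 2) := by
  have hp' : (2 : ℤ) ≤ p := by exact_mod_cast hp
  -- The carry into position `j`, in terms of the digits from `j` on; so it is an integer by
  -- definition, and the recursion `hrec` bounds it from below upwards.
  set k : ℕ → ℤ := fun j => ∑ i ∈ Finset.range (T - j), (c (j + i) - e (j + i)) * (p : ℤ) ^ i
    with hk
  have hrec : ∀ j < T, p * k (j + 1) = k j + e j - c j := by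
    intro j hj
    simp only [hk]
    rw [show T - j = (T - (j + 1)) + 1 by omega, Finset.sum_range_succ', Finset.mul_sum]
    have : ∀ i, (p : ℤ) * ((c (j + 1 + i) - e (j + 1 + i)) * (p : ℤ) ^ i) =
        (c (j + (i + 1)) - e (j + (i + 1))) * (p : ℤ) ^ (i + 1) := by
      intro i
      rw [show j + 1 + i = j + (i + 1) by ring]; ring
    simp only [this, add_zero, pow_zero]
    ring
  have hk0 : k 0 = 0 := by
    simp only [hk, Nat.sub_zero, zero_add, sub_mul, Finset.sum_sub_distrib, hsum, h.sum, sub_self]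
  have hkT : k T = 0 := by simp [hk]
  have hbound : ∀ j ≤ T, |k j| ≤ if j = hi + 1 then 2 else 1 := by
    intro j
    induction j with
    | zero => intro _; rw [hk0]; split_ifs <;> simp
    | succ j ih =>
      intro hj
      have h1 := ih (by omega)
      have h2 := hrec j (by omega)
      have h3 := abs_le.1 (he j)
      have h4 : |(p : ℤ) * k (j + 1)| = p * |k (j + 1)| := by
        rw [abs_mul, abs_of_nonneg (by omega : (0 : ℤ) ≤ p)]
      have h5 : |k j + e j - c j| ≤ |k j| + |e j| + |c j| :=
        (abs_sub _ _).trans (by linarith [abs_add_le (k j) (e j)])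
      rw [← h2, h4] at h5
      have h6 := he j
      by_cases hj1 : j = hi
      · subst hj1
        rw [if_pos rfl]
        rw [if_neg (by omega)] at h1
        by_contra hlt
        push Not at hlt
        nlinarith
      · have h7 := hc j hj1
        rw [if_neg (by omega)]
        by_contra hlt
        push Not at hlt
        by_cases hj2 : j = hi + 1
        · have h8 : c j = 0 := by
            by_contra h8
            have := (h.supp j h8).2
            omega
          rw [if_pos hj2] at h1
          rw [h8, abs_zero] at h5
          nlinarith
        · rw [if_neg hj2] at h1
          nlinarith
  have hlohi := h.lo_le.trans h.le_hi
  have hstate : ∀ j ≤ T, ∃ q, phase q = (if j ≤ lo then 0 else if j ≤ hi + 1 then 1 else 2) ∧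
      carry q = k j := by
    intro j hj
    refine exists_state ?_ ((hbound j hj).trans (by split_ifs <;> norm_num))
    split_ifs <;> norm_num
  have key : ∀ j ≤ T, ∃ q, phase q = (if j ≤ lo then 0 else if j ≤ hi + 1 then 1 else 2) ∧
      carry q = k j ∧ Path p f e j q
        (∑ i ∈ Finset.range j, |c i| + 2 * ((min j (hi + 1) - lo : ℕ) : ℤ)) := by
    intro j
    induction j with
    | zero =>
      intro _
      refine ⟨startState, ?_, ?_, ?_⟩
      · simp [phase, startState]
      · rw [hk0]; simp [carry, startState]
      · simpa using Path.zero
    | succ j ih =>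
      intro hj
      obtain ⟨q, hq1, hq2, hq3⟩ := ih (by omega)
      obtain ⟨q', hq1', hq2'⟩ := hstate (j + 1) hj
      refine ⟨q', hq1', hq2', ?_⟩
      have hlab : label p (e j) q q' = c j := by
        rw [label, hq2, hq2']
        linarith [hrec j (by omega)]
      have hact : phase q' = 1 ↔ lo ≤ j ∧ j ≤ hi := by
        rw [hq1']; grind
      have hallow : Allowed p (f j) (e j) q q' := by
        refine ⟨by rw [hq1, hq1']; grind, ?_⟩
        by_cases hj' : lo ≤ j ∧ j ≤ hi
        · exact Or.inl (hact.2 hj')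
        · refine Or.inr ⟨by_contra fun hfj => hj' (hf j (by simpa using hfj)), ?_⟩
          rw [hlab]
          by_contra h8
          exact hj' (h.supp j h8)
      have := hq3.succ hallow
      convert this using 1
      rw [weight, hlab, Finset.sum_range_succ]
      split_ifs with hph
      · have := hact.1 hph
        have h9 : (min (j + 1) (hi + 1) - lo : ℕ) = (min j (hi + 1) - lo : ℕ) + 1 := by omega
        rw [h9]; push_cast; ring
      · have h10 : ¬ (lo ≤ j ∧ j ≤ hi) := fun h => hph (hact.2 h)
        have h9 : (min (j + 1) (hi + 1) - lo : ℕ) = (min j (hi + 1) - lo : ℕ) := by omega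
        rw [h9]; ring
  obtain ⟨q, hq1, hq2, hq3⟩ := key T le_rfl
  have hq : q = finalState := by
    refine eq_of_phase_of_carry ?_ ?_
    · rw [hq1, if_neg (by omega), if_neg (by omega)]; rfl
    · rw [hq2, hkT]; rfl
  rw [hq] at hq3
  convert hq3 using 1
  rw [repCost, show (min T (hi + 1) - lo : ℕ) = hi + 1 - lo by omega]
  push_cast [show lo ≤ hi + 1 by omega]
  ring

/-- The positions that belong to the heights between `0` and `m`. -/
def forced (N : ℕ) (m : ℤ) (j : ℕ) : Bool :=
  decide (min 0 m ≤ (j : ℤ) - N ∧ (j : ℤ) - N ≤ max 0 m)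

/-- A sequence of states from the start to the end of the graph yields a representation. -/
theorem exists_rep_of_states {p T N : ℕ} {m X : ℤ} {e : ℕ → ℤ}
    (hN : N < T) (hm : 0 ≤ N + m) (hm' : N + m < T)
    (hsum : ∑ j ∈ Finset.range T, e j * (p : ℤ) ^ j = X) {qs : ℕ → Fin 15}
    (h0 : qs 0 = startState) (hlast : qs T = finalState)
    (hall : ∀ j < T, Allowed p (forced N m j) (e j) (qs j) (qs (j + 1))) :
    ∃ lo hi, (∀ j < T, phase (qs (j + 1)) = if j < lo then 0 else if j ≤ hi then 1 else 2) ∧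
      Rep p T N m X lo hi
        (fun j => if j < T then label p (e j) (qs j) (qs (j + 1)) else 0) ∧
      repCost T lo hi (fun j => if j < T then label p (e j) (qs j) (qs (j + 1)) else 0) + 2 =
        ∑ j ∈ Finset.range T, weight p (e j) (qs j) (qs (j + 1)) := by
  have hmono : ∀ j < T, ∀ i ≤ j, phase (qs (i + 1)) ≤ phase (qs (j + 1)) := by
    intro j hj i hij
    induction j, hij using Nat.le_induction with
    | base => exact le_rfl
    | succ j hij ih => exact (ih (by omega)).trans (hall _ hj).1
  have hle2 : ∀ q, phase q ≤ 2 := fun q => by simp only [phase]; omega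
  have hforced : ∀ j < T, forced N m j = true → phase (qs (j + 1)) = 1 := by
    intro j hj hf
    rcases (hall j hj).2 with h | h
    · exact h
    · rw [h.1] at hf; exact absurd hf (by simp)
  have hφN : phase (qs (N + 1)) = 1 := hforced N hN (by simp [forced])
  obtain ⟨M, hM⟩ : ∃ M : ℕ, (M : ℤ) = N + m := ⟨(N + m).toNat, by omega⟩
  have hφM : phase (qs (M + 1)) = 1 :=
    hforced M (by omega) (by simp only [forced, decide_eq_true_eq]; omega)
  have hφT : phase (qs (T - 1 + 1)) = 2 := by
    rw [show T - 1 + 1 = T by omega, hlast]; rfl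
  have hex1 : ∃ j, 1 ≤ phase (qs (j + 1)) := ⟨N, hφN.ge⟩
  have hex2 : ∃ j, 2 ≤ phase (qs (j + 1)) := ⟨T - 1, hφT.ge⟩
  classical
  obtain ⟨lo, hlo, hlo'⟩ : ∃ lo, 1 ≤ phase (qs (lo + 1)) ∧ ∀ j < lo, phase (qs (j + 1)) = 0 :=
    ⟨Nat.find hex1, Nat.find_spec hex1, fun j hj => by have := Nat.find_min hex1 hj; omega⟩
  obtain ⟨up, hup, hup'⟩ : ∃ up, 2 ≤ phase (qs (up + 1)) ∧ ∀ j < up, phase (qs (j + 1)) < 2 :=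
    ⟨Nat.find hex2, Nat.find_spec hex2, fun j hj => by have := Nat.find_min hex2 hj; omega⟩
  have hloN : lo ≤ N := by
    by_contra h; have := hlo' N (by omega); omega
  have hloM : lo ≤ M := by
    by_contra h; have := hlo' M (by omega); omega
  have hupT : up ≤ T - 1 := by
    by_contra h; have := hup' (T - 1) (by omega); omega
  have hNup : N < up := by
    by_contra h
    have := hmono N hN up (by omega); omega
  have hMup : M < up := by
    by_contra h
    have := hmono M (by omega) up (by omega); omega
  obtain ⟨hi, rfl⟩ : ∃ hi, up = hi + 1 := ⟨up - 1, by omega⟩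
  have hphase : ∀ j < T, phase (qs (j + 1)) = if j < lo then 0 else if j ≤ hi then 1 else 2 := by
    intro j hj
    split_ifs with h1 h2
    · exact hlo' j h1
    · have := hup' j (by omega)
      have := hmono j hj lo (by omega)
      omega
    · have := hmono j hj (hi + 1) (by omega)
      have := hle2 (qs (j + 1))
      omega
  have hsupp : ∀ j < T, label p (e j) (qs j) (qs (j + 1)) ≠ 0 → lo ≤ j ∧ j ≤ hi := by
    intro j hj hne
    rcases (hall j hj).2 with h | h
    · rw [hphase j hj] at h
      split_ifs at h <;> omega
    · exact absurd h.2 hne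
  have htele : ∀ j ≤ T, ∑ i ∈ Finset.range j, label p (e i) (qs i) (qs (i + 1)) * (p : ℤ) ^ i +
      carry (qs j) * (p : ℤ) ^ j = ∑ i ∈ Finset.range j, e i * (p : ℤ) ^ i := by
    intro j
    induction j with
    | zero => intro _; simp [h0, carry, startState]
    | succ j ih =>
      intro hj
      rw [Finset.sum_range_succ, Finset.sum_range_succ, ← ih (by omega), label]
      ring
  refine ⟨lo, hi, hphase, ⟨hloN, by omega, by omega, by omega, by omega, ?_, ?_⟩, ?_⟩
  · intro j hj
    split_ifs at hj with hjT
    · exact hsupp j hjT hj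
    · exact absurd rfl hj
  · have h1 := htele T le_rfl
    have h2 : carry finalState = 0 := rfl
    rw [hlast, h2, zero_mul, add_zero, hsum] at h1
    rw [← h1]
    exact Finset.sum_congr rfl fun j hj => by rw [if_pos (Finset.mem_range.1 hj)]
  · have h1 : ∑ j ∈ Finset.range T, weight p (e j) (qs j) (qs (j + 1)) =
        ∑ j ∈ Finset.range T, (|if j < T then label p (e j) (qs j) (qs (j + 1)) else 0| +
          if j ∈ Finset.Icc lo hi then (2 : ℤ) else 0) := by
      refine Finset.sum_congr rfl fun j hj => ?_
      have hj := Finset.mem_range.1 hj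
      rw [weight, if_pos hj, hphase j hj]
      have h2 : (if j < lo then 0 else if j ≤ hi then 1 else 2) = 1 ↔ j ∈ Finset.Icc lo hi := by
        rw [Finset.mem_Icc]
        grind
      simp only [h2]
    rw [h1, Finset.sum_add_distrib, ← Finset.sum_filter, repCost]
    have h2 : (Finset.range T).filter (· ∈ Finset.Icc lo hi) = Finset.Icc lo hi := by
      ext j
      simp only [Finset.mem_filter, Finset.mem_range, Finset.mem_Icc]
      omega
    rw [h2, Finset.sum_const, Nat.card_Icc, nsmul_eq_mul]
    push_cast [show lo ≤ hi + 1 by omega]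
    ring

/-! ### Dynamic programming -/

/-- The tables `B` of predecessors and `L` of labels describe a path of cost `x` through `j` layers
to the state `q`. -/
inductive Traced (p : ℕ) (f : ℕ → Bool) (e : ℕ → ℤ) (B L : Fin 15 → ℕ → ℤ) :
    ℕ → Fin 15 → ℤ → Prop
  | zero : Traced p f e B L 0 startState 0
  | succ {j : ℕ} {q q' : Fin 15} {x : ℤ} : Traced p f e B L j q x →
      Allowed p (f j) (e j) q q' → B q' j = q.val → L q' j = label p (e j) q q' →
      Traced p f e B L (j + 1) q' (x + weight p (e j) q q')

theorem Traced.congr {p : ℕ} {f : ℕ → Bool} {e : ℕ → ℤ} {B L B' L' : Fin 15 → ℕ → ℤ} {j : ℕ}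
    {q : Fin 15} {x : ℤ} (h : Traced p f e B L j q x) (hB : ∀ q, ∀ i < j, B' q i = B q i)
    (hL : ∀ q, ∀ i < j, L' q i = L q i) : Traced p f e B' L' j q x := by
  induction h with
  | zero => exact .zero
  | @succ j q q' x _ ha h1 h2 ih =>
    exact .succ (ih (fun q i hi => hB q i (by omega)) (fun q i hi => hL q i (by omega))) ha
      (by rw [hB _ _ (by omega), h1]) (by rw [hL _ _ (by omega), h2])

theorem Traced.exists_states {p : ℕ} {f : ℕ → Bool} {e : ℕ → ℤ} {B L : Fin 15 → ℕ → ℤ} {T : ℕ}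
    {q : Fin 15} {x : ℤ} (h : Traced p f e B L T q x) :
    ∃ qs : ℕ → Fin 15, qs 0 = startState ∧ qs T = q ∧
      (∀ j < T, Allowed p (f j) (e j) (qs j) (qs (j + 1)) ∧ B (qs (j + 1)) j = (qs j).val ∧
        L (qs (j + 1)) j = label p (e j) (qs j) (qs (j + 1))) ∧
      x = ∑ j ∈ Finset.range T, weight p (e j) (qs j) (qs (j + 1)) := by
  induction h with
  | zero => exact ⟨fun _ => startState, rfl, rfl, by simp, by simp⟩
  | @succ T q q' x _ ha h1 h2 ih =>
    obtain ⟨qs, hq0, hqT, hall, hx⟩ := ih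
    refine ⟨fun j => if j = T + 1 then q' else qs j, by simpa using hq0, by simp, ?_, ?_⟩
    · intro j hj
      by_cases hjT : j = T
      · subst hjT
        simp only [if_pos, if_neg (show j ≠ j + 1 by omega), hqT]
        exact ⟨ha, h1, h2⟩
      · simp only [if_neg (show j ≠ T + 1 by omega), if_neg (show j + 1 ≠ T + 1 by omega)]
        exact hall j (by omega)
    · rw [Finset.sum_range_succ, hx]
      congr 1
      · refine Finset.sum_congr rfl fun j hj => ?_
        have := Finset.mem_range.1 hj
        simp only [if_neg (show j ≠ T + 1 by omega), if_neg (show j + 1 ≠ T + 1 by omega)]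
      · simp only [if_pos, if_neg (show T ≠ T + 1 by omega), hqT]

/-- The costs `v` are those of the cheapest paths to the states of layer `j`, as far as they are
below the bound `I`, and the tables describe such paths. No value `I` or more needs to be the cost of
a path, so `I` serves as infinity. -/
structure Optimal (p : ℕ) (f : ℕ → Bool) (e : ℕ → ℤ) (I : ℤ) (B L : Fin 15 → ℕ → ℤ) (j : ℕ)
    (v : Fin 15 → ℤ) : Prop where
  le_path : ∀ q x, Path p f e j q x → v q ≤ x
  traced : ∀ q, v q < I → Traced p f e B L j q (v q)

theorem Optimal.init {p : ℕ} {f : ℕ → Bool} {e : ℕ → ℤ} {I : ℤ} {B L : Fin 15 → ℕ → ℤ}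
    {v : Fin 15 → ℤ} (h0 : v startState = 0) (h : ∀ q, q ≠ startState → v q = I) :
    Optimal p f e I B L 0 v := by
  refine ⟨fun q x hx => ?_, fun q hq => ?_⟩
  · cases hx; exact h0.le
  · by_cases hq' : q = startState
    · rw [hq', h0]; exact .zero
    · exact absurd (h q hq') hq.ne

/-- The Bellman recursion. -/
theorem Optimal.succ {p : ℕ} {f : ℕ → Bool} {e : ℕ → ℤ} {I : ℤ} {B L B' L' : Fin 15 → ℕ → ℤ}
    {j : ℕ} {v v' : Fin 15 → ℤ} (h : Optimal p f e I B L j v)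
    (hB : ∀ q, ∀ i, i ≠ j → B' q i = B q i) (hL : ∀ q, ∀ i, i ≠ j → L' q i = L q i)
    (h2 : ∀ q q', Allowed p (f j) (e j) q q' → v' q' ≤ v q + weight p (e j) q q')
    (h3 : ∀ q', v' q' < I → ∃ q, Allowed p (f j) (e j) q q' ∧ B' q' j = q.val ∧
      L' q' j = label p (e j) q q' ∧ v' q' = v q + weight p (e j) q q') :
    Optimal p f e I B' L' (j + 1) v' := by
  refine ⟨fun q' x hx => ?_, fun q' hq' => ?_⟩
  · cases hx with
    | @succ _ q _ x hx ha =>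
      have := h.le_path q x hx
      have := h2 q q' ha
      linarith
  · obtain ⟨q, ha, hb, hl, hv⟩ := h3 q' hq'
    rw [hv]
    have hw := weight_nonneg p (e j) q q'
    exact .succ ((h.traced q (by linarith)).congr (fun q i hi => hB q i (by omega))
      (fun q i hi => hL q i (by omega))) ha hb hl

end BaumslagSolitar

namespace RAM

/-! ### Rules for programs -/

section Rules

variable {V A : Type} [DecidableEq V] [DecidableEq A]

/-- Started in `s`, the program ends after at most `t` steps, in a state with the property `Q`. -/
def Prog.Ends (P : Prog V A) (s : St V A) (t : ℕ) (Q : St V A → Prop) : Prop :=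
  ∃ s', P.Run s s' t ∧ Q s'

theorem Prog.Ends.mono {P : Prog V A} {s : St V A} {t t' : ℕ} {Q Q' : St V A → Prop}
    (h : P.Ends s t Q) (ht : t ≤ t') (hQ : ∀ s, Q s → Q' s) : P.Ends s t' Q' := by
  obtain ⟨s', h1, h2⟩ := h
  exact ⟨s', h1.mono ht, hQ _ h2⟩

theorem Prog.Ends.seq {P P' : Prog V A} {s : St V A} {t t' : ℕ} {Q Q' : St V A → Prop}
    (h : P.Ends s t Q) (h' : ∀ s, Q s → P'.Ends s t' Q') : (Prog.seq P P').Ends s (t + t') Q' := by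
  obtain ⟨s', h1, h2⟩ := h
  obtain ⟨s'', h3, h4⟩ := h' s' h2
  exact ⟨s'', h1.seq h3, h4⟩

theorem Prog.Ends.ite_pos {P P' : Prog V A} {e f : Atom V} {s : St V A} {t : ℕ}
    {Q : St V A → Prop} (hc : e.val s < f.val s) (h : P.Ends s t Q) :
    (Prog.ite e f P P').Ends s (t + 1) Q := by
  obtain ⟨s', h1, h2⟩ := h
  exact ⟨s', .ite_pos hc h1, h2⟩

theorem Prog.Ends.ite_neg {P P' : Prog V A} {e f : Atom V} {s : St V A} {t : ℕ}
    {Q : St V A → Prop} (hc : ¬ e.val s < f.val s) (h : P'.Ends s t Q) :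
    (Prog.ite e f P P').Ends s (t + 1) Q := by
  obtain ⟨s', h1, h2⟩ := h
  exact ⟨s', .ite_neg hc h1, h2⟩

/-- A loop that is run through exactly `k` times, with an invariant that may depend on the number
of the round. -/
theorem Prog.Ends.while {P : Prog V A} {e f : Atom V} {s : St V A} (k : ℕ) (t : ℕ → ℕ)
    (Inv : ℕ → St V A → Prop) (h0 : Inv 0 s)
    (hstep : ∀ i < k, ∀ s, Inv i s → e.val s < f.val s ∧ P.Ends s (t i) (Inv (i + 1)))
    (hend : ∀ s, Inv k s → ¬ e.val s < f.val s) :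
    (Prog.while e f P).Ends s (∑ i ∈ Finset.range k, (t i + 1) + 1) (Inv k) := by
  induction k generalizing s t Inv with
  | zero => exact ⟨s, .mono (.while_neg (hend s h0)) (by simp), h0⟩
  | succ k ih =>
    obtain ⟨hc, s', h1, h2⟩ := hstep 0 (by omega) s h0
    obtain ⟨s'', h3, h4⟩ := ih (fun i => t (i + 1)) (fun i => Inv (i + 1)) h2
      (fun i hi => hstep (i + 1) (by omega)) hend
    refine ⟨s'', .mono (.while_pos hc h1 h3) ?_, h4⟩
    rw [Finset.sum_range_succ']
    omega

/-- The program contains no loops. -/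
def Prog.LoopFree : Prog V A → Prop
  | .seq P Q => P.LoopFree ∧ Q.LoopFree
  | .ite _ _ P Q => P.LoopFree ∧ Q.LoopFree
  | .while _ _ _ => False
  | _ => True

/-- The final state of a program without loops. -/
def Prog.eval : Prog V A → St V A → St V A
  | .skip, s => s
  | .set x e, s => s.setv x (e.val s)
  | .inc x c, s => s.setv x (s.v x + c)
  | .get x a y, s => s.setv x (s.a a (s.v y))
  | .put a y x, s => s.seta a (s.v y) (s.v x)
  | .read x, s => { s.setv x (s.inp.headD 0) with inp := s.inp.tail }
  | .print e, s => { s with out := s.out ++ [e.val s] }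
  | .seq P Q, s => Q.eval (P.eval s)
  | .ite e f P Q, s => if e.val s < f.val s then P.eval s else Q.eval s
  | .while _ _ _, s => s

/-- A bound for the number of steps of a program without loops. -/
def Prog.cost : Prog V A → ℕ
  | .seq P Q => P.cost + Q.cost
  | .ite _ _ P Q => max P.cost Q.cost + 1
  | _ => 1

theorem Prog.LoopFree.run {P : Prog V A} (h : P.LoopFree) (s : St V A) :
    P.Run s (P.eval s) P.cost := by
  induction P generalizing s with
  | skip => exact .skip
  | set => exact .set
  | inc => exact .inc
  | get => exact .get
  | put => exact .put
  | read => exact .read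
  | print => exact .print
  | seq P Q ihP ihQ => exact .seq (ihP h.1 s) (ihQ h.2 _)
  | ite e f P Q ihP ihQ =>
    by_cases hc : e.val s < f.val s
    · simp only [eval, if_pos hc, cost]
      exact .mono (.ite_pos hc (ihP h.1 s)) (by omega)
    · simp only [eval, if_neg hc, cost]
      exact .mono (.ite_neg hc (ihQ h.2 s)) (by omega)
  | _ => exact h.elim

theorem Prog.LoopFree.ends {P : Prog V A} (h : P.LoopFree) {s : St V A} {Q : St V A → Prop}
    (hQ : Q (P.eval s)) : P.Ends s P.cost Q := ⟨_, h.run s, hQ⟩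

/-- A list of programs, one after the other. -/
def Prog.block : List (Prog V A) → Prog V A
  | [] => .skip
  | P :: l => .seq P (Prog.block l)

theorem Prog.loopFree_block {l : List (Prog V A)} (h : ∀ P ∈ l, P.LoopFree) :
    (Prog.block l).LoopFree := by
  induction l with
  | nil => trivial
  | cons P l ih =>
    exact ⟨h P (by simp), ih fun Q hQ => h Q (by simp [hQ])⟩

theorem Prog.eval_block_append (l l' : List (Prog V A)) (s : St V A) :
    (Prog.block (l ++ l')).eval s = (Prog.block l').eval ((Prog.block l).eval s) := by
  induction l generalizing s with
  | nil => rfl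
  | cons P l ih => exact ih _

/-- Case distinction: the program `l[i]` is run if the variable `x` has the value `c + i`. -/
def Prog.cases (x : V) : ℤ → List (Prog V A) → Prog V A
  | _, [] => .skip
  | c, P :: l => .ite (.var x) (.lit (c + 1)) P (Prog.cases x (c + 1) l)

theorem Prog.loopFree_cases (x : V) (c : ℤ) {l : List (Prog V A)} (h : ∀ P ∈ l, P.LoopFree) :
    (Prog.cases x c l).LoopFree := by
  induction l generalizing c with
  | nil => trivial
  | cons P l ih => exact ⟨h P (by simp), ih _ fun Q hQ => h Q (by simp [hQ])⟩

theorem Prog.eval_cases {x : V} {c : ℤ} {l : List (Prog V A)} {s : St V A} {i : ℕ}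
    (hi : i < l.length) (hx : s.v x = c + i) : (Prog.cases x c l).eval s = l[i].eval s := by
  induction l generalizing c i with
  | nil => simp at hi
  | cons P l ih =>
    cases i with
    | zero => simp [cases, eval, Atom.val, hx]
    | succ i =>
      have h1 : ¬ (Atom.var x : Atom V).val s < (Atom.lit (c + 1) : Atom V).val s := by
        simp only [Atom.val, hx]; push_cast; omega
      simp only [cases, eval, if_neg h1]
      rw [ih (by simpa using hi) (by rw [hx]; push_cast; ring)]
      rfl

end Rules

end RAM

namespace BaumslagSolitar

open RAM (Atom Prog St)

/-! ### Reading the word -/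

/-- The variables of the program. -/
inductive Var : Type
  /-- the last input symbol -/
  | sym : Var
  /-- whether the word goes on -/
  | go : Var
  /-- the height of the part of the word read so far -/
  | m : Var
  /-- the lowest height of the window considered -/
  | bot : Var
  /-- the upper end of the window considered -/
  | top : Var
  /-- a bound that the costs of all relevant paths obey -/
  | inf : Var
  /-- a height -/
  | h : Var
  /-- the height above `h` -/
  | nxt : Var
  /-- a digit -/
  | e : Var
  /-- whether phase `1` is forced -/
  | frc : Var
  | tmp : Var
  /-- the best predecessor so far -/
  | best : Var
  /-- the label that goes with it -/
  | lab : Var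
  /-- a state of the graph -/
  | q : Var
  /-- the lowest height visited -/
  | lo : Var
  /-- the highest height visited -/
  | hi : Var
  /-- the height of the part of the output produced so far -/
  | x : Var
  /-- the number of letters produced so far, if they are counted -/
  | cnt : Var
  /-- the number given by the digits read so far -/
  | val : Var
  /-- the costs of the states in the last layer -/
  | old (q : Fin 15) : Var
  /-- the costs of the states in the next layer -/
  | new (q : Fin 15) : Var
  deriving DecidableEq, Fintype

/-- The arrays of the program; all of them are indexed by heights. -/
inductive Arr : Type
  /-- the exponent sums of `a`, then the digits -/
  | dig : Arr
  /-- the exponents of `a` in the output -/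
  | out : Arr
  /-- the table of predecessors -/
  | back (q : Fin 15) : Arr
  /-- the table of labels -/
  | label (q : Fin 15) : Arr
  deriving DecidableEq, Fintype

/-- The programs considered. -/
abbrev Cmd : Type := Prog Var Arr

/-- Adds `c` to an array element. -/
def addTo (a : Arr) (y : Var) (c : ℤ) : Cmd :=
  .block [.get .tmp a y, .inc .tmp c, .put a y .tmp]

/-- Determines whether the last symbol read is a letter. -/
def testLetter : Cmd :=
  .block [.set .go (.lit 1), .ite (.lit 2) (.var .sym) (.set .go (.lit 0)) .skip,
    .ite (.var .sym) (.lit (-2)) (.set .go (.lit 0)) .skip,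
    .ite (.lit 0) (.var .sym) .skip (.ite (.var .sym) (.lit 0) .skip (.set .go (.lit 0)))]

/-- Processes a letter and reads the next symbol. After a word of length `n`, the window consists of
the heights from `-n` up to, but not including, `2 n + 2`, and `inf` is `2 n + 3`, which exceeds
`|w| + |m| + 2` for all words `w` of interest. -/
def readLetter : Cmd :=
  .block [.ite (.lit 0) (.var .sym)
      (.ite (.lit 1) (.var .sym) (.inc .m 1) (addTo .dig .m 1))
      (.ite (.var .sym) (.lit (-1)) (.inc .m (-1)) (addTo .dig .m (-1))),
    .inc .bot (-1), .inc .top 2, .inc .inf 2, .read .sym, testLetter]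

/-- Sets up the bounds that `readLetter` maintains, for the empty word, and reads the first symbol. -/
def readInit : Cmd :=
  .block [.set .top (.lit 2), .set .inf (.lit 3), .read .sym, testLetter]

/-- Reads the word. -/
def readWord : Cmd :=
  .seq readInit (.while (.lit 0) (.var .go) readLetter)

/-- The state after reading the word `u`, when the rest of the input is `r`. -/
structure ReadState (u : Word) (r : List ℤ) (s : St Var Arr) : Prop where
  m : s.v .m = height u
  dig : s.a .dig = coef u
  bot : s.v .bot = -(u.length : ℤ)
  top : s.v .top = 2 * u.length + 2
  inf : s.v .inf = 2 * u.length + 3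
  sym : s.v .sym = r.headD 0
  inp : s.inp = r.tail
  out : s.out = []
  cnt : s.v .cnt = 0
  go : s.v .go = if r.headD 0 ∈ [1, -1, 2, -2] then 1 else 0

theorem testLetter_eval {s : St Var Arr} {z : ℤ} (hz : s.v .sym = z)
    (h : z ∈ ([1, -1, 2, -2, 0, 3, -3] : List ℤ)) :
    testLetter.eval s = s.setv .go (if z ∈ ([1, -1, 2, -2] : List ℤ) then 1 else 0) := by
  fin_cases h <;>
    simp [testLetter, Prog.block, Prog.eval, Atom.val, St.setv, hz]

theorem headD_mem {v : Word} {rest : List ℤ} (h : rest.headD 0 ∈ ([0, 3, -3] : List ℤ)) :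
    (encodeWord v ++ rest).headD 0 ∈ ([1, -1, 2, -2, 0, 3, -3] : List ℤ) := by
  cases v with
  | nil =>
    have h' : (encodeWord [] ++ rest).headD 0 = rest.headD 0 := rfl
    rw [h']
    simp only [List.mem_cons, List.not_mem_nil, or_false] at h ⊢
    omega
  | cons l v =>
    obtain ⟨g, b⟩ := l
    cases g <;> cases b <;> simp [encodeWord, letterCode]

theorem loopFree_testLetter : testLetter.LoopFree := by
  simp [testLetter, Prog.block, Prog.LoopFree]

theorem loopFree_readInit : readInit.LoopFree := by
  simp [readInit, Prog.block, Prog.LoopFree, loopFree_testLetter]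

theorem loopFree_readLetter : readLetter.LoopFree := by
  simp [readLetter, addTo, Prog.block, Prog.LoopFree, loopFree_testLetter]

theorem readInit_eval {r : List ℤ} (hr : r.headD 0 ∈ ([1, -1, 2, -2, 0, 3, -3] : List ℤ)) :
    ReadState [] r (readInit.eval (St.init Var Arr r)) := by
  have h1 : readInit.eval (St.init Var Arr r) =
      testLetter.eval { (((St.init Var Arr r).setv .top 2).setv .inf 3).setv .sym (r.headD 0) with
        inp := r.tail } := rfl
  rw [h1, testLetter_eval (z := r.headD 0) rfl hr]
  constructor <;> simp [St.setv, RAM.St.init, height, coef]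
  rfl

theorem ReadState.step {u : Word} {l : Letter} {r : List ℤ} {s : St Var Arr}
    (h : ReadState u (letterCode l :: r) s)
    (hr : r.headD 0 ∈ ([1, -1, 2, -2, 0, 3, -3] : List ℤ)) :
    ReadState (u ++ [l]) r (readLetter.eval s) := by
  obtain ⟨h1, h2, h3, h4, h5, h6, h7, h8, h9, h10⟩ := h
  simp only [List.headD_cons, List.tail_cons] at h6 h7
  have hmid : ∃ s1, readLetter.eval s = testLetter.eval s1 ∧ s1.v .m = height (u ++ [l]) ∧
      s1.a .dig = coef (u ++ [l]) ∧ s1.v .bot = s.v .bot - 1 ∧ s1.v .top = s.v .top + 2 ∧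
      s1.v .inf = s.v .inf + 2 ∧ s1.v .sym = r.headD 0 ∧ s1.inp = r.tail ∧ s1.out = s.out ∧
      s1.v .cnt = s.v .cnt := by
    refine ⟨_, rfl, ?_⟩
    obtain ⟨g, b⟩ := l
    cases g <;> cases b <;> simp only [letterCode] at h6 <;>
      simp [Prog.eval, Prog.block, Atom.val, addTo, St.setv, St.seta, h1, h2, h6, h7,
        height_append_a, height_append_t, coef_append_a, coef_append_t] <;> ring
  obtain ⟨s1, e0, e1, e2, e3, e4, e5, e6, e7, e8, e9⟩ := hmid
  rw [e0, testLetter_eval e6 hr]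
  constructor <;> simp [St.setv, *] <;> ring

theorem readWord_ends (w : Word) {rest : List ℤ} (h : rest.headD 0 ∈ ([0, 3, -3] : List ℤ)) :
    readWord.Ends (St.init Var Arr (encodeWord w ++ rest))
      (readInit.cost + ((readLetter.cost + 1) * w.length + 1)) (ReadState w rest) := by
  refine (loopFree_readInit.ends (readInit_eval (headD_mem h))).seq fun s hs => ?_
  refine (Prog.Ends.while w.length (fun _ => readLetter.cost)
    (fun i => ReadState (w.take i) (encodeWord (w.drop i) ++ rest)) (by simpa using hs)
    ?_ ?_).mono ?_ ?_
  · intro i hi s hs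
    rw [List.drop_eq_getElem_cons hi] at hs
    refine ⟨?_, loopFree_readLetter.ends ?_⟩
    · simp only [Atom.val, hs.go]
      obtain ⟨⟨g, b⟩, hl⟩ : ∃ l, w[i] = l := ⟨_, rfl⟩
      rw [hl]
      cases g <;> cases b <;> simp [encodeWord, letterCode]
    · rw [List.take_succ_eq_append_getElem hi]
      exact hs.step (headD_mem h)
  · intro s hs
    simp only [Atom.val, hs.go]
    rw [List.drop_length]
    have h' : (encodeWord [] ++ rest).headD 0 = rest.headD 0 := rfl
    rw [h', if_neg]
    · simp
    · simp only [List.mem_cons, List.not_mem_nil, or_false] at h ⊢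
      omega
  · simp [mul_comm]
  · intro s hs
    simpa [encodeWord] using hs

/-! ### The dynamic program -/

/-- Makes the digit at height `h` smaller than `p` by carrying units to the height above; the digit
is put into a variable. -/
def normalise (p : ℕ) : Cmd :=
  .seq (.block [.get .e .dig .h, .set .nxt (.var .h), .inc .nxt 1])
    (.seq (.while (.lit (p - 1)) (.var .e) (.block [.inc .e (-p), addTo .dig .nxt 1]))
      (.while (.var .e) (.lit (1 - p)) (.block [.inc .e p, addTo .dig .nxt (-1)])))

/-- Determines whether the height `h` has to be visited. -/
def setForced : Cmd :=
  .block [.set .frc (.lit 1),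
    .ite (.var .h) (.lit 0) (.ite (.var .h) (.var .m) (.set .frc (.lit 0)) .skip) .skip,
    .ite (.lit 0) (.var .h) (.ite (.var .m) (.var .h) (.set .frc (.lit 0)) .skip) .skip]

/-- Takes the edge from `q` to `q'` into account. -/
def relax (p : ℕ) (f : Bool) (e : ℤ) (q' q : Fin 15) : Cmd :=
  if Allowed p f e q q' then
    .block [.set .tmp (.var (.old q)), .inc .tmp (weight p e q q'),
      .ite (.var .tmp) (.var (.new q')) (.block [.set (.new q') (.var .tmp),
        .set .best (.lit (q.val : ℤ)), .set .lab (.lit (label p e q q'))]) .skip]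
  else .skip

/-- Computes the cost of the state `q'` in the next layer. -/
def column (p : ℕ) (f : Bool) (e : ℤ) (q' : Fin 15) : Cmd :=
  .block (.set (.new q') (.var .inf) :: ((List.finRange 15).map (relax p f e q') ++
    [.put (.back q') .h .best, .put (.label q') .h .lab]))

/-- Computes the costs of the next layer, for a digit `e`. The digit is a constant of the program, and
so are the weights and labels of the edges: no multiplication is needed. -/
def layer (p : ℕ) (f : Bool) (e : ℤ) : Cmd :=
  .block ((List.finRange 15).map (column p f e) ++
    (List.finRange 15).map fun q => .set (.old q) (.var (.new q)))

/-- Computes the costs of the next layer, the digit being a variable. -/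
def dispatch (p : ℕ) (f : Bool) : Cmd :=
  .cases .e (1 - p) ((List.range (2 * p)).map fun i : ℕ => layer p f (1 - p + i))

/-- Processes one layer. -/
def dpStep (p : ℕ) : Cmd :=
  .block [setForced, .cases .frc 0 [dispatch p false, dispatch p true], .inc .h 1]

/-- The costs in the first layer. -/
def dpInit : Cmd :=
  .block (.set .h (.var .bot) :: (List.finRange 15).map fun q =>
    .set (.old q) (if q = startState then .lit 0 else .var .inf))

/-- Dynamic programming. -/
def dp (p : ℕ) : Cmd :=
  .seq dpInit (.while (.var .h) (.var .top) (.seq (normalise p) (dpStep p)))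

/-- What the computation of a new layer leaves unchanged. -/
structure LayerFrame (s s' : St Var Arr) : Prop where
  v : ∀ y, y ≠ .tmp → y ≠ .best → y ≠ .lab → (∀ q, y ≠ .new q) → s'.v y = s.v y
  dig : s'.a .dig = s.a .dig
  out : s'.a .out = s.a .out
  back : ∀ q i, i ≠ s.v .h → s'.a (.back q) i = s.a (.back q) i
  label : ∀ q i, i ≠ s.v .h → s'.a (.label q) i = s.a (.label q) i
  inp : s'.inp = s.inp
  output : s'.out = s.out

/-- The state `q'` has its cost in the next layer, and its entries in the tables. -/
structure ColumnDone (p : ℕ) (f : Bool) (e : ℤ) (s : St Var Arr) (q' : Fin 15)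
    (s' : St Var Arr) : Prop where
  le : ∀ q, Allowed p f e q q' → s'.v (.new q') ≤ s.v (.old q) + weight p e q q'
  eq : s'.v (.new q') < s.v .inf → ∃ q, Allowed p f e q q' ∧
    s'.a (.back q') (s.v .h) = q.val ∧ s'.a (.label q') (s.v .h) = BaumslagSolitar.label p e q q' ∧
    s'.v (.new q') = s.v (.old q) + weight p e q q'

/-- The invariant for the computation of the cost of a state: the states in `l` have been taken into
account. -/
structure ColumnInv (p : ℕ) (f : Bool) (e : ℤ) (s : St Var Arr) (q' : Fin 15)
    (l : List (Fin 15)) (s' : St Var Arr) : Prop where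
  v : ∀ y, y ≠ .tmp → y ≠ .best → y ≠ .lab → y ≠ .new q' → s'.v y = s.v y
  a : s'.a = s.a
  inp : s'.inp = s.inp
  output : s'.out = s.out
  le : ∀ q ∈ l, Allowed p f e q q' → s'.v (.new q') ≤ s.v (.old q) + weight p e q q'
  eq : s'.v (.new q') < s.v .inf → ∃ q, Allowed p f e q q' ∧
    s'.v .best = q.val ∧ s'.v .lab = BaumslagSolitar.label p e q q' ∧
    s'.v (.new q') = s.v (.old q) + weight p e q q'

theorem ColumnInv.relax {p : ℕ} {f : Bool} {e : ℤ} {s s' : St Var Arr} {q' : Fin 15}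
    {l : List (Fin 15)} (h : ColumnInv p f e s q' l s') (q : Fin 15) :
    ColumnInv p f e s q' (l ++ [q]) ((relax p f e q' q).eval s') := by
  unfold BaumslagSolitar.relax
  have hold : s'.v (.old q) = s.v (.old q) :=
    h.v _ (by simp) (by simp) (by simp) (by simp)
  split_ifs with ha
  · by_cases hlt : s.v (.old q) + weight p e q q' < s'.v (.new q')
    · have he : ((Prog.block [.set .tmp (.var (.old q)), .inc .tmp (weight p e q q'),
          .ite (.var .tmp) (.var (.new q')) (.block [.set (.new q') (.var .tmp),
          .set .best (.lit (q.val : ℤ)), .set .lab (.lit (label p e q q'))]) .skip]).eval s' :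
          St Var Arr) = ((((s'.setv .tmp (s.v (.old q) + weight p e q q')).setv (.new q')
          (s.v (.old q) + weight p e q q')).setv .best (q.val : ℤ)).setv .lab
          (label p e q q')) := by
        simp [Prog.block, Prog.eval, Atom.val, St.setv, hold, hlt]
      rw [he]
      refine ⟨fun y h1 h2 h3 h4 => ?_, h.a, h.inp, h.output, ?_, fun _ => ⟨q, ha, ?_, ?_, ?_⟩⟩
      · simpa [St.setv, h1, h2, h3, h4] using h.v y h1 h2 h3 h4
      · intro q1 hq1 ha1
        simp only [St.setv, Function.update_self, ne_eq, reduceCtorEq, not_false_eq_true,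
          Function.update_of_ne]
        rcases List.mem_append.1 hq1 with hq1 | hq1
        · exact hlt.le.trans (h.le q1 hq1 ha1)
        · rw [List.mem_singleton.1 hq1]
      all_goals simp [St.setv]
    · have he : ((Prog.block [.set .tmp (.var (.old q)), .inc .tmp (weight p e q q'),
          .ite (.var .tmp) (.var (.new q')) (.block [.set (.new q') (.var .tmp),
          .set .best (.lit (q.val : ℤ)), .set .lab (.lit (label p e q q'))]) .skip]).eval s' :
          St Var Arr) = s'.setv .tmp (s.v (.old q) + weight p e q q') := by
        simp [Prog.block, Prog.eval, Atom.val, St.setv, hold, hlt]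
      rw [he]
      refine ⟨fun y h1 h2 h3 h4 => ?_, h.a, h.inp, h.output, ?_, ?_⟩
      · simpa [St.setv, h1] using h.v y h1 h2 h3 h4
      · intro q1 hq1 ha1
        simp only [St.setv, ne_eq, reduceCtorEq, not_false_eq_true, Function.update_of_ne]
        rcases List.mem_append.1 hq1 with hq1 | hq1
        · exact h.le q1 hq1 ha1
        · rw [List.mem_singleton.1 hq1]; exact not_lt.1 hlt
      · simpa [St.setv] using h.eq
  · refine ⟨h.v, h.a, h.inp, h.output, fun q1 hq1 ha1 => ?_, h.eq⟩
    rcases List.mem_append.1 hq1 with hq1 | hq1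
    · exact h.le q1 hq1 ha1
    · rw [List.mem_singleton.1 hq1] at ha1; exact absurd ha1 ha

theorem ColumnInv.relax_list {p : ℕ} {f : Bool} {e : ℤ} {s s' : St Var Arr} {q' : Fin 15}
    {l : List (Fin 15)} (h : ColumnInv p f e s q' l s') (l' : List (Fin 15)) :
    ColumnInv p f e s q' (l ++ l')
      ((Prog.block (l'.map (BaumslagSolitar.relax p f e q'))).eval s') := by
  induction l' generalizing l s' with
  | nil => simpa [Prog.block, Prog.eval] using h
  | cons q l' ih =>
    have := ih (h.relax q)
    simpa [Prog.block, Prog.eval] using this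

theorem column_eval (p : ℕ) (f : Bool) (e : ℤ) (q' : Fin 15) (s : St Var Arr) :
    LayerFrame s ((column p f e q').eval s) ∧
      ColumnDone p f e s q' ((column p f e q').eval s) ∧
      (∀ q, q ≠ q' → ((column p f e q').eval s).v (.new q) = s.v (.new q) ∧
        ((column p f e q').eval s).a (.back q) = s.a (.back q) ∧
        ((column p f e q').eval s).a (.label q) = s.a (.label q)) := by
  have h0 : ColumnInv p f e s q' [] (s.setv (.new q') (s.v .inf)) := by
    refine ⟨fun y _ _ _ h4 => by simp [St.setv, h4], rfl, rfl, rfl, by simp, ?_⟩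
    intro h
    simp [St.setv] at h
  have h1 := h0.relax_list (List.finRange 15)
  obtain ⟨s1, hs1⟩ : ∃ s1, (Prog.block ((List.finRange 15).map (relax p f e q'))).eval
      (s.setv (.new q') (s.v .inf)) = s1 := ⟨_, rfl⟩
  rw [hs1, List.nil_append] at h1
  have he : (column p f e q').eval s =
      (s1.seta (.back q') (s.v .h) (s1.v .best)).seta (.label q') (s.v .h) (s1.v .lab) := by
    have hh : s1.v .h = s.v .h := h1.v _ (by simp) (by simp) (by simp) (by simp)
    unfold column
    simp only [Prog.block, Prog.eval, Prog.eval_block_append, Atom.val, hs1, St.seta, hh]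
  rw [he]
  have ha := h1.a
  refine ⟨⟨fun y h2 h3 h4 h5 => h1.v y h2 h3 h4 (h5 q'), ?_, ?_, ?_, ?_, h1.inp, h1.output⟩,
    ⟨fun q hq => h1.le q (List.mem_finRange q) hq, fun hlt => ?_⟩, fun q hq => ⟨?_, ?_, ?_⟩⟩
  · simp [St.seta, ha]
  · simp [St.seta, ha]
  · intro q i hi
    by_cases hq : q = q'
    · subst hq; simp [St.seta, ha, hi]
    · simp [St.seta, ha, hq]
  · intro q i hi
    by_cases hq : q = q'
    · subst hq; simp [St.seta, ha, hi]
    · simp [St.seta, ha, hq]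
  · obtain ⟨q, hq1, hq2, hq3, hq4⟩ := h1.eq hlt
    exact ⟨q, hq1, by simpa [St.seta] using hq2, by simpa [St.seta] using hq3, hq4⟩
  · exact h1.v _ (by simp) (by simp) (by simp) (by simpa using hq)
  · simp [St.seta, ha, hq]
  · simp [St.seta, ha, hq]

theorem LayerFrame.trans {s s' s'' : St Var Arr} (h : LayerFrame s s') (h' : LayerFrame s' s'') :
    LayerFrame s s'' := by
  have hh : s'.v .h = s.v .h := h.v _ (by simp) (by simp) (by simp) (by simp)
  refine ⟨fun y h1 h2 h3 h4 => (h'.v y h1 h2 h3 h4).trans (h.v y h1 h2 h3 h4),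
    h'.dig.trans h.dig, h'.out.trans h.out, fun q i hi => ?_, fun q i hi => ?_,
    h'.inp.trans h.inp, h'.output.trans h.output⟩
  · exact (h'.back q i (by rwa [hh])).trans (h.back q i hi)
  · exact (h'.label q i (by rwa [hh])).trans (h.label q i hi)

theorem columns_eval (p : ℕ) (f : Bool) (e : ℤ) (s : St Var Arr) (l : List (Fin 15)) :
    LayerFrame s ((Prog.block (l.map (column p f e))).eval s) ∧
      ∀ q' ∈ l, ColumnDone p f e s q' ((Prog.block (l.map (column p f e))).eval s) := by
  induction l using List.reverseRecOn with
  | nil => exact ⟨⟨fun _ _ _ _ _ => rfl, rfl, rfl, fun _ _ _ => rfl, fun _ _ _ => rfl, rfl, rfl⟩,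
      by simp⟩
  | append_singleton l q0 ih =>
    obtain ⟨hf, hd⟩ := ih
    rw [List.map_append, Prog.eval_block_append]
    set s1 := (Prog.block (l.map (column p f e))).eval s
    have he : (Prog.block ([q0].map (column p f e))).eval s1 = (column p f e q0).eval s1 := rfl
    rw [he]
    obtain ⟨c1, c2, c3⟩ := column_eval p f e q0 s1
    have hold : ∀ q, s1.v (.old q) = s.v (.old q) := fun q =>
      hf.v _ (by simp) (by simp) (by simp) (by simp)
    have hinf : s1.v .inf = s.v .inf := hf.v _ (by simp) (by simp) (by simp) (by simp)
    have hh : s1.v .h = s.v .h := hf.v _ (by simp) (by simp) (by simp) (by simp)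
    refine ⟨hf.trans c1, fun q' hq' => ?_⟩
    by_cases hq : q' = q0
    · subst hq
      obtain ⟨d1, d2⟩ := c2
      simp only [hold, hinf, hh] at d1 d2
      exact ⟨d1, d2⟩
    · obtain ⟨d1, d2, d3⟩ := c3 q' hq
      have hmem : q' ∈ l := by simpa [hq] using hq'
      obtain ⟨e1, e2⟩ := hd q' hmem
      refine ⟨fun q hq => by rw [d1]; exact e1 q hq, ?_⟩
      rw [d1, d2, d3]
      exact e2

theorem copies_eval (s : St Var Arr) (l : List (Fin 15)) :
    let s' := (Prog.block (l.map fun q => (.set (.old q) (.var (.new q)) : Cmd))).eval s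
    s'.a = s.a ∧ s'.inp = s.inp ∧ s'.out = s.out ∧ (∀ y, (∀ q, y ≠ .old q) → s'.v y = s.v y) ∧
      ∀ q ∈ l, s'.v (.old q) = s.v (.new q) := by
  induction l using List.reverseRecOn with
  | nil => simp [Prog.block, Prog.eval]
  | append_singleton l q0 ih =>
    simp only [List.map_append, Prog.eval_block_append]
    set s1 := (Prog.block (l.map fun q => (.set (.old q) (.var (.new q)) : Cmd))).eval s
    obtain ⟨h1, h2, h3, h4, h5⟩ := ih
    refine ⟨h1, h2, h3, fun y hy => ?_, fun q hq => ?_⟩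
    · rw [← h4 y hy]
      simp [Prog.block, Prog.eval, Atom.val, St.setv, hy q0]
    · have h6 : s1.v (.new q0) = s.v (.new q0) := h4 _ (by simp)
      by_cases hq0 : q = q0
      · subst hq0
        simp [Prog.block, Prog.eval, Atom.val, St.setv, h6]
      · have hmem : q ∈ l := by simpa [hq0] using hq
        simp [Prog.block, Prog.eval, Atom.val, St.setv, hq0, h5 q hmem]

/-- What the computation of a layer achieves. -/
structure LayerDone (p : ℕ) (f : Bool) (e : ℤ) (s s' : St Var Arr) : Prop where
  v : ∀ y, y ≠ .tmp → y ≠ .best → y ≠ .lab → y ≠ .frc → (∀ q, y ≠ .new q) → (∀ q, y ≠ .old q) →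
    s'.v y = s.v y
  dig : s'.a .dig = s.a .dig
  back : ∀ q i, i ≠ s.v .h → s'.a (.back q) i = s.a (.back q) i
  label : ∀ q i, i ≠ s.v .h → s'.a (.label q) i = s.a (.label q) i
  inp : s'.inp = s.inp
  output : s'.out = s.out
  le : ∀ q q', Allowed p f e q q' → s'.v (.old q') ≤ s.v (.old q) + weight p e q q'
  eq : ∀ q', s'.v (.old q') < s.v .inf → ∃ q, Allowed p f e q q' ∧
    s'.a (.back q') (s.v .h) = q.val ∧ s'.a (.label q') (s.v .h) = BaumslagSolitar.label p e q q' ∧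
    s'.v (.old q') = s.v (.old q) + weight p e q q'

theorem layer_eval (p : ℕ) (f : Bool) (e : ℤ) (s : St Var Arr) :
    LayerDone p f e s ((layer p f e).eval s) := by
  unfold layer
  rw [Prog.eval_block_append]
  obtain ⟨hf, hd⟩ := columns_eval p f e s (List.finRange 15)
  set s1 := (Prog.block ((List.finRange 15).map (column p f e))).eval s
  obtain ⟨h1, h2, h3, h4, h5⟩ := copies_eval s1 (List.finRange 15)
  set s2 := (Prog.block ((List.finRange 15).map
    fun q => (.set (.old q) (.var (.new q)) : Cmd))).eval s1
  replace h5 := fun q => h5 q (List.mem_finRange q)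
  replace hd := fun q => hd q (List.mem_finRange q)
  refine ⟨fun y e1 e2 e3 _ e4 e5 => (h4 y e5).trans (hf.v y e1 e2 e3 e4), by rw [h1, hf.dig],
    fun q i hi => by rw [h1, hf.back q i hi], fun q i hi => by rw [h1, hf.label q i hi],
    h2.trans hf.inp, h3.trans hf.output,
    fun q q' ha => by rw [h5]; exact (hd q').le q ha, fun q' => ?_⟩
  rw [h5, h1]
  exact (hd q').eq

theorem dispatch_eval {p : ℕ} (f : Bool) {s : St Var Arr} (he : |s.v .e| ≤ p - 1) :
    (dispatch p f).eval s = (layer p f (s.v .e)).eval s := by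
  rw [abs_le] at he
  have h1 : s.v .e = 1 - p + ((s.v .e + p - 1).toNat : ℕ) := by omega
  unfold dispatch
  rw [Prog.eval_cases (i := (s.v .e + p - 1).toNat) (by simp; omega) h1]
  simp only [List.getElem_map, List.getElem_range]
  rw [← h1]

theorem setForced_eval (s : St Var Arr) : setForced.eval s =
    s.setv .frc (if min 0 (s.v .m) ≤ s.v .h ∧ s.v .h ≤ max 0 (s.v .m) then 1 else 0) := by
  have hiff : (min 0 (s.v .m) ≤ s.v .h ∧ s.v .h ≤ max 0 (s.v .m)) ↔
      ¬ (s.v .h < 0 ∧ s.v .h < s.v .m) ∧ ¬ (0 < s.v .h ∧ s.v .m < s.v .h) := by omega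
  simp only [hiff]
  by_cases h1 : s.v .h < 0 <;> by_cases h2 : s.v .h < s.v .m <;> by_cases h3 : 0 < s.v .h <;>
    by_cases h4 : s.v .m < s.v .h <;>
    simp [setForced, Prog.block, Prog.eval, Atom.val, St.setv, h1, h2, h3, h4]

theorem dpStep_eval {p : ℕ} {s : St Var Arr} (he : |s.v .e| ≤ p - 1) {N : ℕ} {j : ℕ}
    (hh : s.v .h = j - N) :
    ∃ s', LayerDone p (forced N (s.v .m) j) (s.v .e) s s' ∧
      (dpStep p).eval s = s'.setv .h (s.v .h + 1) := by
  set s1 := s.setv .frc (if forced N (s.v .m) j then 1 else 0) with hs1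
  have h1 : setForced.eval s = s1 := by
    rw [setForced_eval, hs1]
    simp only [forced, decide_eq_true_eq, hh]
  have he1 : |s1.v .e| ≤ p - 1 := by simpa [hs1, St.setv] using he
  have h2 : (Prog.cases .frc 0 [dispatch p false, dispatch p true]).eval s1 =
      (layer p (forced N (s.v .m) j) (s1.v .e)).eval s1 := by
    rw [← dispatch_eval _ he1]
    cases hfr : forced N (s.v .m) j
    · exact Prog.eval_cases (i := 0) (by simp) (by simp [hs1, hfr, St.setv])
    · exact Prog.eval_cases (i := 1) (by simp) (by simp [hs1, hfr, St.setv])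
  have h3 := layer_eval p (forced N (s.v .m) j) (s1.v .e) s1
  have hv : ∀ y, y ≠ .frc → s1.v y = s.v y := fun y hy => by simp [hs1, St.setv, hy]
  refine ⟨(layer p (forced N (s.v .m) j) (s1.v .e)).eval s1, ?_, ?_⟩
  · obtain ⟨e1, e2, e3, e4, e5, e6, e7, e8⟩ := h3
    simp only [hs1] at e1 e2 e3 e4 e5 e6 e7 e8 ⊢
    refine ⟨fun y f1 f2 f3 f4 f5 f6 => (e1 y f1 f2 f3 f4 f5 f6).trans ?_, e2, e3, e4, e5, e6, e7,
      e8⟩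
    simp [St.setv, f4]
  · have h4 : ((layer p (forced N (s.v .m) j) (s1.v .e)).eval s1).v .h = s.v .h :=
      (h3.v _ (by simp) (by simp) (by simp) (by simp) (by simp) (by simp)).trans (hv _ (by simp))
    simp only [dpStep, Prog.block, Prog.eval, h1, h2, h4]

theorem loopFree_relax (p : ℕ) (f : Bool) (e : ℤ) (q' q : Fin 15) :
    (relax p f e q' q).LoopFree := by
  unfold relax
  split_ifs <;> simp [Prog.block, Prog.LoopFree]

theorem loopFree_layer (p : ℕ) (f : Bool) (e : ℤ) : (layer p f e).LoopFree := by
  refine Prog.loopFree_block fun P hP => ?_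
  rcases List.mem_append.1 hP with hP | hP
  · obtain ⟨q', -, rfl⟩ := List.mem_map.1 hP
    refine Prog.loopFree_block fun P hP => ?_
    rcases List.mem_cons.1 hP with rfl | hP
    · trivial
    rcases List.mem_append.1 hP with hP | hP
    · obtain ⟨q, -, rfl⟩ := List.mem_map.1 hP
      exact loopFree_relax p f e q' q
    · simp only [List.mem_cons, List.not_mem_nil, or_false] at hP
      rcases hP with rfl | rfl <;> trivial
  · obtain ⟨q', -, rfl⟩ := List.mem_map.1 hP
    trivial

theorem loopFree_dpStep (p : ℕ) : (dpStep p).LoopFree := by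
  have h : ∀ f, (dispatch p f).LoopFree := fun f => Prog.loopFree_cases _ _ fun P hP => by
    obtain ⟨i, -, rfl⟩ := List.mem_map.1 hP
    exact loopFree_layer _ _ _
  simp [dpStep, setForced, Prog.block, Prog.LoopFree, Prog.cases, h]

theorem loopFree_dpInit : dpInit.LoopFree := by
  refine Prog.loopFree_block fun P hP => ?_
  rcases List.mem_cons.1 hP with rfl | hP
  · trivial
  · obtain ⟨q, -, rfl⟩ := List.mem_map.1 hP
    trivial

/-- An intermediate state while the digit at height `h` is made small: `x` is the current digit and
`d` the array element above it. -/
structure Carried (s : St Var Arr) (x d : ℤ) (s' : St Var Arr) : Prop where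
  e : s'.v .e = x
  nxt : s'.v .nxt = s.v .h + 1
  v : ∀ y, y ≠ .e → y ≠ .nxt → y ≠ .tmp → s'.v y = s.v y
  dig : s'.a .dig = Function.update (s.a .dig) (s.v .h + 1) d
  a : ∀ b, b ≠ .dig → s'.a b = s.a b
  inp : s'.inp = s.inp
  out : s'.out = s.out

theorem Carried.step {s s' : St Var Arr} {x d : ℤ} (h : Carried s x d s') (k c : ℤ) :
    Carried s (x + k) (d + c)
      ((.block [.inc .e k, addTo .dig .nxt c] : Cmd).eval s') := by
  obtain ⟨h1, h2, h3, h4, h5, h6, h7⟩ := h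
  constructor
  · simp [Prog.block, Prog.eval, addTo, St.setv, St.seta, h1]
  · simp [Prog.block, Prog.eval, addTo, St.setv, St.seta, h2]
  · intro y e1 e2 e3
    simp [Prog.block, Prog.eval, addTo, St.setv, St.seta, e1, e3, h3 y e1 e2 e3]
  · simp [Prog.block, Prog.eval, addTo, St.setv, St.seta, h2, h4]
  · intro b hb
    simp [Prog.block, Prog.eval, addTo, St.setv, St.seta, hb, h5 b hb]
  · simpa [Prog.block, Prog.eval, addTo, St.setv, St.seta] using h6
  · simpa [Prog.block, Prog.eval, addTo, St.setv, St.seta] using h7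

/-- The division by `p` is carried out by repeated subtraction; so its time is that of the carry. -/
theorem normalise_ends {p : ℕ} (hp : 0 < p) (s : St Var Arr) :
    (normalise p).Ends s (7 * ((s.a .dig (s.v .h)).tdiv p).natAbs + 6)
      (Carried s ((s.a .dig (s.v .h)).tmod p)
        (s.a .dig (s.v .h + 1) + (s.a .dig (s.v .h)).tdiv p)) := by
  have hp' : (0 : ℤ) < p := by exact_mod_cast hp
  set x := s.a .dig (s.v .h) with hx
  set d := s.a .dig (s.v .h + 1) with hd
  have hlf : ∀ k c : ℤ, (.block [.inc .e k, addTo .dig .nxt c] : Cmd).LoopFree := by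
    simp [Prog.block, addTo, Prog.LoopFree]
  have hcost : ∀ k c : ℤ, (.block [.inc .e k, addTo .dig .nxt c] : Cmd).cost = 6 := by
    simp [Prog.block, addTo, Prog.cost]
  have hinit : Carried s x d
      ((.block [.get .e .dig .h, .set .nxt (.var .h), .inc .nxt 1] : Cmd).eval s) := by
    constructor
    · simp [Prog.block, Prog.eval, St.setv, hx]
    · simp [Prog.block, Prog.eval, St.setv, Atom.val]
    · intro y e1 e2 e3
      simp [Prog.block, Prog.eval, St.setv, Atom.val, e1, e2]
    · simp [Prog.block, Prog.eval, St.setv, hd]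
    · intro b _
      simp [Prog.block, Prog.eval, St.setv]
    · simp [Prog.block, Prog.eval, St.setv]
    · simp [Prog.block, Prog.eval, St.setv]
  -- The first loop does something if the digit is positive, the second one if it is negative.
  have hloop1 : ∀ k : ℕ, (∀ i : ℕ, i < k ↔ (p : ℤ) - 1 < x - p * i) → ∀ s1, Carried s x d s1 →
      (Prog.while (.lit (p - 1)) (.var .e)
        (.block [.inc .e (-p), addTo .dig .nxt 1]) : Cmd).Ends s1 (7 * k + 1)
        (Carried s (x - p * k) (d + k)) := by
    intro k hk s1 h1
    refine (Prog.Ends.while k (fun _ => 6) (fun i => Carried s (x - p * i) (d + i))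
      (by simpa using h1) ?_ ?_).mono (by simp; omega) (fun _ h => h)
    · intro i hi s2 h2
      refine ⟨?_, ?_⟩
      · simp only [Atom.val, h2.e]; exact (hk i).1 hi
      · rw [← hcost (-p) 1]
        refine (hlf _ _).ends ?_
        have := h2.step (-p) 1
        convert this using 1 <;> push_cast <;> ring
    · intro s2 h2
      simp only [Atom.val, h2.e]
      exact fun h => lt_irrefl k ((hk k).2 h)
  have hloop2 : ∀ k : ℕ, ∀ x d : ℤ, (∀ i : ℕ, i < k ↔ x + p * i < 1 - (p : ℤ)) →
      ∀ s1, Carried s x d s1 →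
      (Prog.while (.var .e) (.lit (1 - p))
        (.block [.inc .e p, addTo .dig .nxt (-1)]) : Cmd).Ends s1 (7 * k + 1)
        (Carried s (x + p * k) (d - k)) := by
    intro k x d hk s1 h1
    refine (Prog.Ends.while k (fun _ => 6) (fun i => Carried s (x + p * i) (d - i))
      (by simpa using h1) ?_ ?_).mono (by simp; omega) (fun _ h => h)
    · intro i hi s2 h2
      refine ⟨?_, ?_⟩
      · simp only [Atom.val, h2.e]; exact (hk i).1 hi
      · rw [← hcost p (-1)]
        refine (hlf _ _).ends ?_
        have := h2.step p (-1)
        convert this using 1 <;> push_cast <;> ring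
    · intro s2 h2
      simp only [Atom.val, h2.e]
      exact fun h => lt_irrefl k ((hk k).2 h)
  have hfirst : (.block [.get .e .dig .h, .set .nxt (.var .h), .inc .nxt 1] : Cmd).Ends s 4
      (Carried s x d) :=
    Prog.LoopFree.ends (by simp [Prog.block, Prog.LoopFree]) hinit
  have hmul : ∀ y : ℤ, ∀ i : ℕ, 0 ≤ y → (i < (y / p).toNat ↔ (p : ℤ) - 1 < y - p * i) := by
    intro y i hy
    rw [Int.lt_toNat, ← Int.add_one_le_iff, Int.le_ediv_iff_mul_le hp']
    constructor <;> intro h <;> nlinarith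
  rcases le_total 0 x with hx0 | hx0
  · have hdiv : x.tdiv p = x / p := Int.tdiv_eq_ediv_of_nonneg hx0
    have hmod : x.tmod p = x % p := Int.tmod_eq_emod_of_nonneg hx0
    have hk : (((x / p).toNat : ℕ) : ℤ) = x / p := Int.toNat_of_nonneg (Int.ediv_nonneg hx0 hp'.le)
    have hx1 : x - p * (x / p) = x % p := by rw [Int.emod_def]
    have hx2 := Int.emod_nonneg x hp'.ne'
    refine (hfirst.seq fun s1 h1 => (hloop1 (x / p).toNat (fun i => hmul x i hx0) s1 h1).seq
      fun s2 h2 => hloop2 0 _ _ (fun i => ?_) s2 h2).mono ?_ ?_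
    · rw [hk, hx1]
      refine iff_of_false (by omega) ?_
      have : (0 : ℤ) ≤ p * i := by positivity
      linarith
    · rw [hdiv]; omega
    · intro s3 h3
      rw [hmod, hdiv]
      simpa [hk, hx1] using h3
  · have hx0' : 0 ≤ -x := by omega
    have hdiv : x.tdiv p = -(-x / p) := by
      rw [← Int.tdiv_eq_ediv_of_nonneg hx0', Int.neg_tdiv, neg_neg]
    have hmod : x.tmod p = -(-x % p) := by
      rw [← Int.tmod_eq_emod_of_nonneg hx0', Int.neg_tmod, neg_neg]
    have hk : (((-x / p).toNat : ℕ) : ℤ) = -x / p :=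
      Int.toNat_of_nonneg (Int.ediv_nonneg hx0' hp'.le)
    have hx1 : -x - p * (-x / p) = -x % p := by rw [Int.emod_def]
    refine (hfirst.seq fun s1 h1 => (hloop1 0 (fun i => ?_) s1 h1).seq
      fun s2 h2 => hloop2 (-x / p).toNat _ _ (fun i => ?_) s2 h2).mono ?_ ?_
    · refine iff_of_false (by omega) ?_
      have : (0 : ℤ) ≤ p * i := by positivity
      linarith
    · rw [hmul (-x) i hx0']
      push_cast
      constructor <;> intro h <;> linarith
    · rw [hdiv]; omega
    · intro s3 h3
      rw [hmod, hdiv]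
      have e1 : x - (p : ℤ) * ((0 : ℕ) : ℤ) + p * (((-x / p).toNat : ℕ) : ℤ) = -(-x % p) := by
        rw [hk, ← hx1]; push_cast; ring
      have e2 : d + ((0 : ℕ) : ℤ) - (((-x / p).toNat : ℕ) : ℤ) = d + -(-x / p) := by
        rw [hk]; push_cast; ring
      rwa [e1, e2] at h3

/-- The invariant of dynamic programming, before layer `j`. -/
structure DpInv (p N : ℕ) (k : ℤ) (D : ℕ → ℤ) (s₀ : St Var Arr) (j : ℕ) (s : St Var Arr) :
    Prop where
  h : s.v .h = j - N
  m : s.v .m = s₀.v .m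
  bot : s.v .bot = s₀.v .bot
  top : s.v .top = s₀.v .top
  inf : s.v .inf = s₀.v .inf
  sym : s.v .sym = s₀.v .sym
  cnt : s.v .cnt = s₀.v .cnt
  inp : s.inp = s₀.inp
  out : s.out = s₀.out
  dig : ∀ i, j ≤ i → s.a .dig (i - N) = D i + if i = j then carryIn p D j else 0
  opt : Optimal p (forced N k) (digit p D) (s₀.v .inf) (fun q i => s.a (.back q) (i - N))
    (fun q i => s.a (.label q) (i - N)) j (fun q => s.v (.old q))

theorem DpInv.step {p N : ℕ} (hp : 0 < p) {D : ℕ → ℤ} {s₀ : St Var Arr} {j : ℕ}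
    {s : St Var Arr} (h : DpInv p N (s₀.v .m) D s₀ j s) :
    (Prog.seq (normalise p) (dpStep p)).Ends s
      (7 * (carryIn p D (j + 1)).natAbs + 6 + (dpStep p).cost)
      (DpInv p N (s₀.v .m) D s₀ (j + 1)) := by
  have hx : s.a .dig (s.v .h) = D j + carryIn p D j := by
    rw [h.h, h.dig j le_rfl, if_pos rfl]
  have hnorm := normalise_ends hp s
  rw [hx] at hnorm
  refine Prog.Ends.seq (hnorm : (normalise p).Ends s (7 * (carryIn p D (j + 1)).natAbs + 6) _)
    fun s1 h1 => (loopFree_dpStep p).ends ?_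
  have he : s1.v .e = digit p D j := h1.e
  have hv : ∀ y, y ≠ .e → y ≠ .nxt → y ≠ .tmp → s1.v y = s.v y := h1.v
  have hh : s1.v .h = s.v .h := hv _ (by simp) (by simp) (by simp)
  have hm : s1.v .m = s₀.v .m := (hv _ (by simp) (by simp) (by simp)).trans h.m
  have hinf : s1.v .inf = s₀.v .inf := (hv _ (by simp) (by simp) (by simp)).trans h.inf
  have hold : ∀ q, s1.v (.old q) = s.v (.old q) := fun q => hv _ (by simp) (by simp) (by simp)
  have hback : ∀ q, s1.a (.back q) = s.a (.back q) := fun q => h1.a _ (by simp)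
  have hlabel : ∀ q, s1.a (.label q) = s.a (.label q) := fun q => h1.a _ (by simp)
  obtain ⟨s2, h2, h3⟩ := dpStep_eval (p := p) (s := s1) (N := N) (j := j)
    (by rw [he]; exact abs_digit_le hp D j) (by rw [hh, h.h])
  rw [h3]
  rw [hm, he] at h2
  have hs2 : ∀ y, y ≠ .tmp → y ≠ .best → y ≠ .lab → y ≠ .frc → (∀ q, y ≠ .new q) →
      (∀ q, y ≠ .old q) → y ≠ .e → y ≠ .nxt → s2.v y = s.v y :=
    fun y f1 f2 f3 f4 f5 f6 f7 f8 => (h2.v y f1 f2 f3 f4 f5 f6).trans (hv y f7 f8 f1)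
  refine ⟨?_, ?_, ?_, ?_, ?_, ?_, ?_, ?_, ?_, fun i hi => ?_, ?_⟩
  · simp [St.setv, hh, h.h]; ring
  · rw [← h.m]; exact hs2 .m (by simp) (by simp) (by simp) (by simp) (by simp) (by simp)
      (by simp) (by simp)
  · rw [← h.bot]; exact hs2 .bot (by simp) (by simp) (by simp) (by simp) (by simp) (by simp)
      (by simp) (by simp)
  · rw [← h.top]; exact hs2 .top (by simp) (by simp) (by simp) (by simp) (by simp) (by simp)
      (by simp) (by simp)
  · rw [← h.inf]; exact hs2 .inf (by simp) (by simp) (by simp) (by simp) (by simp) (by simp)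
      (by simp) (by simp)
  · rw [← h.sym]; exact hs2 .sym (by simp) (by simp) (by simp) (by simp) (by simp) (by simp)
      (by simp) (by simp)
  · rw [← h.cnt]; exact hs2 .cnt (by simp) (by simp) (by simp) (by simp) (by simp) (by simp)
      (by simp) (by simp)
  · exact h2.inp.trans (h1.inp.trans h.inp)
  · exact h2.output.trans (h1.out.trans h.out)
  · have e1 : (s2.setv .h (s1.v .h + 1)).a .dig = s2.a .dig := rfl
    rw [e1, h2.dig, h1.dig, h.h]
    by_cases hij : i = j + 1
    · subst hij
      rw [if_pos rfl, show ((j + 1 : ℕ) : ℤ) - N = j - N + 1 by push_cast; ring,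
        Function.update_self, show (j : ℤ) - N + 1 = ((j + 1 : ℕ) : ℤ) - N by push_cast; ring,
        h.dig _ (by omega), if_neg (by omega), add_zero]
      rfl
    · rw [if_neg hij, Function.update_of_ne (by omega), h.dig i (by omega), if_neg (by omega)]
  · refine h.opt.succ (fun q i hi => ?_) (fun q i hi => ?_) (fun q q' ha => ?_) fun q' hq' => ?_
    · have := h2.back q (i - N) (by rw [hh, h.h]; omega)
      rw [hback] at this
      exact this
    · have := h2.label q (i - N) (by rw [hh, h.h]; omega)
      rw [hlabel] at this
      exact this
    · have := h2.le q q' ha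
      rw [hold] at this
      simpa [St.setv] using this
    · have := h2.eq q' (by rw [hinf]; simpa [St.setv] using hq')
      simp only [hold, hh, h.h] at this
      simpa [St.setv] using this

theorem dpInit_eval (s : St Var Arr) :
    (dpInit.eval s).v .h = s.v .bot ∧ (dpInit.eval s).a = s.a ∧ (dpInit.eval s).inp = s.inp ∧
      (dpInit.eval s).out = s.out ∧
      (∀ q, (dpInit.eval s).v (.old q) = if q = startState then 0 else s.v .inf) ∧
      ∀ y, y ≠ .h → (∀ q, y ≠ .old q) → (dpInit.eval s).v y = s.v y := by
  have key : ∀ (l : List (Fin 15)) (s : St Var Arr),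
      let s' := (Prog.block (l.map fun q => (.set (.old q)
        (if q = startState then .lit 0 else .var .inf) : Cmd))).eval s
      s'.a = s.a ∧ s'.inp = s.inp ∧ s'.out = s.out ∧ (∀ y, (∀ q, y ≠ .old q) → s'.v y = s.v y) ∧
        ∀ q ∈ l, s'.v (.old q) = if q = startState then 0 else s.v .inf := by
    intro l s
    induction l using List.reverseRecOn with
    | nil => simp [Prog.block, Prog.eval]
    | append_singleton l q0 ih =>
      simp only [List.map_append, Prog.eval_block_append]
      set s1 := (Prog.block (l.map fun q => (.set (.old q)
        (if q = startState then .lit 0 else .var .inf) : Cmd))).eval s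
      obtain ⟨h1, h2, h3, h4, h5⟩ := ih
      refine ⟨h1, h2, h3, fun y hy => ?_, fun q hq => ?_⟩
      · rw [← h4 y hy]
        simp [Prog.block, Prog.eval, St.setv, hy q0]
      · have h6 : s1.v .inf = s.v .inf := h4 _ (by simp)
        by_cases hq0 : q = q0
        · subst hq0
          simp only [Prog.block, Prog.eval, St.setv, List.map_cons, List.map_nil,
            Function.update_self]
          split_ifs
          · rfl
          · exact h6
        · have hmem : q ∈ l := by simpa [hq0] using hq
          simp [Prog.block, Prog.eval, St.setv, hq0, h5 q hmem]
  obtain ⟨h1, h2, h3, h4, h5⟩ := key (List.finRange 15) (s.setv .h (s.v .bot))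
  refine ⟨?_, h1, h2, h3, fun q => (h5 q (List.mem_finRange q)).trans ?_,
    fun y hy hy' => (h4 y hy').trans (by simp [St.setv, hy])⟩
  · exact (h4 .h (by simp)).trans (by simp [St.setv])
  · simp [St.setv]

theorem dp_ends {p N : ℕ} (hp : 2 ≤ p) {s : St Var Arr} (hbot : s.v .bot = -(N : ℤ))
    (htop : s.v .top = 2 * N + 2)
    (hD : ∑ i ∈ Finset.range (3 * N + 2), |window N (s.a .dig) i| ≤ N) :
    (dp p).Ends s (dpInit.cost + (7 * N + (7 + (dpStep p).cost) * (3 * N + 2) + 1))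
      (DpInv p N (s.v .m) (window N (s.a .dig)) s (3 * N + 2)) := by
  set D := window N (s.a .dig) with hDdef
  obtain ⟨h1, h2, h3, h4, h5, h6⟩ := dpInit_eval s
  refine (loopFree_dpInit.ends (Q := DpInv p N (s.v .m) D s 0) ?_).seq fun s1 hs1 => ?_
  · refine ⟨by rw [h1, hbot]; simp, h6 _ (by simp) (by simp), h6 _ (by simp) (by simp),
      h6 _ (by simp) (by simp), h6 _ (by simp) (by simp), h6 _ (by simp) (by simp),
      h6 _ (by simp) (by simp), h3, h4, fun i _ => ?_, Optimal.init ?_ fun q hq => ?_⟩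
    · rw [h2, hDdef]
      simp [carryIn, window]
    · rw [h5, if_pos rfl]
    · rw [h5, if_neg hq]
  · refine (Prog.Ends.while (3 * N + 2)
      (fun j => 7 * (carryIn p D (j + 1)).natAbs + 6 + (dpStep p).cost)
      (DpInv p N (s.v .m) D s) hs1 (fun j hj s2 h => ⟨?_, h.step (by omega)⟩) ?_).mono ?_ ?_
    · simp only [Atom.val, h.h, h.top, htop]; omega
    · intro s2 h
      simp only [Atom.val, h.h, h.top, htop]; push_cast; omega
    · have e1 := sum_abs_carryIn_le hp D (3 * N + 2)
      have e2 : (∑ j ∈ Finset.range (3 * N + 2), (carryIn p D (j + 1)).natAbs) ≤ N := by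
        zify
        have := abs_nonneg (carryIn p D (3 * N + 2))
        linarith
      have e3 : ∀ j, 7 * (carryIn p D (j + 1)).natAbs + 6 + (dpStep p).cost + 1 =
          7 * (carryIn p D (j + 1)).natAbs + (7 + (dpStep p).cost) := fun j => by ring
      simp only [e3, Finset.sum_add_distrib, Finset.sum_const, Finset.card_range, smul_eq_mul,
        ← Finset.mul_sum]
      nlinarith
    · exact fun _ h => h

/-! ### Backtracking -/

/-- One step back, from the state `q` at the height above `h`. The interval of the heights visited is
where the phase is `1`; its upper end is found as the height below the lowest one in phase `2`. -/
def stepBack (q : Fin 15) : Cmd :=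
  .block [.get .tmp (.label q) .h, .put .out .h .tmp, .get .q (.back q) .h,
    if phase q = 1 then .set .lo (.var .h)
    else if phase q = 2 then .block [.set .hi (.var .h), .inc .hi (-1)] else .skip]

/-- One step back. -/
def backStep : Cmd :=
  .block [.inc .h (-1), .cases .q 0 ((List.finRange 15).map stepBack)]

/-- Follows the table of predecessors from the final state to the start. -/
def backtrack : Cmd :=
  .seq (.block [.set .q (.lit finalState.val), .set .h (.var .top)])
    (.while (.var .bot) (.var .h) backStep)

/-- The invariant of backtracking, when the layers from `j` to `T` have been dealt with. -/
structure BackInv (N T lo hi : ℕ) (qs : ℕ → Fin 15) (c : ℕ → ℤ) (s₀ : St Var Arr) (j : ℕ)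
    (s : St Var Arr) : Prop where
  h : s.v .h = j - N
  q : s.v .q = (qs j).val
  m : s.v .m = s₀.v .m
  bot : s.v .bot = s₀.v .bot
  sym : s.v .sym = s₀.v .sym
  cnt : s.v .cnt = s₀.v .cnt
  inp : s.inp = s₀.inp
  output : s.out = s₀.out
  back : ∀ q, s.a (.back q) = s₀.a (.back q)
  label : ∀ q, s.a (.label q) = s₀.a (.label q)
  out : ∀ i, j ≤ i → i < T → s.a .out (i - N) = c i
  lo : j ≤ lo → s.v .lo = lo - N
  hi : j ≤ hi + 1 → s.v .hi = hi - N

theorem loopFree_backStep : backStep.LoopFree := by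
  have h : ∀ P ∈ (List.finRange 15).map stepBack, P.LoopFree := by
    intro P hP
    obtain ⟨q, -, rfl⟩ := List.mem_map.1 hP
    unfold stepBack
    split_ifs <;> simp [Prog.block, Prog.LoopFree]
  simp [backStep, Prog.block, Prog.LoopFree, Prog.loopFree_cases _ _ h]

theorem BackInv.step {N T lo hi : ℕ} {qs : ℕ → Fin 15} {c : ℕ → ℤ} {s₀ s : St Var Arr} {j : ℕ}
    (hlohi : lo ≤ hi) (hj : j < T)
    (hphase : phase (qs (j + 1)) = if j < lo then 0 else if j ≤ hi then 1 else 2)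
    (hback : s₀.a (.back (qs (j + 1))) (j - N) = (qs j).val)
    (hlabel : s₀.a (.label (qs (j + 1))) (j - N) = c j)
    (h : BackInv N T lo hi qs c s₀ (j + 1) s) :
    BackInv N T lo hi qs c s₀ j (backStep.eval s) := by
  obtain ⟨h1, h2, h3, h4, h5, h6, h7, h8, h9, h10, h11, h12, h13⟩ := h
  have hh : s.v .h + -1 = j - N := by rw [h1]; push_cast; ring
  have e1 : backStep.eval s = (stepBack (qs (j + 1))).eval (s.setv .h (j - N)) := by
    have e2 : (Prog.cases .q 0 ((List.finRange 15).map stepBack)).eval (s.setv .h (j - N)) =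
        (stepBack (qs (j + 1))).eval (s.setv .h (j - N)) := by
      rw [Prog.eval_cases (i := (qs (j + 1)).val) (by simp) (by simp [St.setv, h2])]
      simp
    rw [← e2]
    simp only [backStep, Prog.block, Prog.eval, hh]
  have e3 : ∃ s1, (stepBack (qs (j + 1))).eval (s.setv .h (j - N)) =
      (if phase (qs (j + 1)) = 1 then Prog.set .lo (.var .h)
        else if phase (qs (j + 1)) = 2 then .block [.set .hi (.var .h), .inc .hi (-1)]
        else .skip : Cmd).eval s1 ∧
      s1.v = Function.update (Function.update (Function.update s.v .h (j - N)) .tmp (c j)) .q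
        ((qs j).val : ℤ) ∧
      s1.a = Function.update s.a .out (Function.update (s.a .out) (j - N) (c j)) ∧
      s1.inp = s.inp ∧ s1.out = s.out := by
    refine ⟨_, rfl, ?_, ?_, rfl, rfl⟩ <;>
      simp [Prog.eval, St.setv, St.seta, h9, h10, hback, hlabel]
  obtain ⟨s1, e4, e5, e6, e7, e8⟩ := e3
  rw [e1, e4, hphase]
  have hout : ∀ i, j ≤ i → i < T → s1.a .out (i - N) = c i := by
    intro i hi1 hi2
    rw [e6, Function.update_self]
    by_cases hij : i = j
    · rw [hij, Function.update_self]
    · rw [Function.update_of_ne (by omega)]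
      exact h11 i (by omega) hi2
  by_cases c1 : j < lo
  · rw [if_pos c1, if_neg (by omega), if_neg (by omega)]
    refine ⟨?_, ?_, ?_, ?_, ?_, ?_, ?_, ?_, ?_, ?_, hout, fun _ => ?_, fun _ => ?_⟩
    on_goal 11 => rw [← h12 (by omega)]
    on_goal 12 => rw [← h13 (by omega)]
    all_goals simp [Prog.eval, *]
  · by_cases c2 : j ≤ hi
    · rw [if_neg c1, if_pos c2, if_pos rfl]
      refine ⟨?_, ?_, ?_, ?_, ?_, ?_, ?_, ?_, ?_, ?_, hout, fun hle => ?_, fun _ => ?_⟩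
      on_goal 11 => obtain rfl : j = lo := by omega
      on_goal 12 => rw [← h13 (by omega)]
      all_goals simp [Prog.eval, St.setv, Atom.val, *]
    · rw [if_neg c1, if_neg c2, if_neg (by omega), if_pos rfl]
      refine ⟨?_, ?_, ?_, ?_, ?_, ?_, ?_, ?_, ?_, ?_, hout, fun hle => ?_, fun hle => ?_⟩
      on_goal 11 => omega
      on_goal 11 => obtain rfl : j = hi + 1 := by omega
      all_goals simp [Prog.block, Prog.eval, St.setv, Atom.val, *]
      all_goals ring

theorem backtrack_ends {N T lo hi : ℕ} {qs : ℕ → Fin 15} {c : ℕ → ℤ} {s : St Var Arr}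
    (hlohi : lo ≤ hi) (hhi : hi + 1 < T) (hbot : s.v .bot = -(N : ℤ))
    (htop : s.v .top = T - N) (hq : qs T = finalState)
    (hphase : ∀ j < T, phase (qs (j + 1)) = if j < lo then 0 else if j ≤ hi then 1 else 2)
    (hback : ∀ j < T, s.a (.back (qs (j + 1))) (j - N) = (qs j).val)
    (hlabel : ∀ j < T, s.a (.label (qs (j + 1))) (j - N) = c j) :
    backtrack.Ends s (3 + ((backStep.cost + 1) * T + 1)) (BackInv N T lo hi qs c s 0) := by
  refine Prog.Ends.seq (t := 3) (Q := BackInv N T lo hi qs c s T) (Prog.LoopFree.ends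
    (by simp [Prog.block, Prog.LoopFree]) ?_) fun s1 h1 => ?_
  · constructor <;> try simp [Prog.block, Prog.eval, St.setv, Atom.val, htop, hq]
    · intro i h1 h2; omega
    · intro h; omega
    · intro h; omega
  · refine (Prog.Ends.while T (fun _ => backStep.cost)
      (fun i => BackInv N T lo hi qs c s (T - i)) h1 (fun i hi s2 h2 => ⟨?_,
        loopFree_backStep.ends ?_⟩) (fun s2 h2 => ?_)).mono (by simp [mul_comm]) (by simp)
    · simp only [Atom.val, h2.h, h2.bot, hbot]; omega
    · have e : T - i = T - (i + 1) + 1 := by omega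
      rw [e] at h2
      exact h2.step hlohi (by omega) (hphase _ (by omega)) (hback _ (by omega))
        (hlabel _ (by omega))
    · simp only [Atom.val, h2.h, h2.bot, hbot]; simp

/-! ### Output -/

/-- Prints a letter, or only counts it. -/
def emit (pr : Bool) (l : Letter) : Cmd :=
  if pr then .print (.lit (letterCode l)) else .inc .cnt 1

/-- The word `a ^ z`. -/
def powWord (z : ℤ) : Word := List.replicate z.natAbs (Gen.a, decide (0 < z))

/-- Emits `a ^ z`, with `z` the array element at height `x`. -/
def emitPow (pr : Bool) : Cmd :=
  .seq (.get .tmp .out .x)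
    (.seq (.while (.lit 0) (.var .tmp) (.block [emit pr (Gen.a, true), .inc .tmp (-1)]))
      (.while (.var .tmp) (.lit 0) (.block [emit pr (Gen.a, false), .inc .tmp 1])))

/-- The direction up or down as a sign. -/
def sgn (up : Bool) : ℤ := if up then 1 else -1

/-- Moves up or down by `k` heights, from height `x₀`; after each step to a height `i`, the power
`a ^ c i` is written if `sw` holds. -/
def moveWord (up sw : Bool) (c : ℤ → ℤ) (x₀ : ℤ) : ℕ → Word
  | 0 => []
  | k + 1 => moveWord up sw c x₀ k ++ ((Gen.t, up) ::
      if sw then powWord (c (x₀ + sgn up * (k + 1 : ℕ))) else [])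

/-- Emits the word for a move to the height `y`. -/
def move (pr up sw : Bool) (y : Var) : Cmd :=
  .while (if up then .var .x else .var y) (if up then .var y else .var .x)
    (.seq (.block [emit pr (Gen.t, up), .inc .x (sgn up)]) (if sw then emitPow pr else .skip))

/-- Emits the whole word: with `m ≥ 0`, it goes down to the lowest height, then up to the highest one
and writes the powers of `a` on the way, then down to `m`. With `m < 0`, up and down are
interchanged. -/
def emitWord (pr : Bool) : Cmd :=
  .seq (.set .x (.lit 0)) (.ite (.var .m) (.lit 0)
    (.seq (move pr true false .hi) (.seq (emitPow pr)
      (.seq (move pr false true .lo) (move pr true false .m))))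
    (.seq (move pr false false .lo) (.seq (emitPow pr)
      (.seq (move pr true true .hi) (move pr false false .m)))))

/-- The word `u` has been emitted. -/
structure Emitted (pr : Bool) (s : St Var Arr) (u : Word) (s' : St Var Arr) : Prop where
  out : s'.out = s.out ++ if pr then encodeWord u else []
  cnt : s'.v .cnt = s.v .cnt + if pr then 0 else (u.length : ℤ)
  v : ∀ y, y ≠ .tmp → y ≠ .x → y ≠ .cnt → s'.v y = s.v y
  a : s'.a = s.a
  inp : s'.inp = s.inp

theorem Emitted.refl (pr : Bool) (s : St Var Arr) : Emitted pr s [] s :=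
  ⟨by simp [encodeWord], by simp, fun _ _ _ _ => rfl, rfl, rfl⟩

theorem Emitted.trans {pr : Bool} {s s' s'' : St Var Arr} {u v : Word} (h : Emitted pr s u s')
    (h' : Emitted pr s' v s'') : Emitted pr s (u ++ v) s'' := by
  refine ⟨?_, ?_, fun y h1 h2 h3 => (h'.v y h1 h2 h3).trans (h.v y h1 h2 h3), h'.a.trans h.a,
    h'.inp.trans h.inp⟩
  · rw [h'.out, h.out]; cases pr <;> simp [encodeWord]
  · rw [h'.cnt, h.cnt]; cases pr <;> simp [add_assoc]

theorem Emitted.letter {pr : Bool} {s s' : St Var Arr} {u : Word} (h : Emitted pr s u s')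
    (l : Letter) {y : Var} (hy : y = .tmp ∨ y = .x) (k : ℤ) :
    Emitted pr s (u ++ [l]) ((.block [emit pr l, .inc y k] : Cmd).eval s') ∧
    ((.block [emit pr l, .inc y k] : Cmd).eval s').v y = s'.v y + k ∧
    ∀ z, z ≠ .cnt → z ≠ y → ((.block [emit pr l, .inc y k] : Cmd).eval s').v z = s'.v z := by
  have hyc : y ≠ .cnt := by rcases hy with rfl | rfl <;> simp
  refine ⟨h.trans ⟨?_, ?_, fun z h1 h2 h3 => ?_, ?_, ?_⟩, ?_, fun z hz hzy => ?_⟩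
  · cases pr <;> simp [Prog.block, Prog.eval, emit, St.setv, encodeWord, Atom.val]
  · cases pr <;> simp [Prog.block, Prog.eval, emit, St.setv, Ne.symm hyc]
  · have : z ≠ y := by rcases hy with rfl | rfl <;> assumption
    cases pr <;> simp [Prog.block, Prog.eval, emit, St.setv, this, h3]
  · cases pr <;> simp [Prog.block, Prog.eval, emit, St.setv]
  · cases pr <;> simp [Prog.block, Prog.eval, emit, St.setv]
  · cases pr <;> simp [Prog.block, Prog.eval, emit, St.setv, hyc]
  · cases pr <;> simp [Prog.block, Prog.eval, emit, St.setv, hz, hzy]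

theorem loopFree_emit (pr : Bool) (l : Letter) (y : Var) (k : ℤ) :
    (.block [emit pr l, .inc y k] : Cmd).LoopFree := by
  cases pr <;> simp [emit, Prog.block, Prog.LoopFree]

theorem cost_emit (pr : Bool) (l : Letter) (y : Var) (k : ℤ) :
    (.block [emit pr l, .inc y k] : Cmd).cost = 3 := by
  cases pr <;> simp [emit, Prog.block, Prog.cost]

theorem emitPow_ends (pr : Bool) (s : St Var Arr) :
    (emitPow pr).Ends s (4 * (s.a .out (s.v .x)).natAbs + 3) fun s' =>
      Emitted pr s (powWord (s.a .out (s.v .x))) s' ∧ s'.v .x = s.v .x := by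
  set z := s.a .out (s.v .x) with hz
  have hget : (Prog.get .tmp .out .x : Cmd).Ends s 1
      fun s' => Emitted pr s [] s' ∧ s'.v .x = s.v .x ∧ s'.v .tmp = z :=
    ⟨_, .get, ⟨by simp [St.setv, encodeWord], by simp [St.setv],
      fun y h1 _ _ => by simp [St.setv, h1], rfl, rfl⟩, by simp [St.setv], by simp [St.setv, hz]⟩
  have hloop1 : ∀ s1, Emitted pr s [] s1 ∧ s1.v .x = s.v .x ∧ s1.v .tmp = z →
      (Prog.while (.lit 0) (.var .tmp) (.block [emit pr (Gen.a, true), .inc .tmp (-1)]) :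
        Cmd).Ends s1 (4 * z.toNat + 1) fun s' =>
          Emitted pr s (List.replicate z.toNat (Gen.a, true)) s' ∧ s'.v .x = s.v .x ∧
            s'.v .tmp = z - z.toNat := by
    intro s1 h1
    refine (Prog.Ends.while z.toNat (fun _ => 3) (fun i s' =>
      Emitted pr s (List.replicate i (Gen.a, true)) s' ∧ s'.v .x = s.v .x ∧ s'.v .tmp = z - i)
      (by simpa using h1) (fun i hi s2 h2 => ⟨?_, ?_⟩) fun s2 h2 => ?_).mono
      (by simp; omega) (fun _ h => h)
    · simp only [Atom.val, h2.2.2]; omega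
    · rw [← cost_emit pr (Gen.a, true) .tmp (-1)]
      obtain ⟨e1, e2, e3⟩ := h2.1.letter (Gen.a, true) (Or.inl rfl) (-1)
      refine (loopFree_emit _ _ _ _).ends ⟨?_, ?_, ?_⟩
      · rw [List.replicate_succ']; exact e1
      · rw [e3 _ (by simp) (by simp), h2.2.1]
      · rw [e2, h2.2.2]; push_cast; ring
    · simp only [Atom.val, h2.2.2]; omega
  have hloop2 : ∀ s1, Emitted pr s (List.replicate z.toNat (Gen.a, true)) s1 ∧ s1.v .x = s.v .x ∧
        s1.v .tmp = z - z.toNat →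
      (Prog.while (.var .tmp) (.lit 0) (.block [emit pr (Gen.a, false), .inc .tmp 1]) :
        Cmd).Ends s1 (4 * (-z).toNat + 1) fun s' =>
          Emitted pr s (List.replicate z.toNat (Gen.a, true) ++
            List.replicate (-z).toNat (Gen.a, false)) s' ∧ s'.v .x = s.v .x := by
    intro s1 h1
    refine (Prog.Ends.while (-z).toNat (fun _ => 3) (fun i s' =>
      Emitted pr s (List.replicate z.toNat (Gen.a, true) ++ List.replicate i (Gen.a, false)) s' ∧
        s'.v .x = s.v .x ∧ s'.v .tmp = z - z.toNat + i)
      (by simpa using h1) (fun i hi s2 h2 => ⟨?_, ?_⟩) fun s2 h2 => ?_).mono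
      (by simp; omega) (fun _ h => ⟨h.1, h.2.1⟩)
    · simp only [Atom.val, h2.2.2]; omega
    · rw [← cost_emit pr (Gen.a, false) .tmp 1]
      obtain ⟨e1, e2, e3⟩ := h2.1.letter (Gen.a, false) (Or.inl rfl) 1
      refine (loopFree_emit _ _ _ _).ends ⟨?_, ?_, ?_⟩
      · rw [List.replicate_succ', ← List.append_assoc]; exact e1
      · rw [e3 _ (by simp) (by simp), h2.2.1]
      · rw [e2, h2.2.2]; push_cast; ring
    · simp only [Atom.val, h2.2.2]; omega
  have hpow : List.replicate z.toNat (Gen.a, true) ++ List.replicate (-z).toNat (Gen.a, false) =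
      powWord z := by
    unfold powWord
    by_cases hpos : 0 < z
    · rw [show (-z).toNat = 0 by omega, show z.natAbs = z.toNat by omega]; simp [hpos]
    · rw [show z.toNat = 0 by omega, show z.natAbs = (-z).toNat by omega]; simp [hpos]
  refine (hget.seq fun s1 h1 => (hloop1 s1 h1).seq fun s2 h2 => hloop2 s2 h2).mono (by omega) ?_
  rw [hpow]
  exact fun _ h => h

theorem moveWord_length_succ (up sw : Bool) (c : ℤ → ℤ) (x₀ : ℤ) (k : ℕ) :
    (moveWord up sw c x₀ (k + 1)).length = (moveWord up sw c x₀ k).length + 1 +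
      if sw then (c (x₀ + sgn up * (k + 1 : ℕ))).natAbs else 0 := by
  cases sw <;> simp [moveWord, powWord]; omega

theorem move_ends (pr up sw : Bool) {y : Var} (h1 : y ≠ .tmp) (h2 : y ≠ .x) (h3 : y ≠ .cnt)
    {s : St Var Arr} {k : ℕ} (hk : s.v y = s.v .x + sgn up * k) :
    (move pr up sw y).Ends s (7 * (moveWord up sw (s.a .out) (s.v .x) k).length + 1) fun s' =>
      Emitted pr s (moveWord up sw (s.a .out) (s.v .x) k) s' ∧ s'.v .x = s.v y := by
  have htime : ∀ k, ∑ i ∈ Finset.range k,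
      (3 + (if sw then 4 * (s.a .out (s.v .x + sgn up * (i + 1 : ℕ))).natAbs + 3 else 1) + 1) + 1 ≤
      7 * (moveWord up sw (s.a .out) (s.v .x) k).length + 1 := by
    intro k
    induction k with
    | zero => simp
    | succ k ih =>
      rw [Finset.sum_range_succ, moveWord_length_succ]
      split_ifs at * <;> omega
  refine (Prog.Ends.while k (fun i => 3 + (if sw then
      4 * (s.a .out (s.v .x + sgn up * (i + 1 : ℕ))).natAbs + 3 else 1)) (fun i s' =>
    Emitted pr s (moveWord up sw (s.a .out) (s.v .x) i) s' ∧ s'.v .x = s.v .x + sgn up * i)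
    ⟨Emitted.refl _ _, by simp⟩ (fun i hi s1 hs1 => ⟨?_, ?_⟩) fun s1 hs1 => ?_).mono (htime k) ?_
  · have e1 := hs1.2
    have e2 := hs1.1.v y h1 h2 h3
    cases up <;> simp [Atom.val, e1, e2, hk, sgn] <;> omega
  · obtain ⟨e1, e2, e3⟩ := hs1.1.letter (Gen.t, up) (Or.inr rfl) (sgn up)
    have hc := cost_emit pr (Gen.t, up) .x (sgn up)
    refine Prog.Ends.seq (Q := fun s' => Emitted pr s (moveWord up sw (s.a .out) (s.v .x) i ++
      [(Gen.t, up)]) s' ∧ s'.v .x = s.v .x + sgn up * (i + 1 : ℕ)) ?_ fun s2 hs2 => ?_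
    · rw [← hc]
      refine (loopFree_emit _ _ _ _).ends ⟨e1, ?_⟩
      rw [e2, hs1.2]; push_cast; ring
    · cases sw
      · exact ⟨s2, .skip, by simpa [moveWord] using hs2.1, hs2.2⟩
      · have := emitPow_ends pr s2
        rw [hs2.2, hs2.1.a] at this
        refine this.mono (by simp) fun s3 hs3 => ⟨?_, hs3.2⟩
        have h4 := hs2.1.trans hs3.1
        simpa [moveWord] using h4
  · have e1 := hs1.2
    have e2 := hs1.1.v y h1 h2 h3
    cases up <;> simp [Atom.val, e1, e2, hk, sgn]
  · exact fun s' h => ⟨h.1, h.2.trans hk.symm⟩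

/-- The word with the powers of `a` prescribed by `c`, for a path from `0` that turns at the heights
`A` and `B`, at distances `k₁`, `k₂`, and that ends at distance `k₃` from `B`. -/
def sweepWord (up : Bool) (c : ℤ → ℤ) (A B : ℤ) (k₁ k₂ k₃ : ℕ) : Word :=
  moveWord (!up) false c 0 k₁ ++ (powWord (c A) ++
    (moveWord up true c A k₂ ++ moveWord (!up) false c B k₃))

theorem emitWord_ends (pr : Bool) {s : St Var Arr} {up : Bool} {A B : ℤ} {k₁ k₂ k₃ : ℕ}
    (hup : up = decide (0 ≤ s.v .m)) (hA : A = if up then s.v .lo else s.v .hi)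
    (hB : B = if up then s.v .hi else s.v .lo) (h1 : A = sgn (!up) * k₁)
    (h2 : B = A + sgn up * k₂) (h3 : s.v .m = B + sgn (!up) * k₃) :
    (emitWord pr).Ends s (7 * (sweepWord up (s.a .out) A B k₁ k₂ k₃).length + 8)
      (Emitted pr s (sweepWord up (s.a .out) A B k₁ k₂ k₃)) := by
  have hlen : 7 * (moveWord (!up) false (s.a .out) 0 k₁).length + 1 +
      (4 * (s.a .out A).natAbs + 3 + (7 * (moveWord up true (s.a .out) A k₂).length + 1 +
      (7 * (moveWord (!up) false (s.a .out) B k₃).length + 1))) ≤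
      7 * (sweepWord up (s.a .out) A B k₁ k₂ k₃).length + 6 := by
    simp only [sweepWord, List.length_append, powWord, List.length_replicate]; omega
  -- The four parts, for both directions at once.
  have hparts : ∀ yA yB : Var, yA = .lo ∨ yA = .hi → yB = .lo ∨ yB = .hi → s.v yA = A →
      s.v yB = B → (Prog.seq (move pr (!up) false yA) (.seq (emitPow pr)
        (.seq (move pr up true yB) (move pr (!up) false .m)))).Ends (s.setv .x 0)
        (7 * (sweepWord up (s.a .out) A B k₁ k₂ k₃).length + 6)
        (Emitted pr s (sweepWord up (s.a .out) A B k₁ k₂ k₃)) := by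
    intro yA yB hyA hyB hsA hsB
    have n1 : yA ≠ .tmp ∧ yA ≠ .x ∧ yA ≠ .cnt := by rcases hyA with rfl | rfl <;> simp
    have n2 : yB ≠ .tmp ∧ yB ≠ .x ∧ yB ≠ .cnt := by rcases hyB with rfl | rfl <;> simp
    have hs0 : Emitted pr s [] (s.setv .x 0) := ⟨by simp [St.setv, encodeWord], by simp [St.setv],
      fun y _ h _ => by simp [St.setv, h], rfl, rfl⟩
    have m1 := move_ends pr (!up) false n1.1 n1.2.1 n1.2.2 (s := s.setv .x 0) (k := k₁)
      (by simp [St.setv, n1.2.1, hsA, h1])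
    have x0 : (s.setv .x 0).v .x = 0 := by simp [St.setv]
    have xA : (s.setv .x 0).v yA = A := by simp [St.setv, n1.2.1, hsA]
    have a0 : (s.setv .x 0).a = s.a := rfl
    rw [x0, xA, a0] at m1
    refine Prog.Ends.mono (m1.seq fun s1 hs1 => ?_) hlen fun _ h => h
    have q1 := hs0.trans hs1.1
    have m2 := emitPow_ends pr s1
    rw [hs1.2, q1.a] at m2
    refine m2.seq fun s2 hs2 => ?_
    have q2 := q1.trans hs2.1
    have b2 : s2.v yB = B := (q2.v yB n2.1 n2.2.1 n2.2.2).trans hsB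
    have m3 := move_ends pr up true n2.1 n2.2.1 n2.2.2 (s := s2) (k := k₂)
      (by rw [b2, hs2.2, h2])
    rw [hs2.2, q2.a, b2] at m3
    refine m3.seq fun s3 hs3 => ?_
    have q3 := q2.trans hs3.1
    have b3 : s3.v .m = s.v .m := q3.v .m (by simp) (by simp) (by simp)
    have m4 := move_ends pr (!up) false (y := .m) (by simp) (by simp) (by simp) (s := s3) (k := k₃)
      (by rw [b3, hs3.2, h3])
    rw [hs3.2, q3.a] at m4
    refine m4.mono le_rfl fun s4 hs4 => ?_
    have q4 := q3.trans hs4.1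
    simpa [sweepWord] using q4
  have htime : 1 + (7 * (sweepWord up (s.a .out) A B k₁ k₂ k₃).length + 6 + 1) =
      7 * (sweepWord up (s.a .out) A B k₁ k₂ k₃).length + 8 := by ring
  rw [← htime]
  refine Prog.Ends.seq (t := 1) (Q := fun s' => s' = s.setv .x 0) ⟨_, .set, rfl⟩ fun s1 hs1 => ?_
  subst hs1
  cases hu : up
  · subst hu
    have hm : s.v .m < 0 := by simpa using hup.symm
    exact Prog.Ends.ite_pos (by simpa [Atom.val, St.setv] using hm)
      (hparts .hi .lo (by simp) (by simp) (by simpa using hA.symm) (by simpa using hB.symm))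
  · subst hu
    have hm : 0 ≤ s.v .m := by simpa using hup.symm
    exact Prog.Ends.ite_neg (by simpa [Atom.val, St.setv] using hm)
      (hparts .lo .hi (by simp) (by simp) (by simpa using hA.symm) (by simpa using hB.symm))

theorem foldl_scanStep_replicate (n : ℕ) (b : Bool) (h : ℤ) (C : ℤ → ℤ) :
    (List.replicate n (Gen.a, b)).foldl scanStep (h, C) =
      (h, Function.update C h (C h + n * sgn b)) := by
  induction n with
  | zero => simp
  | succ n ih =>
    rw [List.replicate_succ', List.foldl_append, ih]
    simp only [List.foldl_cons, List.foldl_nil, scanStep, Function.update_self,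
      Function.update_idem]
    congr 2
    rw [sgn]; push_cast; ring

theorem foldl_scanStep_powWord (z h : ℤ) (C : ℤ → ℤ) :
    (powWord z).foldl scanStep (h, C) = (h, Function.update C h (C h + z)) := by
  rw [powWord, foldl_scanStep_replicate]
  congr 3
  by_cases hz : 0 < z
  · simp only [hz, decide_true, sgn, if_true]; omega
  · simp [hz, sgn, abs_of_nonpos (not_lt.1 hz)]

theorem foldl_scanStep_moveWord (up sw : Bool) (c : ℤ → ℤ) (x₀ : ℤ) (k : ℕ) (C : ℤ → ℤ) :
    (moveWord up sw c x₀ k).foldl scanStep (x₀, C) = (x₀ + sgn up * k, fun i => C i +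
      if sw = true ∧ 1 ≤ sgn up * (i - x₀) ∧ sgn up * (i - x₀) ≤ k then c i else 0) := by
  induction k with
  | zero =>
    simp only [moveWord, List.foldl_nil, Nat.cast_zero, mul_zero, add_zero]
    congr 1
    funext i
    rw [if_neg (by omega), add_zero]
  | succ k ih =>
    rw [moveWord, List.foldl_append, ih, List.foldl_cons]
    have hstep : x₀ + sgn up * (k : ℤ) + (if up then 1 else -1) = x₀ + sgn up * (k + 1 : ℕ) := by
      push_cast; rw [sgn]; ring
    cases sw
    · simp only [scanStep, hstep]
      simp
    · simp only [scanStep, hstep, if_true, foldl_scanStep_powWord, true_and]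
      congr 1
      funext i
      by_cases hi : i = x₀ + sgn up * (k + 1 : ℕ)
      · have h1 : sgn up * (i - x₀) = (k + 1 : ℕ) := by
          rw [hi]; cases up <;> simp [sgn]
        rw [hi, Function.update_self, ← hi, h1, if_neg (by omega), if_pos (by omega), add_zero]
      · have h1 : sgn up * (i - x₀) ≠ (k + 1 : ℕ) := by
          intro h; apply hi; rw [← h]; cases up <;> simp [sgn]
        rw [Function.update_of_ne hi]
        congr 1
        refine if_congr ?_ rfl rfl
        push_cast at h1 ⊢
        omega

theorem foldl_scanStep_sweepWord {up : Bool} {c : ℤ → ℤ} {A B : ℤ} {k₁ k₂ k₃ : ℕ}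
    (h1 : A = sgn (!up) * k₁) (h2 : B = A + sgn up * k₂) :
    (sweepWord up c A B k₁ k₂ k₃).foldl scanStep (0, 0) = (B + sgn (!up) * k₃, fun i =>
      if 0 ≤ sgn up * (i - A) ∧ sgn up * (i - A) ≤ k₂ then c i else 0) := by
  rw [sweepWord, List.foldl_append, foldl_scanStep_moveWord, List.foldl_append, zero_add, ← h1,
    foldl_scanStep_powWord, List.foldl_append, foldl_scanStep_moveWord, ← h2,
    foldl_scanStep_moveWord]
  congr 1
  funext i
  simp only [Bool.false_eq_true, false_and, if_false, add_zero, true_and, Pi.zero_apply, zero_add]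
  by_cases hi : i = A
  · subst hi
    simp
  · have h3 : sgn up * (i - A) ≠ 0 := by
      intro h; apply hi
      cases up <;> simp [sgn] at h; all_goals omega
    rw [Function.update_of_ne hi, zero_add]
    exact if_congr (by omega) rfl rfl

theorem length_moveWord (up sw : Bool) (c : ℤ → ℤ) (x₀ : ℤ) (k : ℕ) :
    (moveWord up sw c x₀ k).length = k +
      if sw then ∑ i ∈ Finset.range k, (c (x₀ + sgn up * (i + 1 : ℕ))).natAbs else 0 := by
  induction k with
  | zero => simp [moveWord]
  | succ k ih =>
    rw [moveWord_length_succ, ih, Finset.sum_range_succ]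
    split_ifs <;> omega

theorem length_sweepWord (up : Bool) (c : ℤ → ℤ) (A B : ℤ) (k₁ k₂ k₃ : ℕ) :
    (sweepWord up c A B k₁ k₂ k₃).length =
      k₁ + k₂ + k₃ + ∑ i ∈ Finset.range (k₂ + 1), (c (A + sgn up * i)).natAbs := by
  simp only [sweepWord, List.length_append, length_moveWord, powWord, List.length_replicate,
    Finset.sum_range_succ', Bool.false_eq_true, if_false, if_true, Nat.cast_zero, mul_zero,
    add_zero]
  ring

/-- A representation is turned into a word of the expected length, namely `repCost - |m|`. -/
theorem sweepWord_spec {p T N lo hi : ℕ} {m X : ℤ} {c : ℤ → ℤ} {c' : ℕ → ℤ}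
    (h : Rep p T N m X lo hi c') (hc : ∀ j < T, c (j - N) = c' j) :
    ∃ k₁ k₂ k₃ : ℕ, ∃ A B : ℤ, ∃ up : Bool, up = decide (0 ≤ m) ∧
      A = (if up then (lo : ℤ) - N else hi - N) ∧ B = (if up then (hi : ℤ) - N else lo - N) ∧
      A = sgn (!up) * k₁ ∧ B = A + sgn up * k₂ ∧ m = B + sgn (!up) * k₃ ∧
      height (sweepWord up c A B k₁ k₂ k₃) = m ∧
      (∑ j ∈ Finset.range T, window N (coef (sweepWord up c A B k₁ k₂ k₃)) j * (p : ℤ) ^ j) = X ∧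
      ((sweepWord up c A B k₁ k₂ k₃).length : ℤ) ≤ repCost T lo hi c' - |m| := by
  obtain ⟨e1, e2, e3, e4, e5, e6, e7⟩ := h
  set up := decide (0 ≤ m) with hup
  obtain ⟨A, hA⟩ : ∃ A : ℤ, A = if up then (lo : ℤ) - N else hi - N := ⟨_, rfl⟩
  obtain ⟨B, hB⟩ : ∃ B : ℤ, B = if up then (hi : ℤ) - N else lo - N := ⟨_, rfl⟩
  obtain ⟨k₁, hk₁⟩ : ∃ k₁ : ℕ, (k₁ : ℤ) = if up then (N : ℤ) - lo else hi - N :=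
    ⟨(if up then (N : ℤ) - lo else hi - N).toNat, by
      rw [Int.toNat_of_nonneg]; split_ifs <;> omega⟩
  obtain ⟨k₂, hk₂⟩ : ∃ k₂ : ℕ, (k₂ : ℤ) = hi - lo := ⟨hi - lo, by omega⟩
  obtain ⟨k₃, hk₃⟩ : ∃ k₃ : ℕ, (k₃ : ℤ) = if up then (hi : ℤ) - N - m else N + m - lo :=
    ⟨(if up then (hi : ℤ) - N - m else N + m - lo).toNat, by
      rw [Int.toNat_of_nonneg]; split_ifs <;> omega⟩
  have h1 : A = sgn (!up) * k₁ := by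
    rw [hA, hk₁]; cases up <;> simp [sgn]
  have h2 : B = A + sgn up * k₂ := by
    rw [hA, hB, hk₂]; cases up <;> simp [sgn]
  have h3 : m = B + sgn (!up) * k₃ := by
    rw [hB, hk₃]; cases up <;> simp [sgn]
  have hscan := foldl_scanStep_sweepWord (c := c) (k₃ := k₃) h1 h2
  have hrange : ∀ j : ℕ, (0 ≤ sgn up * ((j : ℤ) - N - A) ∧ sgn up * ((j : ℤ) - N - A) ≤ k₂) ↔
      lo ≤ j ∧ j ≤ hi := by
    intro j
    rw [hA, hk₂]
    cases up <;> simp [sgn]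
    omega
  refine ⟨k₁, k₂, k₃, A, B, up, rfl, hA, hB, h1, h2, h3, ?_, ?_, ?_⟩
  · rw [height, hscan, ← h3]
  · rw [← e7]
    refine Finset.sum_congr rfl fun j hj => ?_
    have hj := Finset.mem_range.1 hj
    rw [window, coef, hscan]
    simp only [hrange]
    by_cases hj' : lo ≤ j ∧ j ≤ hi
    · rw [if_pos hj', hc j hj]
    · rw [if_neg hj']
      have : c' j = 0 := by
        by_contra hne
        exact hj' (e6 j hne)
      rw [this]
  · rw [length_sweepWord, repCost]
    have hsum : ∑ i ∈ Finset.range (k₂ + 1), (c (A + sgn up * i)).natAbs ≤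
        ∑ j ∈ Finset.range T, (c' j).natAbs := by
      have hidx : ∀ i : ℕ, i < k₂ + 1 → 0 ≤ A + sgn up * i + N ∧ A + sgn up * i + N < T := by
        intro i hi'
        rw [hA]
        cases up <;> simp [sgn] <;> omega
      have himg : (Finset.range (k₂ + 1)).image (fun i : ℕ => (A + sgn up * i + N).toNat) ⊆
          Finset.range T := by
        intro j hj
        obtain ⟨i, hi', rfl⟩ := Finset.mem_image.1 hj
        have := hidx i (Finset.mem_range.1 hi')
        rw [Finset.mem_range]; omega
      refine le_trans (le_of_eq ?_) (Finset.sum_le_sum_of_subset himg)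
      rw [Finset.sum_image]
      · refine Finset.sum_congr rfl fun i hi' => ?_
        have := hidx i (Finset.mem_range.1 hi')
        rw [← hc _ (by omega)]
        congr 2
        omega
      · intro i hi' i' hi'' heq
        have := hidx i (by simpa using hi')
        have := hidx i' (by simpa using hi'')
        dsimp only at heq
        cases hup' : up <;> simp only [hup', sgn] at * <;> simp at * <;> omega
    have hsum' : (∑ i ∈ Finset.range (k₂ + 1), ((c (A + sgn up * i)).natAbs : ℤ)) ≤
        ∑ j ∈ Finset.range T, |c' j| := by
      have : ∑ j ∈ Finset.range T, |c' j| = ((∑ j ∈ Finset.range T, (c' j).natAbs : ℕ) : ℤ) := by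
        push_cast; rfl
      rw [this]
      exact_mod_cast hsum
    have hk : (k₁ : ℤ) + k₂ + k₃ = 2 * ((hi : ℤ) - lo) - |m| := by
      rw [hk₁, hk₂, hk₃]
      by_cases hm : 0 ≤ m
      · simp only [hup, hm, decide_true, if_true, abs_of_nonneg hm]; ring
      · simp only [hup, hm, decide_false, abs_of_neg (not_le.1 hm)]; simp; ring
    push_cast
    linarith

/-! ### The geodesic -/

/-- The program that computes a geodesic word, and prints it or counts its letters. -/
def geodesic (p : ℕ) (pr : Bool) : Cmd :=
  .seq readWord (.seq (dp p) (.seq backtrack (emitWord pr)))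

/-- What the program achieves on the input that consists of a word and of the symbols `r`. -/
structure GeodesicState (p : ℕ) (pr : Bool) (w : Word) (r : List ℤ) (v : Word)
    (s : St Var Arr) : Prop where
  value : value p v = value p w
  geodesic : IsGeodesic p v
  length_le : v.length ≤ w.length
  out : s.out = if pr then encodeWord v else []
  cnt : s.v .cnt = if pr then 0 else (v.length : ℤ)
  sym : s.v .sym = r.headD 0
  inp : s.inp = r.tail

/-- The number of letters in a word representing the same element bounds the cost of the
cheapest path. The `2` stands for the top height of the interval visited: there is one more height
than there are steps between heights. -/
theorem Optimal.le_length {p : ℕ} (hp : 2 ≤ p) {w u : Word} {I : ℤ} {B L : Fin 15 → ℕ → ℤ}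
    {v : Fin 15 → ℤ} {e : ℕ → ℤ} (he : ∀ j, |e j| ≤ p - 1)
    (hsum : ∑ j ∈ Finset.range (3 * w.length + 2), e j * (p : ℤ) ^ j =
      ∑ j ∈ Finset.range (3 * w.length + 2), window w.length (coef w) j * (p : ℤ) ^ j)
    (h : Optimal p (forced w.length (height w)) e I B L (3 * w.length + 2) v)
    (hu : u.length ≤ w.length) (huw : value p u = value p w) :
    v finalState ≤ u.length + |height w| + 2 := by
  have hT : 2 * w.length < 3 * w.length + 2 := by omega
  obtain ⟨hh, hX⟩ := (value_eq_iff (by omega) hT hu le_rfl).1 huw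
  obtain ⟨lo, hi, hrep, hcost⟩ := exists_rep p hT u hu
  rw [hX, hh] at hrep
  rw [hh] at hcost
  have hm := abs_height_le w
  obtain ⟨hi', c', hrep', hcost', hc1, hc2⟩ := hrep.exists_reduced hp
    (by push_cast; omega : (2 * (w.length : ℤ) + (u.length + |height w|) + 2 : ℤ) <
      2 * ((3 * w.length + 2 : ℕ) : ℤ)) hcost
  have hnn : 0 ≤ ∑ j ∈ Finset.range (3 * w.length + 2), |c' j| :=
    Finset.sum_nonneg fun _ _ => abs_nonneg _
  have hlo := hrep'.lo_le
  have hhi : hi' + 1 < 3 * w.length + 2 := by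
    unfold repCost at hcost'; omega
  have hpath := hrep'.path hp hc1 hc2 hhi he hsum (f := forced w.length (height w)) (by
    intro j hj
    simp only [forced, decide_eq_true_eq] at hj
    have := hrep'.lo_le'
    have := hrep'.le_hi
    have := hrep'.le_hi'
    omega)
  have := h.le_path _ _ hpath
  linarith

/-- The exponents of `a` in a word are small in total and vanish above the window of the word. -/
theorem sum_abs_window_coef_le (w : Word) :
    (∑ j ∈ Finset.range (3 * w.length + 2), |window w.length (coef w) j|) ≤ w.length ∧
      ∀ j, 2 * w.length < j → window w.length (coef w) j = 0 := by
  obtain ⟨lo, hi, hrep, hcost⟩ := exists_rep 0 (N := w.length) (T := 3 * w.length + 2)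
    (by omega) w le_rfl
  have h1 := hrep.lo_le
  have h2 := hrep.lo_le'
  have h3 := hrep.le_hi
  have h4 := hrep.le_hi'
  have hm : |height w| ≤ (hi : ℤ) - lo := by rw [abs_le]; omega
  have hnn : 0 ≤ ∑ j ∈ Finset.range (3 * w.length + 2), |window w.length (coef w) j| :=
    Finset.sum_nonneg fun _ _ => abs_nonneg _
  unfold repCost at hcost
  refine ⟨by linarith, fun j hj => ?_⟩
  by_contra hne
  have := (hrep.supp j hne).2
  omega

/-- The factor in the running time. -/
def geodesicTime (p : ℕ) : ℕ :=
  readInit.cost + readLetter.cost + dpInit.cost + 3 * (dpStep p).cost + 3 * backStep.cost + 100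

/-- The output is geodesic: its length is at most the cost of the cheapest path, minus `|m| + 2`, and
by `Optimal.le_length` no word for the same element is shorter. -/
theorem geodesic_ends {p : ℕ} (hp : 2 ≤ p) (pr : Bool) (w : Word) {r : List ℤ}
    (hr : r.headD 0 ∈ ([0, 3, -3] : List ℤ)) :
    (geodesic p pr).Ends (St.init Var Arr (encodeWord w ++ r))
      (geodesicTime p * (w.length + 1)) fun s => ∃ v, GeodesicState p pr w r v s := by
  obtain ⟨hD, hD0⟩ := sum_abs_window_coef_le w
  have hm := abs_height_le w
  have hheight := abs_le.1 hm
  have htotal : readInit.cost + ((readLetter.cost + 1) * w.length + 1) +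
      (dpInit.cost + (7 * w.length + (7 + (dpStep p).cost) * (3 * w.length + 2) + 1) +
      (3 + ((backStep.cost + 1) * (3 * w.length + 2) + 1) + (7 * w.length + 8))) ≤
      geodesicTime p * (w.length + 1) := by
    unfold geodesicTime
    nlinarith [Nat.zero_le (readInit.cost * w.length), Nat.zero_le (dpInit.cost * w.length)]
  refine Prog.Ends.mono ((readWord_ends w hr).seq fun s1 h1 => ?_) htotal fun _ h => h
  have hdp := dp_ends hp (N := w.length) h1.bot h1.top
    (by rw [h1.dig]; exact hD)
  rw [h1.m, h1.dig] at hdp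
  refine hdp.seq fun s2 h2 => ?_
  set D := window w.length (coef w) with hDdef
  set T := 3 * w.length + 2 with hT
  have hopt := h2.opt
  rw [h1.inf] at hopt
  have he : ∀ j, |digit p D j| ≤ p - 1 := abs_digit_le (by omega) D
  have hsum : ∑ j ∈ Finset.range T, digit p D j * (p : ℤ) ^ j =
      ∑ j ∈ Finset.range T, D j * (p : ℤ) ^ j := by
    rw [← sum_digit p D T, carryIn_eq_zero hp hD0 ?_ (by omega : 3 * w.length + 1 ≤ T), zero_mul,
      add_zero]
    refine le_trans (Finset.sum_le_sum_of_subset_of_nonneg ?_ fun _ _ _ => abs_nonneg _) hD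
    exact Finset.range_subset_range.2 (by omega)
  have hle : ∀ u : Word, u.length ≤ w.length → value p u = value p w →
      s2.v (.old finalState) ≤ u.length + |height w| + 2 :=
    fun u hu huw => hopt.le_length hp he hsum hu huw
  -- The word itself shows that the cheapest path obeys the bound.
  have hfin := hle w le_rfl rfl
  obtain ⟨qs, hq0, hqT, hqs, hx⟩ := (hopt.traced finalState (by omega)).exists_states
  obtain ⟨lo, hi, hphase, hrep, hcost⟩ := exists_rep_of_states (N := w.length) (m := height w)
    (by omega) (by omega) (by omega) hsum hq0 hqT fun j hj => (hqs j hj).1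
  rw [← hx] at hcost
  have hlohi : lo ≤ hi := hrep.lo_le.trans hrep.le_hi
  have hhi : hi + 1 < T := by
    have h3 := hphase (T - 1) (by omega)
    rw [show T - 1 + 1 = T by omega, hqT] at h3
    have h4 : phase finalState = 2 := rfl
    rw [h4] at h3
    by_contra hcon
    by_cases h5 : T - 1 < lo
    · rw [if_pos h5] at h3
      omega
    · rw [if_neg h5, if_pos (by omega)] at h3
      omega
  refine Prog.Ends.seq (backtrack_ends (N := w.length) (T := T) hlohi hhi
    (h2.bot.trans h1.bot) (by rw [h2.top, h1.top]; push_cast [hT]; ring) hqT hphase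
    (fun j hj => (hqs j hj).2.1) (c := fun j =>
      label p (digit p D j) (qs j) (qs (j + 1))) (fun j hj => (hqs j hj).2.2)) fun s3 h3 => ?_
  obtain ⟨k₁, k₂, k₃, A, B, up, hup, hA, hB, e1, e2, e3, hvh, hvX, hvl⟩ :=
    sweepWord_spec (c := s3.a .out) hrep (fun j hj => by
      rw [if_pos hj]; exact h3.out j (Nat.zero_le _) hj)
  have hm3 : s3.v .m = height w := by rw [h3.m, h2.m, h1.m]
  have hlo3 : s3.v .lo = lo - w.length := h3.lo (Nat.zero_le _)
  have hhi3 : s3.v .hi = hi - w.length := h3.hi (Nat.zero_le _)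
  set v := sweepWord up (s3.a .out) A B k₁ k₂ k₃ with hv
  have hvle : (v.length : ℤ) ≤ s2.v (.old finalState) - 2 - |height w| := by linarith
  have hvw : v.length ≤ w.length := by omega
  have hval : value p v = value p w :=
    (value_eq_iff (by omega) (T := T) (by omega) hvw le_rfl).2 ⟨hvh, hvX⟩
  refine Prog.Ends.mono (emitWord_ends pr (s := s3) (by rw [hm3]; exact hup)
    (by rw [hlo3, hhi3]; exact hA) (by rw [hlo3, hhi3]; exact hB) e1 e2 (by rw [hm3]; exact e3))
    (by rw [← hv]; omega) fun s4 h4 => ⟨v, hval, fun u hu => ?_, hvw, ?_, ?_, ?_, ?_⟩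
  · by_cases hul : u.length ≤ w.length
    · have := hle u hul (hu.trans hval)
      omega
    · omega
  · rw [h4.out, h3.output, h2.out, h1.out, List.nil_append]
  · rw [h4.cnt, h3.cnt, h2.cnt, h1.cnt, zero_add]
  · rw [h4.v _ (by simp) (by simp) (by simp), h3.sym, h2.sym, h1.sym]
  · rw [h4.inp, h3.inp, h2.inp, h1.inp]

/-! ### Comparison with a number in binary -/

/-- Appends a binary digit to the number `v`, unless `v` exceeds `c` already. Without the cut-off, the
number would outgrow the registers. -/
def appendDigit (c v : ℕ) (b : Bool) : ℕ := if c < v then v else 2 * v + b.toNat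

theorem le_appendDigit (c v : ℕ) (b : Bool) : v ≤ appendDigit c v b := by
  unfold appendDigit; split_ifs <;> omega

theorem foldl_appendDigit_le (c : ℕ) (L : List Bool) : L.foldl (appendDigit c) 0 ≤ 2 * c + 1 := by
  induction L using List.reverseRecOn with
  | nil => simp
  | append_singleton L b ih =>
    rw [List.foldl_append]
    simp only [List.foldl_cons, List.foldl_nil, appendDigit]
    have := b.toNat_le
    split_ifs <;> omega

theorem lt_foldl_appendDigit (c : ℕ) (L : List Bool) :
    c < L.foldl (appendDigit c) 0 ↔ c < L.foldl (fun v b => 2 * v + b.toNat) 0 := by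
  have key : (c < L.foldl (appendDigit c) 0 ∧ c < L.foldl (fun v b => 2 * v + b.toNat) 0) ∨
      L.foldl (appendDigit c) 0 = L.foldl (fun v b => 2 * v + b.toNat) 0 := by
    induction L using List.reverseRecOn with
    | nil => simp
    | append_singleton L b ih =>
      simp only [List.foldl_append, List.foldl_cons, List.foldl_nil, appendDigit]
      split_ifs <;> omega
  omega

theorem foldl_bits_reverse (n : ℕ) :
    n.bits.reverse.foldl (fun v b => 2 * v + b.toNat) 0 = n := by
  rw [List.foldl_reverse]
  induction n using Nat.binaryRec' with
  | zero => simp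
  | bit b n h ih =>
    rw [Nat.bits_append_bit n b h, List.foldr_cons, ih, Nat.bit_val]

/-- Appends the digit given by the last symbol to `val` and reads the next symbol. Doubling `val`
takes time proportional to its growth. -/
def compareStep : Cmd :=
  .seq (.ite (.var .cnt) (.var .val) .skip
      (.seq (.set .x (.var .val))
        (.seq (.while (.lit 0) (.var .x) (.seq (.inc .val 1) (.inc .x (-1))))
          (.ite (.lit 4) (.var .sym) (.inc .val 1) .skip))))
    (.read .sym)

/-- Decides whether `cnt` is less than the integer whose sign has just been read. -/
def compare : Cmd :=
  .ite (.var .sym) (.lit 0) (.print (.lit 0))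
    (.seq (.seq (.set .val (.lit 0)) (.read .sym))
      (.seq (.while (.lit 0) (.var .sym) compareStep)
        (.ite (.var .cnt) (.var .val) (.print (.lit 1)) (.print (.lit 0)))))

/-- The state when the digits `L` are ahead and the digits read so far have given `v`. -/
structure CompareState (c v : ℕ) (L : List Bool) (s : St Var Arr) : Prop where
  cnt : s.v .cnt = c
  val : s.v .val = v
  sym : s.v .sym = (L.map fun b => if b then (5 : ℤ) else 4).headD 0
  inp : s.inp = (L.map fun b => if b then (5 : ℤ) else 4).tail
  out : s.out = []

theorem double_ends {c v : ℕ} {L : List Bool} {s : St Var Arr} (h : CompareState c v L s) :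
    (Prog.while (.lit 0) (.var .x) (.seq (.inc .val 1) (.inc .x (-1))) : Cmd).Ends
      (s.setv .x v) (3 * v + 1) (CompareState c (2 * v) L) := by
  obtain ⟨h1, h2, h3, h4, h5⟩ := h
  refine (Prog.Ends.while v (fun _ => 2) (fun i s => CompareState c (v + i) L s ∧
    s.v .x = v - i) ?_ (fun i hi s1 hs1 => ?_) fun s1 hs1 => ?_).mono ?_ ?_
  · refine ⟨⟨?_, ?_, ?_, ?_, ?_⟩, ?_⟩ <;> simp [St.setv, *]
  · obtain ⟨⟨e1, e2, e3, e4, e5⟩, e6⟩ := hs1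
    refine ⟨by simp only [Atom.val, e6]; omega, _, Prog.Run.seq .inc .inc, ⟨?_, ?_, ?_, ?_, ?_⟩, ?_⟩
    all_goals simp [St.setv, *]
    all_goals ring
  · simp only [Atom.val, hs1.2]; omega
  · simp; omega
  · rintro s1 ⟨hs1, -⟩
    rwa [two_mul]

theorem compareStep_ends {c v : ℕ} {b : Bool} {L : List Bool} {s : St Var Arr}
    (h : CompareState c v (b :: L) s) :
    compareStep.Ends s (6 + 3 * (appendDigit c v b - v))
      (CompareState c (appendDigit c v b) L) := by
  have hread : ∀ s, CompareState c (appendDigit c v b) (b :: L) s →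
      (Prog.read .sym : Cmd).Ends s 1 (CompareState c (appendDigit c v b) L) := by
    intro s h
    obtain ⟨h1, h2, h3, h4, h5⟩ := h
    refine ⟨_, .read, ?_, ?_, ?_, ?_, ?_⟩ <;> simp [St.setv, *]
  by_cases hc : c < v
  · have hv : appendDigit c v b = v := by rw [appendDigit, if_pos hc]
    refine (Prog.Ends.seq (.ite_pos ?_ ⟨s, .skip, ?_⟩) hread).mono (by omega) fun _ h => h
    · simp only [Atom.val, h.cnt, h.val]; exact_mod_cast hc
    · rwa [hv]
  · have hv : appendDigit c v b = 2 * v + b.toNat := by rw [appendDigit, if_neg hc]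
    refine (Prog.Ends.seq (.ite_neg ?_ (Prog.Ends.seq (t := 1)
      (Q := fun s1 => s1 = s.setv .x v) ⟨_, .set, ?_⟩ fun s1 h1 =>
        Prog.Ends.seq (t := 3 * v + 1) (t' := 2) (Q := CompareState c (2 * v) (b :: L)) ?_
          fun s2 h2 => ?_)) hread).mono (by omega) fun _ h => h
    · simp only [Atom.val, h.cnt, h.val]; exact_mod_cast hc
    · rw [Atom.val, h.val]
    · rw [h1]; exact double_ends h
    · rw [hv]
      obtain ⟨e1, e2, e3, e4, e5⟩ := h2
      cases b
      · exact .ite_neg (by simp [Atom.val, e3]) ⟨_, .skip, e1, e2, e3, e4, e5⟩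
      · refine .ite_pos (by simp [Atom.val, e3]) ⟨_, .inc, ?_, ?_, ?_, ?_, ?_⟩ <;>
          simp [St.setv, *]

theorem compare_ends {c : ℕ} {k : ℤ} {s : St Var Arr} (hcnt : s.v .cnt = c)
    (hsym : s.v .sym = (encodeInt k).headD 0) (hinp : s.inp = (encodeInt k).tail)
    (hout : s.out = []) :
    compare.Ends s (13 * (c + (encodeInt k).length + 1))
      fun s' => s'.out = [if (c : ℤ) < k then 1 else 0] := by
  rcases lt_or_ge k 0 with hk | hk
  · refine Prog.Ends.mono (t := 1 + 1) (.ite_pos ?_ ⟨_, .print, ?_⟩) (by omega) fun _ h => h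
    · simp only [Atom.val, hsym, encodeInt, if_neg (not_le.2 hk)]; simp
    · rw [if_neg (by omega)]; simp [hout, Atom.val]
  · obtain ⟨L, hL⟩ : ∃ L, L = k.natAbs.bits.reverse := ⟨_, rfl⟩
    have henc : encodeInt k = 3 :: L.map fun b => if b then (5 : ℤ) else 4 := by
      rw [encodeInt, if_pos hk, hL]
    rw [henc] at hsym hinp ⊢
    obtain ⟨V, hV⟩ : ∃ V : ℕ → ℕ, V = fun i => (L.take i).foldl (appendDigit c) 0 := ⟨_, rfl⟩
    have hsucc : ∀ i (hi : i < L.length), V (i + 1) = appendDigit c (V i) L[i] := by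
      intro i hi
      simp only [hV, List.take_succ_eq_append_getElem hi, List.foldl_append, List.foldl_cons,
        List.foldl_nil]
    have hmono : Monotone V := by
      refine monotone_nat_of_le_succ fun i => ?_
      rcases lt_or_ge i L.length with hi | hi
      · rw [hsucc i hi]; exact le_appendDigit _ _ _
      · simp only [hV, List.take_of_length_le hi, List.take_of_length_le (hi.trans (Nat.le_succ _)),
          le_refl]
    have hVL : V L.length = L.foldl (appendDigit c) 0 := by simp [hV]
    have hV0 : V 0 = 0 := by simp [hV]
    have hle := foldl_appendDigit_le c L
    have hiff := lt_foldl_appendDigit c L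
    rw [hL, foldl_bits_reverse, ← hL, ← hVL] at hiff
    rw [← hVL] at hle
    refine Prog.Ends.mono (.ite_neg ?_ (Prog.Ends.seq (t := 2)
      (t' := ∑ i ∈ Finset.range L.length, (6 + 3 * (V (i + 1) - V i) + 1) + 1 + 2) (Q := CompareState c (V 0) L)
      ⟨_, .seq .set .read, ?_⟩ fun s1 h1 => Prog.Ends.seq (Prog.Ends.while L.length
        (fun i => 6 + 3 * (V (i + 1) - V i)) (fun i => CompareState c (V i) (L.drop i)) h1
        (fun i hi s2 h2 => ?_) fun s2 h2 => ?_) fun s2 h2 => ?_)) ?_ fun _ h => h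
    · simp [Atom.val, hsym]
    · refine ⟨?_, ?_, ?_, ?_, ?_⟩ <;> simp [St.setv, *, Atom.val]
    · rw [List.drop_eq_getElem_cons hi] at h2
      refine ⟨?_, ?_⟩
      · simp only [Atom.val, h2.sym, List.map_cons, List.headD_cons]
        split_ifs <;> simp
      · rw [hsucc i hi]; exact compareStep_ends h2
    · simp [Atom.val, h2.sym]
    · by_cases hlt : c < V L.length
      · refine .ite_pos (t := 1) ?_ ⟨_, .print, ?_⟩
        · simp only [Atom.val, h2.cnt, h2.val]; exact_mod_cast hlt
        · rw [if_pos (by have := hiff.1 hlt; omega)]; simp [h2.out, Atom.val]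
      · refine .ite_neg (t := 1) ?_ ⟨_, .print, ?_⟩
        · simp only [Atom.val, h2.cnt, h2.val]; exact_mod_cast hlt
        · rw [if_neg fun h => hlt (hiff.2 (by omega))]; simp [h2.out, Atom.val]
    · simp only [Finset.sum_add_distrib, ← Finset.mul_sum, Finset.sum_range_tsub hmono, hV0,
        Finset.sum_const, Finset.card_range, smul_eq_mul, List.length_cons, List.length_map]
      omega

theorem geodesicLength_eq {p : ℕ} {v w : Word} (h : value p v = value p w)
    (hv : IsGeodesic p v) : geodesicLength p w = v.length := by
  refine le_antisymm (Nat.sInf_le ⟨v, h, rfl⟩) (le_csInf ⟨_, v, h, rfl⟩ ?_)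
  rintro k ⟨u, hu, rfl⟩
  exact hv u (hu.trans h.symm)

theorem natAbs_le_of_mem_encodeWord {w : Word} {z : ℤ} (hz : z ∈ encodeWord w) :
    z.natAbs ≤ 5 := by
  obtain ⟨⟨g, b⟩, -, rfl⟩ := List.mem_map.1 hz
  cases g <;> cases b <;> simp [letterCode]

theorem natAbs_le_of_mem_encodeInt {k z : ℤ} (hz : z ∈ encodeInt k) : z.natAbs ≤ 5 := by
  rcases List.mem_cons.1 hz with rfl | hz
  · split_ifs <;> simp
  · obtain ⟨b, -, rfl⟩ := List.mem_map.1 hz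
    cases b <;> simp

theorem solvable_geodesicProblem {p : ℕ} (hp : 2 ≤ p) :
    RAM.LinearTimeQuasilinearSpaceSolvable encodeWord (geodesicProblem p) := by
  refine RAM.solvable_of_prog (geodesic p true) (geodesicTime p)
    (fun w z => natAbs_le_of_mem_encodeWord) fun w => ?_
  obtain ⟨s, hrun, v, h⟩ := geodesic_ends hp true w (r := []) (by simp)
  rw [List.append_nil] at hrun
  exact ⟨s, by simpa [encodeWord] using hrun, v, by simpa using h.out, h.value, h.geodesic⟩

theorem solvable_geodesicLengthProblem {p : ℕ} (hp : 2 ≤ p) :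
    RAM.LinearTimeQuasilinearSpaceSolvable encodeWord (geodesicLengthProblem p) := by
  refine RAM.solvable_of_prog (.seq (geodesic p false) (.print (.var .cnt))) (geodesicTime p + 1)
    (fun w z => natAbs_le_of_mem_encodeWord) fun w => ?_
  obtain ⟨s, hrun, v, h⟩ := geodesic_ends hp false w (r := []) (by simp)
  rw [List.append_nil] at hrun
  refine ⟨_, .mono (.seq hrun .print) ?_, ?_⟩
  · simp only [encodeWord, List.length_map]; nlinarith
  · simp [geodesicLengthProblem, Atom.val, h.out, h.cnt, geodesicLength_eq h.value h.geodesic]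

theorem solvable_boundedGeodesicLengthProblem {p : ℕ} (hp : 2 ≤ p) :
    RAM.LinearTimeQuasilinearSpaceSolvable encodeWordInt (boundedGeodesicLengthProblem p) := by
  refine RAM.solvable_of_prog (.seq (geodesic p false) compare) (geodesicTime p + 13)
    (fun x z hz => ?_) fun ⟨w, k⟩ => ?_
  · rcases List.mem_append.1 hz with hz | hz
    · exact natAbs_le_of_mem_encodeWord hz
    · exact natAbs_le_of_mem_encodeInt hz
  · obtain ⟨s, hrun, v, h⟩ := geodesic_ends hp false w (r := encodeInt k) (by
      rw [encodeInt, List.headD_cons]; split_ifs <;> simp)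
    obtain ⟨s', hrun', h'⟩ := compare_ends (by simpa using h.cnt) h.sym h.inp (by simpa using h.out)
    refine ⟨s', .mono (.seq hrun hrun') ?_, ?_⟩
    · have := h.length_le
      simp only [encodeWordInt, List.length_append, encodeWord, List.length_map]
      nlinarith [Nat.zero_le (geodesicTime p * (encodeInt k).length)]
    · rw [h', boundedGeodesicLengthProblem, geodesicLength_eq h.value h.geodesic]

end BaumslagSolitar

theorem mainTheorem1 (p : ℕ) (hp : 2 ≤ p) :
    RAM.LinearTimeQuasilinearSpaceSolvable BaumslagSolitar.encodeWord
      (BaumslagSolitar.geodesicProblem p) ∧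
    RAM.LinearTimeSolvable BaumslagSolitar.encodeWord
      (BaumslagSolitar.geodesicProblem p) ∧
    RAM.LinearTimeSolvable BaumslagSolitar.encodeWord
      (BaumslagSolitar.geodesicLengthProblem p) ∧
    RAM.LinearTimeSolvable BaumslagSolitar.encodeWordInt
      (BaumslagSolitar.boundedGeodesicLengthProblem p) :=
  ⟨BaumslagSolitar.solvable_geodesicProblem hp,
    (BaumslagSolitar.solvable_geodesicProblem hp).linearTimeSolvable,
    (BaumslagSolitar.solvable_geodesicLengthProblem hp).linearTimeSolvable,
    (BaumslagSolitar.solvable_boundedGeodesicLengthProblem hp).linearTimeSolvable⟩
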